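/- \textbf{Notation.} Let $\mathbb R^{n\times n}_{\rm sym}$ carry the Euclidean norm $|\sigma|^2=\sum_{i,j}\sigma_{ij}^2$. A Borel-measurable, locally bounded function $f:\mathbb R^{n\times n}_{\rm sym}\to\mathbb R$ is \emph{symmetric div-quasiconvex} if $$f\Bigl(\int_{(0,1)^n}\varphi\,dx\Bigr)\le\int_{(0,1)^n}f(\varphi)\,dx$$ for all $\varphi\in C^\infty_{\rm per}((0,1)^n;\mathbb R^{n\times n}_{\rm sym})$ with $\operatorname{div}\varphi=0$, where $C^\infty_{\rm per}$ denotes smooth functions on $\mathbb R^n$ that are $1$-periodic in each variable. The envelope of $f$ is $$Q_{\rm sd}f(\xi)=\inf\Bigl\{\int_{(0,1)^n} f(\varphi)\,dx:\ \varphi\in C^\infty_{\rm per}((0,1)^n;\mathbb R^{n\times n}_{\rm sym}),\ \operatorname{div}\varphi=0,\ \int_{(0,1)^n}\varphi\,dx=\xi\Bigr\}.$$ For a nonempty compact set $K\subseteq\mathbb R^{n\times n}_{\rm sym}$ and $1<r<\infty$ let $K^{(r)}=\{\xi: Q_{\rm sd}(\operatorname{dist}^r(\cdot,K))(\xi)=0\}$,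 and let $K^{(\infty)}$ be the set of all $\xi$ with $g(\xi)\le\max g(K)$ for every symmetric div-quasiconvex $g\in C^0(\mathbb R^{n\times n}_{\rm sym};[0,\infty))$. The hull $K^{\rm sdqc}$ is the set $K^{(r)}$ for any $r\in(1,\infty)$ (it does not depend on $r$). For $\sigma\in\mathbb R^{3\times3}_{\rm sym}$ let $p(\sigma)=\frac13\operatorname{Tr}\sigma$, $q(\sigma)=|\sigma-p(\sigma)\mathrm{Id}|/\sqrt2$ and $\Phi(\sigma)=(p(\sigma),q(\sigma))$. For $H\subseteq\mathbb R\times[0,\infty)$ let $$\hat H=\{(p,q)\in\mathbb R\times[0,\infty):\ (p,q+a)\in H\text{ for some }a\ge0\}.$$ A point $y_*$ \emph{can be separated from $\hat H$} if there is $y_0=(p_0,q_0)\in\mathbb R\times[0,\infty)$ such that $f_{y_0}(p,q)=4(q^2-q_0^2)-3(p-p_0)^2$ satisfies $\max f_{y_0}(H)<f_{y_0}(y_*)$. Let $H^{\rm sdqc}$ be the set of points of the convex hull of $\hat H$ that cannot be separated from $\hat H$. \textbf{Theorem.} Let $H\subseteq\mathbb R\times[0,\infty)$ be compact, and let $K=\{\sigma\in\mathbb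 R^{3\times3}_{\rm sym}:\Phi(\sigma)\in H\}$. Assume that $H^{\rm sdqc}$ is connected (in particular nonempty), and that at every $y_*\in\partial H^{\rm sdqc}\setminus\hat H$ each tangent direction $e=(e_1,e_2)$ to $\partial H^{\rm sdqc}$ satisfies $|e_2|\le\frac{\sqrt3}{4}|e_1|$; here $\partial H^{\rm sdqc}$ is the boundary in $\mathbb R^2$, and $e$ is a tangent direction at $y_*$ if $e=\lim_k\lambda_k(y_k-y_*)$ for some $\lambda_k\in\mathbb R$ and $y_k\in\partial H^{\rm sdqc}$ with $y_k\to y_*$. Then $$K^{\rm sdqc}=K^{(\infty)}=\{\sigma\in\mathbb R^{3\times3}_{\rm sym}:\Phi(\sigma)\in H^{\rm sdqc}\},$$ that is, $K^{(r)}=K^{(\infty)}=\{\sigma:\Phi(\sigma)\in H^{\rm sdqc}\}$ for every $r\in(1,\infty)$. -/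

import Mathlib

open Set Filter Topology MeasureTheory
open scoped ContDiff

namespace SymDivQC

noncomputable section

/- Matrices carry the Euclidean (Frobenius) norm `|σ|² = ∑ᵢⱼ σᵢⱼ²`. -/
attribute [local instance] Matrix.frobeniusNormedAddCommGroup Matrix.frobeniusNormedSpace

/-- The subspace of symmetric matrices in the space of real `n × n` matrices. -/
def symSubmodule (n : ℕ) : Submodule ℝ (Matrix (Fin n) (Fin n) ℝ) where
  carrier := {A | A.IsSymm}
  add_mem' hA hB := Matrix.IsSymm.add hA hB
  zero_mem' := Matrix.isSymm_zero
  smul_mem' c _ hA := Matrix.IsSymm.smul hA c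

/-- The space of real symmetric `n × n` matrices, as a type of its own, with the Euclidean
(Frobenius) norm. -/
def Sym (n : ℕ) : Type := symSubmodule n

instance (n : ℕ) : NormedAddCommGroup (Sym n) :=
  inferInstanceAs (NormedAddCommGroup (symSubmodule n))

instance (n : ℕ) : NormedSpace ℝ (Sym n) :=
  inferInstanceAs (NormedSpace ℝ (symSubmodule n))

/-- The matrix underlying an element of `Sym n`. -/
def Sym.mat {n : ℕ} (σ : Sym n) : Matrix (Fin n) (Fin n) ℝ := Subtype.val σ

/-- The open unit cube `(0,1)ⁿ`. -/
def cube (n : ℕ) : Set (Fin n → ℝ) := Set.pi Set.univ fun _ => Set.Ioo (0 : ℝ) 1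

/-- Smooth, `(0,1)ⁿ`-periodic, divergence-free fields of symmetric matrices; the divergence is
taken row by row, `(div φ)ᵢ = ∑ⱼ ∂ⱼ φᵢⱼ`. -/
structure IsTestField {n : ℕ} (φ : (Fin n → ℝ) → Sym n) : Prop where
  smooth : ContDiff ℝ ∞ φ
  periodic : ∀ (x : Fin n → ℝ) (i : Fin n), φ (x + Pi.single i 1) = φ x
  div_eq_zero : ∀ (x : Fin n → ℝ) (i : Fin n),
    ∑ j : Fin n,
      fderiv ℝ (fun y => (φ y).mat i j) x (Pi.single j 1) = 0

/-- Symmetric div-quasiconvexity: `f` is Borel measurable, locally bounded, and satisfies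
`f (∫ φ) ≤ ∫ f (φ)` on the unit cube for all smooth periodic divergence-free `φ`. -/
structure SymmDivQuasiconvex {n : ℕ} (f : Sym n → ℝ) : Prop where
  borel_measurable : Measurable[borel (Sym n)] f
  locally_bounded : ∀ ξ, ∃ U ∈ 𝓝 ξ, ∃ C : ℝ, ∀ η ∈ U, |f η| ≤ C
  le_integral : ∀ φ : (Fin n → ℝ) → Sym n, IsTestField φ →
    f (∫ x in cube n, φ x) ≤ ∫ x in cube n, f (φ x)

/-- The symmetric div-quasiconvex envelope of `f`. -/
def envelope {n : ℕ} (f : Sym n → ℝ) (ξ : Sym n) : ℝ :=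
  sInf {r | ∃ φ : (Fin n → ℝ) → Sym n,
    IsTestField φ ∧ ∫ x in cube n, φ x = ξ ∧ r = ∫ x in cube n, f (φ x)}

/-- The hull `K^(p)` of a nonempty compact set `K`, for finite `p`: the zero set of the envelope
of `dist(·, K)^p`. -/
def hull {n : ℕ} (p : ℝ) (K : Set (Sym n)) : Set (Sym n) :=
  {ξ | envelope (fun η => Metric.infDist η K ^ p) ξ = 0}

/-- The hull `K^(∞)` of a nonempty compact set `K`: all `ξ` with `g(ξ) ≤ max g(K)` for every
continuous, nonnegative, symmetric div-quasiconvex `g`. -/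
def hullInfty {n : ℕ} (K : Set (Sym n)) : Set (Sym n) :=
  {ξ | ∀ g : Sym n → ℝ, Continuous g → (∀ η, 0 ≤ g η) → SymmDivQuasiconvex g →
    g ξ ≤ sSup (g '' K)}

/-- The pressure `p(σ) = tr σ / 3`. -/
def pressure (σ : Sym 3) : ℝ := (1 / 3) * σ.mat.trace

/-- The effective shear stress `q(σ) = |σ - p(σ) Id| / √2`. -/
def shear (σ : Sym 3) : ℝ :=
  ‖σ.mat - pressure σ • (1 : Matrix (Fin 3) (Fin 3) ℝ)‖ / √2

/-- The map `Φ = (p, q)`. -/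
def Phi (σ : Sym 3) : ℝ × ℝ := (pressure σ, shear σ)

/-- `Ĥ`: all points of the upper half-plane lying on or below a point of `H`. -/
def hat (H : Set (ℝ × ℝ)) : Set (ℝ × ℝ) :=
  {y | 0 ≤ y.2 ∧ ∃ a : ℝ, 0 ≤ a ∧ (y.1, y.2 + a) ∈ H}

/-- The function `f_{y₀}(p, q) = 4 (q² - q₀²) - 3 (p - p₀)²`. -/
def sepFun (y₀ y : ℝ × ℝ) : ℝ := 4 * (y.2 ^ 2 - y₀.2 ^ 2) - 3 * (y.1 - y₀.1) ^ 2

/-- `y` can be separated: for some `y₀ ∈ ℝ × [0,∞)` one has `max f_{y₀}(H) < f_{y₀}(y)`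
(`H` is compact, so that the maximum is attained). -/
def Separated (H : Set (ℝ × ℝ)) (y : ℝ × ℝ) : Prop :=
  ∃ y₀ : ℝ × ℝ, 0 ≤ y₀.2 ∧ ∀ z ∈ H, sepFun y₀ z < sepFun y₀ y

/-- `H^sdqc`: the points of the convex hull of `Ĥ` that cannot be separated. -/
def Hsdqc (H : Set (ℝ × ℝ)) : Set (ℝ × ℝ) :=
  {y | y ∈ convexHull ℝ (hat H) ∧ ¬ Separated H y}

end

end SymDivQC

namespace SymDivQC

noncomputable section

attribute [local instance] Matrix.frobeniusNormedAddCommGroup Matrix.frobeniusNormedSpace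

/-! ### Symmetric matrices -/

section SymBasics

variable {n : ℕ}

/-! The function `f_{y₀} ∘ Φ` is, up to a constant, Tartar's form `2|σ|² - (tr σ)² = 4q² - 3p²` plus
a multiple of the pressure. Tartar's form is symmetric div-quasiconvex: it is nonnegative on
symmetric matrices that annihilate a nonzero vector `k`. So the inequalities defining non-separation
should hold on both hulls, and so should those given by the convex functions `q - s p - t`, which
cut out the convex hull of `Ĥ`.

For `K^(∞)` this is immediate, since the positive parts of these functions are admissible
(`tartar_hullInfty`, `convex_hullInfty_le`). For `K^(r)` with `r < 2` the form grows faster than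
`dist^r`, so a sequence that is almost optimal for the envelope cannot be inserted directly. Such
fields `φ` are truncated to bounded fields `g`, which are no longer divergence-free. In Fourier
variables the defect is a pairing of the bounded `g` with second order Riesz transforms of `φ - g`.
Monotonicity of a Bellman function along the heat flow bounds this pairing by an `L log L` quantity
of `φ - g` (`bellman_estimate`, `riesz_estimate`), and `L log L` is dominated by `dist^r` for every
`r > 1` (`llog_le`). This gives `tartar_stability` and `tartar_hull`.

Conversely, each `ξ` with `Φ(ξ) ∈ H^sdqc` is the barycentre of a laminate of order at most two
supported in `K`. Over `Ĥ` a single shear suffices: it keeps `p` and raises `q`. Otherwise `Φ(ξ)`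
lies on or below a hyperbola `4q² - 3p² = αp + β` through two points of `H` on either side
(`exists_hyperbola`). The tangent condition excludes that a chord bounds `H^sdqc` there, since such
a chord would have slope at least `√3/2`, and bounds the slope of the hyperbola by `√3/4`. A shear
lifts `ξ` to two matrices on the hyperbola. Along `|n|² Id - n ⊗ n` Tartar's form and the pressure
are both affine, so each lifted matrix moves along the hyperbola to the two points of `H` as soon as
`n` is isotropic for `σ + (α/6) Id`; the slope bound provides such an `n` (`exists_isotropic`,
`exists_cof_split`). The laminates are realized by smooth periodic fields built from potentials,
bounded uniformly and close to `K` off small sets (`isApproximable_laminate`). This puts `ξ` in all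
the hulls at once. -/

@[ext] theorem Sym.ext {σ τ : Sym n} (h : ∀ i j, σ.mat i j = τ.mat i j) : σ = τ :=
  Subtype.ext (Matrix.ext h)

@[simp] theorem Sym.mat_add (σ τ : Sym n) : (σ + τ).mat = σ.mat + τ.mat := rfl
@[simp] theorem Sym.mat_sub (σ τ : Sym n) : (σ - τ).mat = σ.mat - τ.mat := rfl
@[simp] theorem Sym.mat_neg (σ : Sym n) : (-σ).mat = -σ.mat := rfl
@[simp] theorem Sym.mat_smul (c : ℝ) (σ : Sym n) : (c • σ).mat = c • σ.mat := rfl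
@[simp] theorem Sym.mat_zero : (0 : Sym n).mat = 0 := rfl

theorem Sym.mat_symm (σ : Sym n) (i j : Fin n) : σ.mat i j = σ.mat j i :=
  (σ.2.apply i j).symm

instance : FiniteDimensional ℝ (Sym n) :=
  inferInstanceAs (FiniteDimensional ℝ (symSubmodule n))

theorem Sym.norm_sq (σ : Sym n) : ‖σ‖ ^ 2 = ∑ i, ∑ j, σ.mat i j ^ 2 := by
  have h : ‖σ‖ = ‖σ.mat‖ := rfl
  rw [h, Matrix.frobenius_norm_def, ← Real.sqrt_eq_rpow, Real.sq_sqrt (by positivity)]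
  simp

theorem Sym.abs_entry_le (σ : Sym n) (i j : Fin n) : |σ.mat i j| ≤ ‖σ‖ := by
  apply abs_le_of_sq_le_sq _ (norm_nonneg _)
  rw [σ.norm_sq]
  calc σ.mat i j ^ 2 ≤ ∑ j, σ.mat i j ^ 2 :=
        Finset.single_le_sum (f := fun j => σ.mat i j ^ 2) (fun _ _ => sq_nonneg _)
          (Finset.mem_univ j)
    _ ≤ _ := Finset.single_le_sum (f := fun i => ∑ j, σ.mat i j ^ 2)
          (fun _ _ => Finset.sum_nonneg fun _ _ => sq_nonneg _) (Finset.mem_univ i)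

/-- A matrix entry as a continuous linear functional. -/
def entry (i j : Fin n) : Sym n →L[ℝ] ℝ :=
  LinearMap.toContinuousLinearMap
    { toFun := fun σ => σ.mat i j
      map_add' := fun _ _ => rfl
      map_smul' := fun _ _ => rfl }

@[simp] theorem entry_apply (i j : Fin n) (σ : Sym n) : entry i j σ = σ.mat i j := rfl

/-- The symmetric part of a square array. -/
def symPart : (Fin n → Fin n → ℝ) →L[ℝ] Sym n :=
  LinearMap.toContinuousLinearMap
    { toFun := fun f => ⟨Matrix.of fun i j => (f i j + f j i) / 2, by
        ext i j; simp [Matrix.transpose_apply, add_comm]⟩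
      map_add' := fun f g => by
        apply Subtype.ext; ext i j
        change ((f i j + g i j) + (f j i + g j i)) / 2 = (f i j + f j i) / 2 + (g i j + g j i) / 2
        ring
      map_smul' := fun c f => by
        apply Subtype.ext; ext i j
        change (c * f i j + c * f j i) / 2 = c * ((f i j + f j i) / 2)
        ring }

theorem symPart_mat (f : Fin n → Fin n → ℝ) (i j : Fin n) :
    (symPart f).mat i j = (f i j + f j i) / 2 := rfl

theorem symPart_mat_of_symm {f : Fin n → Fin n → ℝ} (h : ∀ i j, f i j = f j i) (i j : Fin n) :
    (symPart f).mat i j = f i j := by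
  rw [symPart_mat, h j i]; ring

theorem symPart_mat_self (σ : Sym n) : symPart (fun i j => σ.mat i j) = σ := by
  ext i j; exact symPart_mat_of_symm σ.mat_symm i j

theorem continuous_of_entries {X : Type*} [TopologicalSpace X] {φ : X → Sym n}
    (h : ∀ i j, Continuous fun x => (φ x).mat i j) : Continuous φ := by
  have : φ = fun x => symPart fun i j => (φ x).mat i j := funext fun x => (symPart_mat_self _).symm
  rw [this]
  exact symPart.continuous.comp (continuous_pi fun i => continuous_pi fun j => h i j)

theorem continuous_entry {X : Type*} [TopologicalSpace X] {φ : X → Sym n} (h : Continuous φ)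
    (i j : Fin n) : Continuous fun x => (φ x).mat i j :=
  (entry i j).continuous.comp h

theorem contDiff_entry {X : Type*} [NormedAddCommGroup X] [NormedSpace ℝ X] {φ : X → Sym n}
    (h : ContDiff ℝ ∞ φ) (i j : Fin n) : ContDiff ℝ ∞ fun x => (φ x).mat i j :=
  (entry i j).contDiff.comp h

theorem integral_mat {X : Type*} [MeasurableSpace X] {μ : Measure X} {φ : X → Sym n}
    (h : Integrable φ μ) (i j : Fin n) : (∫ x, φ x ∂μ).mat i j = ∫ x, (φ x).mat i j ∂μ :=
  ((entry i j).integral_comp_comm h).symm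

end SymBasics

/-! ### The invariants `p` and `q` -/

/-- The trace of a symmetric matrix, as a continuous linear functional. -/
def tr : Sym 3 →L[ℝ] ℝ := ∑ i, entry i i

theorem tr_apply (σ : Sym 3) : tr σ = σ.mat 0 0 + σ.mat 1 1 + σ.mat 2 2 := by
  simp [tr, Fin.sum_univ_three]

theorem pressure_eq (σ : Sym 3) : pressure σ = tr σ / 3 := by
  rw [tr_apply, pressure, Matrix.trace, Fin.sum_univ_three]; simp [Matrix.diag]; ring

theorem norm_sq_three (σ : Sym 3) : ‖σ‖ ^ 2 = σ.mat 0 0 ^ 2 + σ.mat 1 1 ^ 2 + σ.mat 2 2 ^ 2 +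
    2 * (σ.mat 0 1 ^ 2 + σ.mat 0 2 ^ 2 + σ.mat 1 2 ^ 2) := by
  rw [σ.norm_sq]; simp only [Fin.sum_univ_three]
  rw [σ.mat_symm 1 0, σ.mat_symm 2 0, σ.mat_symm 2 1]; ring

/-- The identity matrix. -/
def idSym : Sym 3 := ⟨1, Matrix.isSymm_one⟩

@[simp] theorem idSym_mat : idSym.mat = 1 := rfl

/-- The deviatoric part of a symmetric matrix. -/
def dev : Sym 3 →L[ℝ] Sym 3 :=
  ContinuousLinearMap.id ℝ _ - ((1 / 3 : ℝ) • tr).smulRight idSym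

theorem dev_apply (σ : Sym 3) : dev σ = σ - pressure σ • idSym := by
  rw [pressure_eq, div_eq_inv_mul]; simp [dev]

theorem shear_eq (σ : Sym 3) : shear σ = ‖dev σ‖ / √2 := by
  rw [dev_apply]; rfl

theorem shear_nonneg (σ : Sym 3) : 0 ≤ shear σ := by rw [shear_eq]; positivity

theorem shear_sq (σ : Sym 3) : 4 * shear σ ^ 2 = 2 * ‖σ‖ ^ 2 - tr σ ^ 2 + 3 * pressure σ ^ 2 := by
  rw [shear_eq, div_pow, Real.sq_sqrt (by norm_num), norm_sq_three, norm_sq_three, dev_apply,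
    pressure_eq, tr_apply]
  simp
  ring

/-- Tartar's quadratic form `2|σ|² - (tr σ)²`. -/
def tartar (σ : Sym 3) : ℝ := 2 * ‖σ‖ ^ 2 - tr σ ^ 2

theorem tartar_eq (σ : Sym 3) : tartar σ = 4 * shear σ ^ 2 - 3 * pressure σ ^ 2 := by
  rw [shear_sq, tartar]; ring

theorem continuous_pressure : Continuous pressure := by
  have : pressure = fun σ => tr σ / 3 := funext pressure_eq
  rw [this]; fun_prop

theorem continuous_shear : Continuous shear := by
  have : shear = fun σ => ‖dev σ‖ / √2 := funext shear_eq
  rw [this]; fun_prop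

theorem continuous_tartar : Continuous tartar := by unfold tartar; fun_prop

theorem continuous_Phi : Continuous Phi := continuous_pressure.prodMk continuous_shear

end

end SymDivQC

namespace SymDivQC

noncomputable section

attribute [local instance] Matrix.frobeniusNormedAddCommGroup Matrix.frobeniusNormedSpace

/-! ### Integration over the unit cube -/

section Cube

variable {n : ℕ} {E : Type*} [NormedAddCommGroup E]

theorem volume_restrict_cube (n : ℕ) : (volume : Measure (Fin n → ℝ)).restrict (cube n) =
    Measure.pi fun _ => (volume : Measure ℝ).restrict (Ioo 0 1) := by
  rw [cube, volume_pi, Measure.restrict_pi_pi]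

instance isProbabilityMeasure_Ioo :
    IsProbabilityMeasure ((volume : Measure ℝ).restrict (Ioo 0 1)) :=
  ⟨by simp⟩

instance isProbabilityMeasure_cube :
    IsProbabilityMeasure ((volume : Measure (Fin n → ℝ)).restrict (cube n)) := by
  rw [volume_restrict_cube]; infer_instance

theorem isOpen_cube : IsOpen (cube n) := isOpen_set_pi finite_univ fun _ _ => isOpen_Ioo

theorem measurableSet_cube : MeasurableSet (cube n) := isOpen_cube.measurableSet

theorem cube_subset_Icc : cube n ⊆ Icc 0 1 := fun _ hx =>
  ⟨fun i => (hx i trivial).1.le, fun i => (hx i trivial).2.le⟩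

theorem integrableOn_cube {F : (Fin n → ℝ) → E} (hF : Continuous F) :
    IntegrableOn F (cube n) :=
  (hF.continuousOn.integrableOn_compact isCompact_Icc).mono_set cube_subset_Icc

theorem integral_cube_const [NormedSpace ℝ E] [CompleteSpace E] (c : E) :
    ∫ _ in cube n, c = c := by
  simp

theorem integral_cube_mono {F G : (Fin n → ℝ) → ℝ} (hF : Continuous F) (hG : Continuous G)
    (h : ∀ x, F x ≤ G x) : ∫ x in cube n, F x ≤ ∫ x in cube n, G x :=
  integral_mono (integrableOn_cube hF) (integrableOn_cube hG) h

theorem integral_cube_nonneg {F : (Fin n → ℝ) → ℝ} (h : ∀ x, 0 ≤ F x) :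
    0 ≤ ∫ x in cube n, F x :=
  integral_nonneg h

/-- Integration over the cube is not changed by averaging over one coordinate. -/
theorem integral_cube_average [NormedSpace ℝ E] [CompleteSpace E] {F : (Fin (n + 1) → ℝ) → E}
    (hF : Continuous F) (i : Fin (n + 1)) :
    ∫ x in cube (n + 1), F x =
      ∫ x in cube (n + 1), ∫ τ in (0 : ℝ)..1, F (Function.update x i τ) := by
  have hint := integrableOn_cube hF
  simp only [intervalIntegral.integral_of_le zero_le_one, integral_Ioc_eq_integral_Ioo]
  rw [IntegrableOn, volume_restrict_cube] at hint
  rw [volume_restrict_cube]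
  set ν := (volume : Measure ℝ).restrict (Ioo 0 1)
  have mp := (measurePreserving_piFinSuccAbove (fun _ : Fin (n + 1) => ν) i).symm
  have hint' := hint
  rw [← mp.map_eq, integrable_map_equiv] at hint'
  rw [← mp.integral_comp', ← mp.integral_comp']
  rw [show (∫ z, F ((MeasurableEquiv.piFinSuccAbove (fun _ : Fin (n + 1) => ℝ) i).symm z)
    ∂ν.prod (Measure.pi fun _ : Fin n => ν)) = _ from integral_prod_symm _ hint']
  have key : ∀ (y : Fin n → ℝ) (s τ : ℝ),
      Function.update ((MeasurableEquiv.piFinSuccAbove (fun _ : Fin (n + 1) => ℝ) i).symm (s, y))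
        i τ = (MeasurableEquiv.piFinSuccAbove (fun _ : Fin (n + 1) => ℝ) i).symm (τ, y) := by
    intro y s τ
    simp [MeasurableEquiv.piFinSuccAbove, Fin.insertNthEquiv]
  simp only [key]
  have hi := hint'.integral_prod_right
  have := integral_prod_symm (μ := ν) (ν := Measure.pi fun _ : Fin n => ν)
    (fun z : ℝ × (Fin n → ℝ) => ∫ τ, F ((MeasurableEquiv.piFinSuccAbove
      (fun _ : Fin (n + 1) => ℝ) i).symm (τ, z.2)) ∂ν) ?_
  · refine Eq.trans ?_ this.symm
    simp
  · exact (hi.comp_snd ν)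

theorem integral_cube_eq_of_average [NormedSpace ℝ E] [CompleteSpace E]
    {F : (Fin (n + 1) → ℝ) → E} (hF : Continuous F) (i : Fin (n + 1)) {c : E}
    (h : ∀ x, ∫ τ in (0 : ℝ)..1, F (Function.update x i τ) = c) :
    ∫ x in cube (n + 1), F x = c := by
  rw [integral_cube_average hF i]; simp [h]

/-- `F` is `1`-periodic in each variable. -/
def IsPer {α : Type*} (F : (Fin n → ℝ) → α) : Prop := ∀ x i, F (x + Pi.single i 1) = F x

theorem IsPer.comp {α β : Type*} {F : (Fin n → ℝ) → α} (h : IsPer F) (g : α → β) :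
    IsPer fun x => g (F x) := fun x i => congrArg g (h x i)

theorem IsPer.update_one {α : Type*} {F : (Fin n → ℝ) → α} (h : IsPer F) (x : Fin n → ℝ)
    (i : Fin n) : F (Function.update x i 1) = F (Function.update x i 0) := by
  rw [← h (Function.update x i 0) i]
  congr 1
  ext j
  by_cases hj : j = i
  · subst hj; simp
  · simp [hj]

theorem IsPer.add_int {α : Type*} {F : (Fin n → ℝ) → α} (h : IsPer F) (x : Fin n → ℝ)
    (k : Fin n → ℤ) : F (x + fun i => (k i : ℝ)) = F x := by
  have hz : ∀ (m : ℤ) (i : Fin n) (x : Fin n → ℝ), F (x + m • Pi.single i 1) = F x := by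
    intro m i
    induction m using Int.induction_on with
    | zero => simp
    | succ m ih =>
      intro x; rw [add_smul, one_smul, ← add_assoc, h, ih]
    | pred m ih =>
      intro x
      rw [← h (x + _) i, add_assoc, sub_smul, one_smul, sub_add_cancel, ih]
  have hs : ∀ (s : Finset (Fin n)) (x : Fin n → ℝ),
      F (x + ∑ i ∈ s, k i • Pi.single i (1 : ℝ)) = F x := by
    intro s
    induction s using Finset.induction_on with
    | empty => simp
    | insert a s ha ih =>
      intro x; rw [Finset.sum_insert ha, ← add_assoc, ih, hz]
  convert hs Finset.univ x using 3
  ext j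
  simp [Finset.sum_apply, Pi.single_apply]

theorem IsPer.exists_mem_Icc {α : Type*} {F : (Fin n → ℝ) → α} (h : IsPer F) (x : Fin n → ℝ) :
    ∃ y ∈ Icc (0 : Fin n → ℝ) 1, F y = F x := by
  refine ⟨fun i => Int.fract (x i), ⟨fun i => Int.fract_nonneg _, fun i => (Int.fract_lt_one _).le⟩,
    ?_⟩
  rw [← h.add_int _ fun i => ⌊x i⌋]
  congr 1
  ext i; simp

theorem IsPer.exists_bound {F : (Fin n → ℝ) → E} (h : IsPer F) (hc : Continuous F) :
    ∃ M, ∀ x, ‖F x‖ ≤ M := by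
  obtain ⟨M, hM⟩ := (isCompact_Icc (a := (0 : Fin n → ℝ)) (b := 1)).exists_bound_of_continuousOn
    hc.continuousOn
  refine ⟨M, fun x => ?_⟩
  obtain ⟨y, hy, e⟩ := h.exists_mem_Icc x
  rw [← e]; exact hM y hy

/-- The `i`-th partial derivative. -/
def pd [NormedSpace ℝ E] (i : Fin n) (F : (Fin n → ℝ) → E) (x : Fin n → ℝ) : E :=
  fderiv ℝ F x (Pi.single i 1)

theorem hasDerivAt_comp_update [NormedSpace ℝ E] {F : (Fin n → ℝ) → E} (hF : Differentiable ℝ F)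
    (x : Fin n → ℝ) (i : Fin n) (τ : ℝ) :
    HasDerivAt (fun τ => F (Function.update x i τ)) (pd i F (Function.update x i τ)) τ := by
  have h1 : HasDerivAt (fun τ : ℝ => Function.update x i τ) (Pi.single i 1) τ :=
    hasDerivAt_update x i τ
  exact (hF _).hasFDerivAt.comp_hasDerivAt τ h1

/-- Differentiation under the integral sign. -/
theorem hasDerivAt_integral_cube {G G' : ℝ → (Fin n → ℝ) → ℝ}
    (hG : Continuous fun z : ℝ × (Fin n → ℝ) => G z.1 z.2)
    (hG' : Continuous fun z : ℝ × (Fin n → ℝ) => G' z.1 z.2)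
    (h : ∀ t x, HasDerivAt (fun t => G t x) (G' t x) t) (t : ℝ) :
    HasDerivAt (fun t => ∫ x in cube n, G t x) (∫ x in cube n, G' t x) t := by
  obtain ⟨M, hM⟩ := ((isCompact_closedBall t (1 : ℝ)).prod
    (isCompact_Icc (a := (0 : Fin n → ℝ)) (b := 1))).exists_bound_of_continuousOn hG'.continuousOn
  have hcont : ∀ s, Continuous (G s) := fun s => hG.comp (by fun_prop : Continuous fun x => (s, x))
  have hcont' : ∀ s, Continuous (G' s) := fun s =>
    hG'.comp (by fun_prop : Continuous fun x => (s, x))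
  refine (hasDerivAt_integral_of_dominated_loc_of_deriv_le (F := G) (F' := G')
    (bound := fun _ => M) (s := Metric.ball t 1) (Metric.ball_mem_nhds t one_pos)
    (Eventually.of_forall fun s => (integrableOn_cube (hcont s)).aestronglyMeasurable)
    (integrableOn_cube (hcont t)) (integrableOn_cube (hcont' t)).aestronglyMeasurable ?_
    (integrable_const M) (Eventually.of_forall fun x s _ => h s x)).2
  filter_upwards [ae_restrict_mem measurableSet_cube] with x hx s hs
  exact hM (s, x) ⟨Metric.ball_subset_closedBall hs, cube_subset_Icc hx⟩

end Cube

end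

end SymDivQC

namespace SymDivQC

noncomputable section

/-! ### Trigonometric polynomials and the heat flow -/

section Trig

variable {n : ℕ}

/-- `F'` is the `i`-th partial derivative of `F`. -/
def HasPd {E : Type*} [NormedAddCommGroup E] [NormedSpace ℝ E] (i : Fin n)
    (F F' : (Fin n → ℝ) → E) : Prop :=
  ∀ x τ, HasDerivAt (fun τ => F (Function.update x i τ)) (F' (Function.update x i τ)) τ

theorem hasPd_of_differentiable {E : Type*} [NormedAddCommGroup E] [NormedSpace ℝ E]
    {F : (Fin n → ℝ) → E} (hF : Differentiable ℝ F) (i : Fin n) : HasPd i F (pd i F) :=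
  fun x τ => hasDerivAt_comp_update hF x i τ

theorem HasPd.integral_eq_zero {E : Type*} [NormedAddCommGroup E] [NormedSpace ℝ E]
    [CompleteSpace E] {F F' : (Fin (n + 1) → ℝ) → E} {i : Fin (n + 1)} (h : HasPd i F F')
    (hc : Continuous F') (hp : IsPer F) : ∫ x in cube (n + 1), F' x = 0 := by
  refine integral_cube_eq_of_average hc i fun x => ?_
  rw [intervalIntegral.integral_eq_sub_of_hasDerivAt (fun τ _ => h x τ)
    ((hc.comp (continuous_const.update i continuous_id)).intervalIntegrable _ _), hp.update_one,
    sub_self]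

/-- The character `exp (2π i k · x)`. -/
def expo (k : Fin n → ℤ) (x : Fin n → ℝ) : ℂ :=
  Complex.exp (2 * Real.pi * Complex.I * ∑ i, (k i : ℂ) * (x i : ℂ))

theorem continuous_expo (k : Fin n → ℤ) : Continuous (expo k) := by
  unfold expo; fun_prop

theorem norm_expo (k : Fin n → ℤ) (x : Fin n → ℝ) : ‖expo k x‖ = 1 := by
  have : (2 * Real.pi * Complex.I * ∑ i, (k i : ℂ) * (x i : ℂ)) =
      ((2 * Real.pi * ∑ i, (k i : ℝ) * x i : ℝ) : ℂ) * Complex.I := by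
    push_cast; ring
  rw [expo, this, Complex.norm_exp_ofReal_mul_I]

theorem expo_add (k l : Fin n → ℤ) (x : Fin n → ℝ) : expo (k + l) x = expo k x * expo l x := by
  rw [expo, expo, expo, ← Complex.exp_add, ← mul_add, ← Finset.sum_add_distrib]
  simp [add_mul]

theorem expo_zero (x : Fin n → ℝ) : expo (0 : Fin n → ℤ) x = 1 := by simp [expo]

theorem expo_add_right (k : Fin n → ℤ) (x y : Fin n → ℝ) :
    expo k (x + y) = expo k x * expo k y := by
  rw [expo, expo, expo, ← Complex.exp_add, ← mul_add, ← Finset.sum_add_distrib]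
  simp [mul_add]

theorem expo_neg (k : Fin n → ℤ) (x : Fin n → ℝ) : expo (-k) x = (starRingEnd ℂ) (expo k x) := by
  rw [expo, expo, ← Complex.exp_conj]
  simp [map_ofNat]

theorem isPer_expo (k : Fin n → ℤ) : IsPer (expo k) := by
  intro x i
  rw [expo_add_right]
  have : expo k (Pi.single i 1) = 1 := by
    rw [expo]
    have : ∑ j, (k j : ℂ) * ((Pi.single i (1 : ℝ) : Fin n → ℝ) j : ℂ) = k i := by
      rw [Finset.sum_eq_single i] <;> simp +contextual
    rw [this, Complex.exp_eq_one_iff]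
    exact ⟨k i, by ring⟩
  rw [this, mul_one]

theorem hasPd_expo (k : Fin n → ℤ) (i : Fin n) :
    HasPd i (expo k) fun x => 2 * Real.pi * Complex.I * k i * expo k x := by
  intro x τ
  have h1 : HasDerivAt (fun τ : ℝ => 2 * (Real.pi : ℂ) * Complex.I *
      ∑ j, (k j : ℂ) * ((Function.update x i τ j : ℝ) : ℂ))
      (2 * Real.pi * Complex.I * k i) τ := by
    have h2 : HasDerivAt (fun τ : ℝ => ∑ j, (k j : ℂ) * ((Function.update x i τ j : ℝ) : ℂ))
        (∑ j, (k j : ℂ) * (((Pi.single i 1 : Fin n → ℝ) j : ℝ) : ℂ)) τ := by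
      refine HasDerivAt.fun_sum fun j _ => HasDerivAt.const_mul _ ?_
      exact ((hasDerivAt_pi.1 (hasDerivAt_update x i τ)) j).ofReal_comp
    have h3 : ∑ j, (k j : ℂ) * (((Pi.single i 1 : Fin n → ℝ) j : ℝ) : ℂ) = k i := by
      rw [Finset.sum_eq_single i] <;> simp +contextual
    rw [h3] at h2
    exact h2.const_mul _
  have := h1.cexp
  refine HasDerivAt.congr_deriv this ?_
  simp only [expo]
  ring

theorem integral_expo (k : Fin (n + 1) → ℤ) :
    ∫ x in cube (n + 1), expo k x = if k = 0 then 1 else 0 := by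
  split_ifs with h
  · subst h; simp [expo_zero]
  · obtain ⟨i, hi⟩ : ∃ i, k i ≠ 0 := by
      by_contra hc; push Not at hc; exact h (funext hc)
    have h0 := (hasPd_expo k i).integral_eq_zero
      (continuous_const.mul (continuous_expo k)) (isPer_expo k)
    rw [integral_const_mul] at h0
    have : 2 * (Real.pi : ℂ) * Complex.I * k i ≠ 0 := by
      simp [Real.pi_ne_zero, hi]
    exact (mul_eq_zero.1 h0).resolve_left this

/-- The trigonometric polynomial with frequencies in `T` and coefficients `a`. -/
def trig (T : Finset (Fin n → ℤ)) (a : (Fin n → ℤ) → ℂ) (x : Fin n → ℝ) : ℂ :=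
  ∑ k ∈ T, a k * expo k x

theorem continuous_trig (T : Finset (Fin n → ℤ)) (a : (Fin n → ℤ) → ℂ) :
    Continuous (trig T a) :=
  continuous_finsetSum _ fun k _ => continuous_const.mul (continuous_expo k)

theorem isPer_trig (T : Finset (Fin n → ℤ)) (a : (Fin n → ℤ) → ℂ) : IsPer (trig T a) := by
  intro x i
  simp only [trig]
  exact Finset.sum_congr rfl fun k _ => by rw [isPer_expo k x i]

theorem hasPd_trig (T : Finset (Fin n → ℤ)) (a : (Fin n → ℤ) → ℂ) (i : Fin n) :
    HasPd i (trig T a) (trig T fun k => 2 * Real.pi * Complex.I * k i * a k) := by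
  intro x τ
  simp only [trig]
  refine HasDerivAt.fun_sum fun k _ => ?_
  have := (hasPd_expo k i x τ).const_mul (a k)
  rw [← mul_assoc, mul_comm (a k)] at this
  exact this

theorem trig_eq_of_subset {T T' : Finset (Fin n → ℤ)} (h : T ⊆ T') {a : (Fin n → ℤ) → ℂ}
    (ha : ∀ k, k ∉ T → a k = 0) (x : Fin n → ℝ) : trig T a x = trig T' a x :=
  Finset.sum_subset h fun k _ hk => by rw [ha k hk, zero_mul]

/-- The `k`-th Fourier coefficient of a function on the cube. -/
def fcoeff (f : (Fin n → ℝ) → ℝ) (k : Fin n → ℤ) : ℂ :=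
  ∫ x in cube n, (f x : ℂ) * expo (-k) x

/-- A trigonometric polynomial with real values. -/
structure IsRealTrig (T : Finset (Fin n → ℤ)) (a : (Fin n → ℤ) → ℂ) : Prop where
  neg_mem : ∀ k ∈ T, -k ∈ T
  eq_zero : ∀ k, k ∉ T → a k = 0
  conj_eq : ∀ k, a (-k) = (starRingEnd ℂ) (a k)

theorem IsRealTrig.conj_trig {T : Finset (Fin n → ℤ)} {a : (Fin n → ℤ) → ℂ} (h : IsRealTrig T a)
    (x : Fin n → ℝ) : (starRingEnd ℂ) (trig T a x) = trig T a x := by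
  rw [trig, map_sum]
  refine Finset.sum_bij (fun k _ => -k) (fun k hk => h.neg_mem k hk) (fun _ _ _ _ h => neg_inj.1 h)
    (fun k hk => ⟨-k, h.neg_mem k hk, neg_neg k⟩) fun k _ => ?_
  rw [map_mul, h.conj_eq, expo_neg]

theorem IsRealTrig.ofReal_re {T : Finset (Fin n → ℤ)} {a : (Fin n → ℤ) → ℂ} (h : IsRealTrig T a)
    (x : Fin n → ℝ) : ((trig T a x).re : ℂ) = trig T a x :=
  Complex.conj_eq_iff_re.1 (h.conj_trig x)

theorem IsRealTrig.mul {T : Finset (Fin n → ℤ)} {a m : (Fin n → ℤ) → ℂ} (h : IsRealTrig T a)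
    (hm : ∀ k, m (-k) = (starRingEnd ℂ) (m k)) : IsRealTrig T fun k => m k * a k where
  neg_mem := h.neg_mem
  eq_zero k hk := by rw [h.eq_zero k hk, mul_zero]
  conj_eq k := by rw [h.conj_eq, hm, map_mul]

theorem IsRealTrig.mono {T T' : Finset (Fin n → ℤ)} {a : (Fin n → ℤ) → ℂ} (h : IsRealTrig T a)
    (hT : T ⊆ T') (hn : ∀ k ∈ T', -k ∈ T') : IsRealTrig T' a where
  neg_mem := hn
  eq_zero k hk := h.eq_zero k fun hk' => hk (hT hk')
  conj_eq := h.conj_eq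

theorem fcoeff_trig {T : Finset (Fin (n + 1) → ℤ)} {a : (Fin (n + 1) → ℤ) → ℂ}
    (h : IsRealTrig T a) (k : Fin (n + 1) → ℤ) :
    fcoeff (fun x => (trig T a x).re) k = a k := by
  simp only [fcoeff, h.ofReal_re]
  have : ∀ x, trig T a x * expo (-k) x = ∑ l ∈ T, a l * expo (l - k) x := fun x => by
    rw [trig, Finset.sum_mul]
    exact Finset.sum_congr rfl fun l _ => by rw [sub_eq_add_neg, expo_add]; ring
  simp only [this]
  rw [integral_finsetSum _ fun l _ =>
    integrableOn_cube (F := fun x => a l * expo (l - k) x)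
      (continuous_const.mul (continuous_expo _))]
  simp only [integral_const_mul, integral_expo, sub_eq_zero, mul_ite, mul_one, mul_zero]
  rw [Finset.sum_ite_eq']
  split_ifs with hk
  · rfl
  · exact (h.eq_zero k hk).symm

/-- Parseval's formula, one factor being a trigonometric polynomial. -/
theorem integral_trig_mul {T : Finset (Fin n → ℤ)} {a : (Fin n → ℤ) → ℂ}
    (h : IsRealTrig T a) {f : (Fin n → ℝ) → ℝ} (hf : Continuous f) :
    ((∫ x in cube n, (trig T a x).re * f x : ℝ) : ℂ) =
      ∑ k ∈ T, a k * (starRingEnd ℂ) (fcoeff f k) := by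
  rw [← integral_complex_ofReal]
  have : ∀ x, (((trig T a x).re * f x : ℝ) : ℂ) = ∑ k ∈ T, a k * ((f x : ℂ) * expo k x) := by
    intro x
    rw [Complex.ofReal_mul, h.ofReal_re, trig, Finset.sum_mul]
    exact Finset.sum_congr rfl fun k _ => by ring
  simp only [this]
  rw [integral_finsetSum _ fun k _ => integrableOn_cube
    (F := fun x => a k * ((f x : ℂ) * expo k x)) (continuous_const.mul
    ((Complex.continuous_ofReal.comp hf).mul (continuous_expo _)))]
  refine Finset.sum_congr rfl fun k _ => ?_
  rw [integral_const_mul, fcoeff, ← integral_conj]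
  congr 2
  ext x
  rw [expo_neg, map_mul, Complex.conj_conj, Complex.conj_ofReal]

/-- Continuous periodic functions are uniform limits of trigonometric polynomials. -/
theorem exists_trig_approx {f : (Fin n → ℝ) → ℝ} (hf : Continuous f) (hp : IsPer f) {ε : ℝ}
    (hε : 0 < ε) : ∃ T a, IsRealTrig (n := n) T a ∧ ∀ x, |f x - (trig T a x).re| < ε := by
  classical
  -- Periodicity lets `f` descend to a continuous function on the torus, where the span of the
  -- monomials `mFourier` is dense.
  have hq : IsOpenQuotientMap (fun (x : Fin n → ℝ) (i : Fin n) => ((x i : ℝ) : UnitAddCircle)) :=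
    IsOpenQuotientMap.piMap fun _ => QuotientAddGroup.isOpenQuotientMap_mk
  have hlift : ∀ x y : Fin n → ℝ, (fun i => ((x i : ℝ) : UnitAddCircle)) =
      (fun i => ((y i : ℝ) : UnitAddCircle)) → f x = f y := by
    intro x y h
    have : ∀ i, ∃ m : ℤ, x i = y i + m := by
      intro i
      have := congrFun h i
      rw [QuotientAddGroup.eq] at this
      obtain ⟨m, hm⟩ := AddSubgroup.mem_zmultiples_iff.1 this
      refine ⟨-m, ?_⟩
      push_cast
      simp at hm
      linarith
    choose m hm using this
    rw [← hp.add_int y m]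
    congr 1; ext i; simp [hm i]
  let F : UnitAddTorus (Fin n) → ℝ := fun z => f (Function.surjInv hq.surjective z)
  have hF : ∀ x : Fin n → ℝ, F (fun i => ((x i : ℝ) : UnitAddCircle)) = f x := fun x =>
    hlift _ _ (Function.surjInv_eq hq.surjective _)
  have hFc : Continuous F := by
    exact hq.isQuotientMap.continuous_iff.2 (by
      have : F ∘ (fun (x : Fin n → ℝ) (i : Fin n) => ((x i : ℝ) : UnitAddCircle)) = f := funext hF
      rw [this]; exact hf)
  let G : C(UnitAddTorus (Fin n), ℂ) := ⟨fun z => (F z : ℂ), Complex.continuous_ofReal.comp hFc⟩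
  have hG : G ∈ (Submodule.span ℂ (range (UnitAddTorus.mFourier (d := Fin n)))).topologicalClosure
    := by rw [UnitAddTorus.span_mFourier_closure_eq_top]; trivial
  obtain ⟨P, hP, hPG⟩ := Metric.mem_closure_iff.1 hG ε hε
  obtain ⟨c, rfl⟩ := (Finsupp.mem_span_range_iff_exists_finsupp).1 hP
  have hval : ∀ x : Fin n → ℝ, (c.sum fun k r => r • UnitAddTorus.mFourier k)
      (fun i => ((x i : ℝ) : UnitAddCircle)) = ∑ k ∈ c.support, c k * expo k x := by
    intro x
    rw [Finsupp.sum, ContinuousMap.coe_sum, Finset.sum_apply]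
    refine Finset.sum_congr rfl fun k _ => ?_
    rw [ContinuousMap.smul_apply, smul_eq_mul, UnitAddTorus.mFourier, ContinuousMap.coe_mk, expo,
      Finset.mul_sum, Complex.exp_sum]
    congr 1
    refine Finset.prod_congr rfl fun i _ => ?_
    rw [fourier_coe_apply]
    congr 1
    push_cast; ring
  -- Symmetrizing the coefficients replaces the approximating polynomial by its real part, which is
  -- no farther from the real function `f`.
  refine ⟨c.support ∪ c.support.image (fun k => -k),
    fun k => (c k + (starRingEnd ℂ) (c (-k))) / 2, ⟨?_, ?_, ?_⟩, ?_⟩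
  · intro k hk
    rcases Finset.mem_union.1 hk with h | h
    · exact Finset.mem_union_right _ (Finset.mem_image_of_mem _ h)
    · obtain ⟨l, hl, rfl⟩ := Finset.mem_image.1 h
      rw [neg_neg]; exact Finset.mem_union_left _ hl
  · intro k hk
    rw [Finset.mem_union, not_or] at hk
    have h1 : c k = 0 := Finsupp.notMem_support_iff.1 hk.1
    have h2 : c (-k) = 0 := by
      by_contra h
      exact hk.2 (Finset.mem_image.2 ⟨-k, Finsupp.mem_support_iff.2 h, neg_neg k⟩)
    simp [h1, h2]
  · intro k
    simp [add_comm, map_ofNat]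
  · intro x
    set T := c.support ∪ c.support.image (fun k => -k) with hT
    have hneg : ∀ k ∈ T, -k ∈ T := by
      intro k hk
      rcases Finset.mem_union.1 hk with h | h
      · exact Finset.mem_union_right _ (Finset.mem_image_of_mem _ h)
      · obtain ⟨l, hl, rfl⟩ := Finset.mem_image.1 h
        rw [neg_neg]; exact Finset.mem_union_left _ hl
    have e1 : ∑ k ∈ c.support, c k * expo k x = trig T c x :=
      trig_eq_of_subset Finset.subset_union_left (fun k hk => Finsupp.notMem_support_iff.1 hk) x
    have e2 : (starRingEnd ℂ) (trig T c x) = trig T (fun k => (starRingEnd ℂ) (c (-k))) x := by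
      rw [trig, map_sum]
      refine Finset.sum_bij (fun k _ => -k) (fun k hk => hneg k hk)
        (fun _ _ _ _ h => neg_inj.1 h) (fun k hk => ⟨-k, hneg k hk, neg_neg k⟩) fun k _ => ?_
      simp only [map_mul, expo_neg, neg_neg]
    have e3 : trig T (fun k => (c k + (starRingEnd ℂ) (c (-k))) / 2) x =
        ((trig T c x).re : ℂ) := by
      rw [Complex.re_eq_add_conj, e2]
      simp only [trig]
      rw [← Finset.sum_add_distrib, Finset.sum_div]
      exact Finset.sum_congr rfl fun k _ => by ring
    rw [e3, Complex.ofReal_re]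
    have := (ContinuousMap.dist_apply_le_dist (f := G) (g := c.sum fun k r =>
      r • UnitAddTorus.mFourier k) (fun i => ((x i : ℝ) : UnitAddCircle))).trans_lt hPG
    rw [hval, e1] at this
    have e4 : G (fun i => ((x i : ℝ) : UnitAddCircle)) = (f x : ℂ) := by
      change ((F _ : ℝ) : ℂ) = _
      rw [hF]
    rw [e4, dist_eq_norm] at this
    refine lt_of_le_of_lt ?_ this
    have := Complex.abs_re_le_norm ((f x : ℂ) - trig T c x)
    simpa using this

/-- The rate of decay of the `k`-th mode under the heat flow. -/
def decay (k : Fin n → ℤ) : ℝ := 4 * Real.pi ^ 2 * ∑ i, (k i : ℝ) ^ 2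

/-- The coefficients of the heat flow at time `t`. -/
def heatCoeff (a : (Fin n → ℤ) → ℂ) (t : ℝ) (k : Fin n → ℤ) : ℂ :=
  (Real.exp (-decay k * t) : ℂ) * a k

theorem decay_neg (k : Fin n → ℤ) : decay (-k) = decay k := by simp [decay]

theorem IsRealTrig.heat {T : Finset (Fin n → ℤ)} {a : (Fin n → ℤ) → ℂ} (h : IsRealTrig T a)
    (t : ℝ) : IsRealTrig T (heatCoeff a t) :=
  h.mul fun k => by rw [decay_neg, Complex.conj_ofReal]

/-- The heat semigroup at time `t` is averaging over a centred Gaussian of variance `2t` in each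
coordinate. On characters this is the product of the one-dimensional characteristic functions.
Writing the flow as an average is what yields the maximum principle. -/
theorem integral_expo_gaussian (k : Fin n → ℤ) (x : Fin n → ℝ) {t : ℝ} (ht : 0 ≤ t) :
    ∫ z, expo k (x + √(2 * t) • z) ∂(Measure.pi fun _ : Fin n =>
      ProbabilityTheory.gaussianReal 0 1) = Real.exp (-decay k * t) * expo k x := by
  have h1 : ∀ z : Fin n → ℝ, expo k (x + √(2 * t) • z) = expo k x *
      ∏ i, Complex.exp ((2 * Real.pi * k i * √(2 * t) : ℝ) * z i * Complex.I) := by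
    intro z
    rw [expo_add_right]
    congr 1
    rw [expo, ← Complex.exp_sum, Finset.mul_sum]
    congr 1
    refine Finset.sum_congr rfl fun i _ => ?_
    simp only [Pi.smul_apply, smul_eq_mul]
    push_cast; ring
  simp only [h1]
  rw [integral_const_mul, integral_fintype_prod_eq_prod (fun i (y : ℝ) =>
    Complex.exp ((2 * Real.pi * k i * √(2 * t) : ℝ) * y * Complex.I)), mul_comm]
  congr 1
  simp only [← MeasureTheory.charFun_apply_real, ProbabilityTheory.charFun_gaussianReal]
  rw [← Complex.exp_sum, Complex.ofReal_exp]
  congr 1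
  rw [decay, Finset.mul_sum, ← Finset.sum_neg_distrib, Finset.sum_mul]
  push_cast
  refine Finset.sum_congr rfl fun i _ => ?_
  have : ((√(2 * t) : ℝ) : ℂ) ^ 2 = 2 * t := by
    rw [← Complex.ofReal_pow, Real.sq_sqrt (by positivity)]; push_cast; ring
  simp only [mul_pow, this]
  ring

/-- The maximum principle for the heat flow. -/
theorem norm_trig_heat_le {T : Finset (Fin n → ℤ)} {a : (Fin n → ℤ) → ℂ} {M : ℝ}
    (h : ∀ x, ‖trig T a x‖ ≤ M) {t : ℝ} (ht : 0 ≤ t) (x : Fin n → ℝ) :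
    ‖trig T (heatCoeff a t) x‖ ≤ M := by
  have e : trig T (heatCoeff a t) x = ∫ z, trig T a (x + √(2 * t) • z) ∂(Measure.pi fun _ : Fin n =>
      ProbabilityTheory.gaussianReal 0 1) := by
    simp only [trig]
    rw [integral_finsetSum]
    · refine Finset.sum_congr rfl fun k _ => ?_
      rw [integral_const_mul, integral_expo_gaussian k x ht, heatCoeff]
      ring
    · intro k _
      refine Integrable.const_mul ?_ _
      refine Integrable.of_bound (C := 1) ?_ (Eventually.of_forall fun z => (norm_expo _ _).le)
      exact ((continuous_expo k).comp (by fun_prop)).aestronglyMeasurable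
  rw [e]
  refine (norm_integral_le_of_norm_le_const (Eventually.of_forall fun z => h _)).trans ?_
  simp

end Trig

end

end SymDivQC

namespace SymDivQC

noncomputable section

/-! ### A Bellman function estimate for second order Riesz transforms -/

section Bellman

variable {n : ℕ}

/-- `u` solves the heat equation on the torus, with first and second spatial derivatives `du` and
`ddu`. -/
structure HeatFlow (u : ℝ → (Fin n → ℝ) → ℝ) (du ddu : Fin n → ℝ → (Fin n → ℝ) → ℝ) : Prop where
  cont : Continuous fun z : ℝ × (Fin n → ℝ) => u z.1 z.2
  cont_d : ∀ m, Continuous fun z : ℝ × (Fin n → ℝ) => du m z.1 z.2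
  cont_dd : ∀ m, Continuous fun z : ℝ × (Fin n → ℝ) => ddu m z.1 z.2
  per : ∀ t, IsPer (u t)
  per_d : ∀ m t, IsPer (du m t)
  hasPd : ∀ m t, HasPd m (u t) (du m t)
  hasPd_d : ∀ m t, HasPd m (du m t) (ddu m t)
  time : ∀ t x, HasDerivAt (fun t => u t x) (∑ m, ddu m t x) t

/-- `Θ` is a function of two real variables with partial derivatives `Θ₁` and `Θ₂`. -/
def HasPartials (Θ Θ₁ Θ₂ : ℝ → ℝ → ℝ) : Prop :=
  ∀ (f g : ℝ → ℝ) (f' g' τ : ℝ), HasDerivAt f f' τ → HasDerivAt g g' τ →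
    HasDerivAt (fun τ => Θ (f τ) (g τ)) (Θ₁ (f τ) (g τ) * f' + Θ₂ (f τ) (g τ) * g') τ

/-- By the chain rule and the heat equation the time derivative is the integral of `Θ₁ Δu + Θ₂ Δv`.
Adding the Hessian terms gives the divergence of the field `Θ₁ ∇u + Θ₂ ∇v`, whose integral over a
period vanishes. -/
theorem hasDerivAt_entropy {u v : ℝ → (Fin (n + 1) → ℝ) → ℝ}
    {du ddu dv ddv : Fin (n + 1) → ℝ → (Fin (n + 1) → ℝ) → ℝ}
    (hu : HeatFlow u du ddu) (hv : HeatFlow v dv ddv) {Θ Θ₁ Θ₂ Θ₁₁ Θ₁₂ Θ₂₂ : ℝ → ℝ → ℝ}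
    (h : HasPartials Θ Θ₁ Θ₂) (h1 : HasPartials Θ₁ Θ₁₁ Θ₁₂) (h2 : HasPartials Θ₂ Θ₁₂ Θ₂₂)
    (hc : Continuous fun z : ℝ × ℝ => Θ z.1 z.2) (hc1 : Continuous fun z : ℝ × ℝ => Θ₁ z.1 z.2)
    (hc2 : Continuous fun z : ℝ × ℝ => Θ₂ z.1 z.2) (hc11 : Continuous fun z : ℝ × ℝ => Θ₁₁ z.1 z.2)
    (hc12 : Continuous fun z : ℝ × ℝ => Θ₁₂ z.1 z.2)
    (hc22 : Continuous fun z : ℝ × ℝ => Θ₂₂ z.1 z.2) (t : ℝ) :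
    HasDerivAt (fun t => ∫ x in cube (n + 1), Θ (u t x) (v t x))
      (-∫ x in cube (n + 1), ∑ m, (Θ₁₁ (u t x) (v t x) * du m t x ^ 2 +
        2 * Θ₁₂ (u t x) (v t x) * du m t x * dv m t x + Θ₂₂ (u t x) (v t x) * dv m t x ^ 2)) t := by
  have cuv := hu.cont.prodMk hv.cont
  have sl : ∀ {g : ℝ × (Fin (n + 1) → ℝ) → ℝ}, Continuous g → Continuous fun x => g (t, x) :=
    fun hg => hg.comp (by fun_prop)
  have cd := fun m => hu.cont_d m
  have cd' := fun m => hv.cont_d m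
  have cdd := fun m => hu.cont_dd m
  have cdd' := fun m => hv.cont_dd m
  have k0 := hc.comp cuv
  have k1 := hc1.comp cuv
  have k2 := hc2.comp cuv
  have k11 := hc11.comp cuv
  have k12 := hc12.comp cuv
  have k22 := hc22.comp cuv
  simp only [Function.comp_def] at k0 k1 k2 k11 k12 k22
  have hG' : Continuous fun z : ℝ × (Fin (n + 1) → ℝ) =>
      Θ₁ (u z.1 z.2) (v z.1 z.2) * (∑ m, ddu m z.1 z.2) +
        Θ₂ (u z.1 z.2) (v z.1 z.2) * ∑ m, ddv m z.1 z.2 := by fun_prop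
  have hd := hasDerivAt_integral_cube (n := n + 1) (G := fun t x => Θ (u t x) (v t x))
    (G' := fun t x => Θ₁ (u t x) (v t x) * (∑ m, ddu m t x) +
      Θ₂ (u t x) (v t x) * ∑ m, ddv m t x) k0 hG' (fun t x => h _ _ _ _ _ (hu.time t x) (hv.time t x)) t
  refine hd.congr_deriv ?_
  rw [eq_neg_iff_add_eq_zero]
  have hHess : Continuous fun z : ℝ × (Fin (n + 1) → ℝ) =>
      ∑ m, (Θ₁₁ (u z.1 z.2) (v z.1 z.2) * du m z.1 z.2 ^ 2 +
        2 * Θ₁₂ (u z.1 z.2) (v z.1 z.2) * du m z.1 z.2 * dv m z.1 z.2 +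
        Θ₂₂ (u z.1 z.2) (v z.1 z.2) * dv m z.1 z.2 ^ 2) := by fun_prop
  rw [← integral_add (integrableOn_cube (sl hG')) (integrableOn_cube (sl hHess))]
  have hY : ∀ m, ∫ x in cube (n + 1), ((Θ₁₁ (u t x) (v t x) * du m t x + Θ₁₂ (u t x) (v t x) *
      dv m t x) * du m t x + Θ₁ (u t x) (v t x) * ddu m t x + ((Θ₁₂ (u t x) (v t x) * du m t x +
      Θ₂₂ (u t x) (v t x) * dv m t x) * dv m t x + Θ₂ (u t x) (v t x) * ddv m t x)) = 0 := by
    intro m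
    refine HasPd.integral_eq_zero (i := m)
      (F := fun x => Θ₁ (u t x) (v t x) * du m t x + Θ₂ (u t x) (v t x) * dv m t x) ?_ ?_ ?_
    · intro x τ
      have a1 := hu.hasPd m t x τ
      have a2 := hv.hasPd m t x τ
      exact ((h1 _ _ _ _ _ a1 a2).mul (hu.hasPd_d m t x τ)).add
        ((h2 _ _ _ _ _ a1 a2).mul (hv.hasPd_d m t x τ))
    · have := cd m; have := cd' m; have := cdd m; have := cdd' m
      exact sl (g := fun z => (Θ₁₁ (u z.1 z.2) (v z.1 z.2) * du m z.1 z.2 +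
        Θ₁₂ (u z.1 z.2) (v z.1 z.2) * dv m z.1 z.2) * du m z.1 z.2 +
        Θ₁ (u z.1 z.2) (v z.1 z.2) * ddu m z.1 z.2 + ((Θ₁₂ (u z.1 z.2) (v z.1 z.2) * du m z.1 z.2 +
        Θ₂₂ (u z.1 z.2) (v z.1 z.2) * dv m z.1 z.2) * dv m z.1 z.2 +
        Θ₂ (u z.1 z.2) (v z.1 z.2) * ddv m z.1 z.2)) (by fun_prop)
    · intro x i
      simp only [hu.per t x i, hv.per t x i, hu.per_d m t x i, hv.per_d m t x i]
  have hsum := Finset.sum_eq_zero fun m (_ : m ∈ Finset.univ) => hY m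
  rw [← integral_finsetSum] at hsum
  · rw [← hsum]
    congr 1
    ext x
    rw [Finset.mul_sum, Finset.mul_sum, ← Finset.sum_add_distrib, ← Finset.sum_add_distrib]
    exact Finset.sum_congr rfl fun m _ => by ring
  · intro m _
    have := cd m; have := cd' m; have := cdd m; have := cdd' m
    exact integrableOn_cube (sl (g := fun z => (Θ₁₁ (u z.1 z.2) (v z.1 z.2) * du m z.1 z.2 +
        Θ₁₂ (u z.1 z.2) (v z.1 z.2) * dv m z.1 z.2) * du m z.1 z.2 +
        Θ₁ (u z.1 z.2) (v z.1 z.2) * ddu m z.1 z.2 + ((Θ₁₂ (u z.1 z.2) (v z.1 z.2) * du m z.1 z.2 +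
        Θ₂₂ (u z.1 z.2) (v z.1 z.2) * dv m z.1 z.2) * dv m z.1 z.2 +
        Θ₂ (u z.1 z.2) (v z.1 z.2) * ddv m z.1 z.2)) (by fun_prop))

/-- The weight `√(1 + v²)`. -/
def wt (v : ℝ) : ℝ := √(1 + v ^ 2)

theorem wt_pos (v : ℝ) : 0 < wt v := Real.sqrt_pos.2 (by positivity)

theorem wt_sq (v : ℝ) : wt v ^ 2 = 1 + v ^ 2 := Real.sq_sqrt (by positivity)

theorem wt_le (v : ℝ) : wt v ≤ 1 + |v| := by
  rw [wt, Real.sqrt_le_left (by positivity)]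
  nlinarith [abs_nonneg v, sq_abs v]

theorem continuous_wt : Continuous wt := by unfold wt; fun_prop

theorem hasDerivAt_wt (v : ℝ) : HasDerivAt wt (v / wt v) v := by
  have h := ((hasDerivAt_pow 2 v).const_add 1).sqrt (by positivity)
  refine h.congr_deriv ?_
  rw [wt]; field_simp; simp

/-- The convex function with second derivative `1 / √(1 + v²)`. -/
def llog (v : ℝ) : ℝ := v * Real.arsinh v - wt v + 1

theorem continuous_llog : Continuous llog := by
  unfold llog
  have := continuous_wt
  have := Real.continuous_arsinh
  fun_prop

theorem hasDerivAt_arsinh_wt (v : ℝ) : HasDerivAt Real.arsinh (1 / wt v) v := by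
  rw [one_div]; exact Real.hasDerivAt_arsinh v

theorem hasDerivAt_llog (v : ℝ) : HasDerivAt llog (Real.arsinh v) v := by
  have := (((hasDerivAt_id v).mul (hasDerivAt_arsinh_wt v)).sub (hasDerivAt_wt v)).add_const 1
  refine this.congr_deriv ?_
  simp; ring

theorem llog_neg (v : ℝ) : llog (-v) = llog v := by simp [llog, wt, Real.arsinh_neg]

theorem llog_zero : llog 0 = 0 := by simp [llog, wt]

theorem llog_nonneg (v : ℝ) : 0 ≤ llog v := by
  have key : ∀ v, 0 ≤ v → 0 ≤ llog v := by
    intro v hv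
    have hm : MonotoneOn llog (Ici 0) := by
      refine monotoneOn_of_deriv_nonneg (convex_Ici 0) continuous_llog.continuousOn
        (fun x _ => (hasDerivAt_llog x).differentiableAt.differentiableWithinAt) fun x hx => ?_
      rw [(hasDerivAt_llog x).deriv]
      rw [interior_Ici] at hx
      exact Real.arsinh_nonneg_iff.2 (le_of_lt hx)
    rw [← llog_zero]
    exact hm self_mem_Ici hv hv
  rcases le_total 0 v with h | h
  · exact key v h
  · rw [← llog_neg]; exact key _ (by linarith)

/-- The coefficients are the second derivatives of the Bellman function `(θ/2) u² wt(v) + (1/(2θ) +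
2θ) llog(v)`. Completing the square in the mixed term leaves `-2θ u² v² b² / wt³`, which the part
`2θ llog` absorbs because `|u v| ≤ wt v`. The part `(1/(2θ)) llog` feeds the weighted Young
inequality of the second claim. -/
theorem bellman_pointwise {θ u v a b b' : ℝ} (hθ : 0 < θ) (hu : |u| ≤ 1) :
    θ / 2 * wt v * a ^ 2 + 1 / (2 * θ) * b ^ 2 / wt v ≤ θ * wt v * a ^ 2 +
      2 * (θ * (u * v / wt v)) * a * b +
      (θ / 2 * u ^ 2 / wt v ^ 3 + (1 / (2 * θ) + 2 * θ) / wt v) * b ^ 2 ∧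
    |a * b'| ≤ θ / 2 * wt v * a ^ 2 + 1 / (2 * θ) * b' ^ 2 / wt v := by
  have hw := wt_pos v
  have hw2 := wt_sq v
  have hu2 : u ^ 2 ≤ 1 := by rw [← sq_abs]; nlinarith [abs_nonneg u]
  constructor
  · have e : θ * wt v * a ^ 2 + 2 * (θ * (u * v / wt v)) * a * b +
        (θ / 2 * u ^ 2 / wt v ^ 3 + (1 / (2 * θ) + 2 * θ) / wt v) * b ^ 2 -
        (θ / 2 * wt v * a ^ 2 + 1 / (2 * θ) * b ^ 2 / wt v) =
        θ / 2 * wt v * (a + 2 * (u * v) * b / wt v ^ 2) ^ 2 + θ / 2 * u ^ 2 / wt v ^ 3 * b ^ 2 +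
        2 * θ * b ^ 2 * (wt v ^ 2 - u ^ 2 * v ^ 2) / wt v ^ 3 := by
      field_simp
      ring
    have h3 : 0 ≤ wt v ^ 2 - u ^ 2 * v ^ 2 := by rw [hw2]; nlinarith [sq_nonneg v]
    have : 0 ≤ θ / 2 * wt v * (a + 2 * (u * v) * b / wt v ^ 2) ^ 2 +
        θ / 2 * u ^ 2 / wt v ^ 3 * b ^ 2 +
        2 * θ * b ^ 2 * (wt v ^ 2 - u ^ 2 * v ^ 2) / wt v ^ 3 := by positivity
    linarith
  · have e : ∀ s : ℝ, s ^ 2 = 1 → θ / 2 * wt v * a ^ 2 + 1 / (2 * θ) * b' ^ 2 / wt v - s * (a * b') =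
        θ / 2 * wt v * (a - s * b' / (θ * wt v)) ^ 2 := by
      intro s hs
      field_simp
      linear_combination (-1) * b' ^ 2 * hs
    have h0 : ∀ s : ℝ, 0 ≤ θ / 2 * wt v * (a - s * b' / (θ * wt v)) ^ 2 := fun s => by positivity
    rw [abs_le]
    constructor
    · have := e (-1) (by norm_num); have := h0 (-1); linarith
    · have := e 1 (by norm_num); have := h0 1; linarith

/-- The Bellman estimate, for a function `W` of time whose derivative is a bilinear expression
in the gradients. -/
theorem bellman_estimate {u v : ℝ → (Fin (n + 1) → ℝ) → ℝ}
    {du ddu dv ddv : Fin (n + 1) → ℝ → (Fin (n + 1) → ℝ) → ℝ}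
    (hu : HeatFlow u du ddu) (hv : HeatFlow v dv ddv) (h1 : ∀ t, 0 ≤ t → ∀ x, |u t x| ≤ 1)
    {θ : ℝ} (hθ : 0 < θ) (j l : Fin (n + 1)) {W : ℝ → ℝ}
    (hW : ∀ t, HasDerivAt W (2 * ∫ x in cube (n + 1), du j t x * dv l t x) t) {t : ℝ}
    (ht : 0 ≤ t) :
    |W t - W 0| ≤ θ * (∫ x in cube (n + 1), wt (v 0 x)) +
      (1 / θ + 4 * θ) * ∫ x in cube (n + 1), llog (v 0 x) := by
  set κ := 1 / (2 * θ) + 2 * θ with hκ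
  have hκ0 : 0 < κ := by positivity
  have cw := continuous_wt
  have cl := continuous_llog
  have ca := Real.continuous_arsinh
  have wne : ∀ v, wt v ≠ 0 := fun v => (wt_pos v).ne'
  have hG := fun t => hasDerivAt_entropy hu hv
    (Θ := fun u v => θ / 2 * u ^ 2 * wt v + κ * llog v)
    (Θ₁ := fun u v => θ * u * wt v)
    (Θ₂ := fun u v => θ / 2 * u ^ 2 * (v / wt v) + κ * Real.arsinh v)
    (Θ₁₁ := fun _ v => θ * wt v)
    (Θ₁₂ := fun u v => θ * (u * v / wt v))
    (Θ₂₂ := fun u v => θ / 2 * u ^ 2 / wt v ^ 3 + κ / wt v)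
    (fun f g f' g' τ hf hg => by
      refine ((((hf.pow 2).const_mul (θ / 2)).mul ((hasDerivAt_wt (g τ)).comp τ hg)).add
        (((hasDerivAt_llog (g τ)).comp τ hg).const_mul κ)).congr_deriv ?_
      simp; ring)
    (fun f g f' g' τ hf hg => by
      refine ((hf.const_mul θ).mul ((hasDerivAt_wt (g τ)).comp τ hg)).congr_deriv ?_
      simp; ring)
    (fun f g f' g' τ hf hg => by
      have hw := wne (g τ)
      have hw2 := wt_sq (g τ)
      refine ((((hf.pow 2).const_mul (θ / 2)).mul (hg.div ((hasDerivAt_wt (g τ)).comp τ hg)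
        hw)).add (((hasDerivAt_arsinh_wt (g τ)).comp τ hg).const_mul κ)).congr_deriv ?_
      simp only [Function.comp_apply, Pi.pow_apply, Pi.div_apply]
      field_simp
      linear_combination (θ * f τ ^ 2 * g') * hw2)
    (by fun_prop) (by fun_prop)
    (by fun_prop (disch := first | exact fun _ => wne _ | exact fun _ => pow_ne_zero _ (wne _)))
    (by fun_prop)
    (by fun_prop (disch := first | exact fun _ => wne _ | exact fun _ => pow_ne_zero _ (wne _)))
    (by fun_prop (disch := first | exact fun _ => wne _ | exact fun _ => pow_ne_zero _ (wne _))) t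
  set G := fun t => ∫ x in cube (n + 1), (θ / 2 * u t x ^ 2 * wt (v t x) + κ * llog (v t x))
    with hGdef
  have G_nonneg : ∀ t, 0 ≤ G t := fun t => integral_cube_nonneg fun x => by
    have := wt_pos (v t x); have := llog_nonneg (v t x); positivity
  have slu : ∀ t, Continuous fun x => u t x := fun t => hu.cont.comp
    (by fun_prop : Continuous fun x => (t, x))
  have slv : ∀ t, Continuous fun x => v t x := fun t => hv.cont.comp
    (by fun_prop : Continuous fun x => (t, x))
  have sldu : ∀ m t, Continuous fun x => du m t x := fun m t => (hu.cont_d m).comp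
    (by fun_prop : Continuous fun x => (t, x))
  have sldv : ∀ m t, Continuous fun x => dv m t x := fun m t => (hv.cont_d m).comp
    (by fun_prop : Continuous fun x => (t, x))
  -- The entropy `G` dissipates at least the integral of `s ∂ⱼu ∂ₗv`, which is `s/2` times the
  -- derivative of `W`. Hence `G + W/2` and `G - W/2` both decrease, and `G ≥ 0` bounds `|W t - W
  -- 0|` by `2 G 0`.
  have step : ∀ s : ℝ, |s| = 1 → G t + s / 2 * W t ≤ G 0 + s / 2 * W 0 := by
    intro s hs
    have hanti : AntitoneOn (fun t => G t + s / 2 * W t) (Ici 0) := by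
      have hd : ∀ t, HasDerivAt (fun t => G t + s / 2 * W t) _ t := fun t =>
        (hG t).add ((hW t).const_mul (s / 2))
      refine antitoneOn_of_deriv_nonpos (convex_Ici 0)
        (continuous_iff_continuousAt.2 fun t => (hd t).continuousAt).continuousOn
        (fun x _ => (hd x).differentiableAt.differentiableWithinAt) fun t ht => ?_
      rw [interior_Ici] at ht
      rw [(hd t).deriv]
      have : s * ∫ x in cube (n + 1), du j t x * dv l t x ≤
          ∫ x in cube (n + 1), ∑ m, (θ * wt (v t x) * du m t x ^ 2 +
            2 * (θ * (u t x * v t x / wt (v t x))) * du m t x * dv m t x +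
            (θ / 2 * u t x ^ 2 / wt (v t x) ^ 3 + κ / wt (v t x)) * dv m t x ^ 2) := by
        rw [← integral_const_mul]
        have := slu t; have := slv t; have := sldu j t; have := sldv l t
        have := fun m => sldu m t; have := fun m => sldv m t
        refine integral_cube_mono (by fun_prop) ?_ fun x => ?_
        · refine continuous_finsetSum _ fun m _ => ?_
          have := sldu m t; have := sldv m t
          fun_prop (disch := first | exact fun _ => wne _ | exact fun _ => pow_ne_zero _ (wne _))
        · have hux := h1 t ht.le x
          have hb := fun m => (bellman_pointwise (v := v t x) (a := du m t x) (b := dv m t x)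
            (b' := dv l t x) hθ hux).1
          refine le_trans ?_ (Finset.sum_le_sum fun m _ => hb m)
          rw [Finset.sum_add_distrib]
          have hw := wt_pos (v t x)
          have t1 := Finset.single_le_sum (f := fun m => θ / 2 * wt (v t x) * du m t x ^ 2)
            (fun m _ => by positivity) (Finset.mem_univ j)
          have t2 := Finset.single_le_sum (f := fun m => 1 / (2 * θ) * dv m t x ^ 2 / wt (v t x))
            (fun m _ => by positivity) (Finset.mem_univ l)
          have t3 := (bellman_pointwise (v := v t x) (a := du j t x) (b := dv l t x)
            (b' := dv l t x) hθ hux).2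
          refine le_trans ?_ (t3.trans (add_le_add t1 t2))
          refine (le_abs_self _).trans ?_
          rw [abs_mul s, hs, one_mul]
      linarith
    exact hanti self_mem_Ici ht ht
  have hG0 : 2 * G 0 ≤ θ * (∫ x in cube (n + 1), wt (v 0 x)) +
      (1 / θ + 4 * θ) * ∫ x in cube (n + 1), llog (v 0 x) := by
    rw [hGdef]
    simp only
    have := slu 0; have := slv 0
    rw [integral_add (integrableOn_cube (by fun_prop)) (integrableOn_cube (by fun_prop)),
      integral_const_mul κ]
    have h3 : ∫ x in cube (n + 1), θ / 2 * u 0 x ^ 2 * wt (v 0 x) ≤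
        θ / 2 * ∫ x in cube (n + 1), wt (v 0 x) := by
      rw [← integral_const_mul]
      refine integral_cube_mono (by fun_prop) (by fun_prop) fun x => ?_
      have hux := h1 0 le_rfl x
      have hu2 : u 0 x ^ 2 ≤ 1 := by rw [← sq_abs]; nlinarith [abs_nonneg (u 0 x)]
      have hw := wt_pos (v 0 x)
      nlinarith [mul_nonneg (mul_pos hθ hw).le (sub_nonneg.2 hu2)]
    have : 2 * κ = 1 / θ + 4 * θ := by rw [hκ]; field_simp; ring
    rw [← this]
    linarith
  have s1 := step 1 (by norm_num)
  have s2 := step (-1) (by norm_num)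
  have := G_nonneg t
  rw [abs_le]
  constructor <;> linarith

end Bellman

end

end SymDivQC

namespace SymDivQC

noncomputable section

/-! ### Pairing bounded trigonometric polynomials with second order Riesz transforms -/

section Riesz

variable {n : ℕ}

theorem HasPd.re {i : Fin n} {F F' : (Fin n → ℝ) → ℂ} (h : HasPd i F F') :
    HasPd i (fun x => (F x).re) fun x => (F' x).re :=
  fun x τ => Complex.reCLM.hasFDerivAt.comp_hasDerivAt τ (h x τ)

/-- The coefficients of the `m`-th partial derivative. -/
def pdCoeff (m : Fin n) (a : (Fin n → ℤ) → ℂ) (k : Fin n → ℤ) : ℂ :=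
  2 * Real.pi * Complex.I * k m * a k

theorem IsRealTrig.pdCoeff {T : Finset (Fin n → ℤ)} {a : (Fin n → ℤ) → ℂ} (h : IsRealTrig T a)
    (m : Fin n) : IsRealTrig T (pdCoeff m a) :=
  h.mul fun k => by simp [map_ofNat]

theorem continuous_trig_heat (T : Finset (Fin n → ℤ)) (a c : (Fin n → ℤ) → ℂ) :
    Continuous fun z : ℝ × (Fin n → ℝ) => (trig T (fun k => c k * heatCoeff a z.1 k) z.2).re := by
  unfold trig heatCoeff
  have := fun k : Fin n → ℤ => continuous_expo k
  fun_prop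

theorem heatFlow_trig {T : Finset (Fin n → ℤ)} (a : (Fin n → ℤ) → ℂ) :
    HeatFlow (fun t x => (trig T (heatCoeff a t) x).re)
      (fun m t x => (trig T (pdCoeff m (heatCoeff a t)) x).re)
      (fun m t x => (trig T (pdCoeff m (pdCoeff m (heatCoeff a t))) x).re) where
  cont := by simpa using continuous_trig_heat T a 1
  cont_d m := continuous_trig_heat T a _
  cont_dd m := by
    have e : ∀ t, pdCoeff m (pdCoeff m (heatCoeff a t)) = fun k => (2 * Real.pi * Complex.I * k m) *
        (2 * Real.pi * Complex.I * k m) * heatCoeff a t k := fun t => by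
      ext k; simp only [pdCoeff, mul_assoc]
    simp only [e]
    exact continuous_trig_heat T a _
  per t := (isPer_trig _ _).comp Complex.re
  per_d m t := (isPer_trig _ _).comp Complex.re
  hasPd m t := (hasPd_trig _ _ m).re
  hasPd_d m t := (hasPd_trig _ _ m).re
  time t x := by
    have h1 : ∀ k : Fin n → ℤ, HasDerivAt (fun t => heatCoeff a t k * expo k x)
        ((-decay k : ℝ) * heatCoeff a t k * expo k x) t := by
      intro k
      have h2 : HasDerivAt (fun t : ℝ => ((Real.exp (-decay k * t) : ℝ) : ℂ))
          ((Real.exp (-decay k * t) * (-decay k) : ℝ) : ℂ) t := by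
        have h3 : HasDerivAt (fun t : ℝ => -decay k * t) (-decay k) t := by
          simpa using (hasDerivAt_id t).const_mul (-decay k)
        exact h3.exp.ofReal_comp
      refine ((h2.mul_const (a k)).mul_const (expo k x)).congr_deriv ?_
      simp only [heatCoeff]
      push_cast; ring
    have h4 : HasDerivAt (fun t => trig T (heatCoeff a t) x)
        (∑ k ∈ T, (-decay k : ℝ) * heatCoeff a t k * expo k x) t :=
      HasDerivAt.fun_sum fun k _ => h1 k
    refine (Complex.reCLM.hasFDerivAt.comp_hasDerivAt t h4).congr_deriv ?_
    rw [← Complex.re_sum]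
    simp only [Complex.reCLM_apply]
    congr 1
    simp only [trig]
    rw [Finset.sum_comm]
    refine Finset.sum_congr rfl fun k _ => ?_
    simp only [pdCoeff, decay]
    rw [← Finset.sum_mul]
    congr 1
    push_cast
    rw [Finset.mul_sum, ← Finset.sum_neg_distrib, Finset.sum_mul]
    refine Finset.sum_congr rfl fun m _ => ?_
    linear_combination (-4 * Real.pi ^ 2 * (k m : ℂ) ^ 2 * heatCoeff a t k) * Complex.I_sq

/-- The symbol of the second order Riesz transform `-R_j R_l`. -/
def rz (k : Fin n → ℤ) (j l : Fin n) : ℝ := k j * k l / ∑ i, (k i : ℝ) ^ 2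

theorem rz_zero (j l : Fin n) : rz (0 : Fin n → ℤ) j l = 0 := by simp [rz]

theorem sum_sq_pos {k : Fin n → ℤ} (hk : k ≠ 0) : 0 < ∑ i, (k i : ℝ) ^ 2 := by
  obtain ⟨i, hi⟩ : ∃ i, k i ≠ 0 := by
    by_contra hc; push Not at hc; exact hk (funext hc)
  have hi' : (k i : ℝ) ≠ 0 := by exact_mod_cast hi
  exact Finset.sum_pos' (fun _ _ => sq_nonneg _) ⟨i, Finset.mem_univ _, by positivity⟩

theorem rz_mul_decay (k : Fin n → ℤ) (j l : Fin n) :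
    rz k j l * decay k = 4 * Real.pi ^ 2 * (k j * k l) := by
  by_cases hk : k = 0
  · subst hk; simp [rz]
  · have := (sum_sq_pos hk).ne'
    rw [rz, decay]; field_simp

/-- Here `-W t` is the Riesz pairing of the two heat flows. Both factors decay, hence the rate `2 *
decay k`, and `rz k j l * decay k` turns the derivative of `W` into the pairing of first derivatives
required by `bellman_estimate`. As `t → ∞` every mode `k ≠ 0` dies out and the mode `0` has symbol
zero, so `W t → 0` and the estimate bounds `W 0`. -/
theorem rz_add_riesz_trig {T : Finset (Fin (n + 1) → ℤ)} {a b : (Fin (n + 1) → ℤ) → ℂ}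
    (ha : IsRealTrig T a) (hb : IsRealTrig T b) (h1 : ∀ x, |(trig T a x).re| ≤ 1)
    {θ : ℝ} (hθ : 0 < θ) (j l : Fin (n + 1)) :
    |(∑ k ∈ T, (rz k j l : ℂ) * a k * (starRingEnd ℂ) (b k)).re| ≤
      θ * (∫ x in cube (n + 1), wt (trig T b x).re) +
      (1 / θ + 4 * θ) * ∫ x in cube (n + 1), llog (trig T b x).re := by
  have hnorm : ∀ x, ‖trig T a x‖ ≤ 1 := fun x => by
    rw [← ha.ofReal_re, Complex.norm_real]; exact h1 x
  have heat0 : ∀ c : (Fin (n + 1) → ℤ) → ℂ, heatCoeff c 0 = c := fun c => by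
    ext k; simp [heatCoeff]
  set w : (Fin (n + 1) → ℤ) → ℝ := fun k => (a k * (starRingEnd ℂ) (b k)).re with hw
  set W : ℝ → ℝ := fun t => -∑ k ∈ T, rz k j l * w k * Real.exp (-(2 * decay k) * t) with hWdef
  have hW : ∀ t, HasDerivAt W (2 * ∫ x in cube (n + 1),
      (trig T (pdCoeff j (heatCoeff a t)) x).re * (trig T (pdCoeff l (heatCoeff b t)) x).re) t := by
    intro t
    have h2 := integral_trig_mul ((ha.heat t).pdCoeff j)
      (Complex.continuous_re.comp (continuous_trig T (pdCoeff l (heatCoeff b t))))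
    simp only [Function.comp_def, fcoeff_trig ((hb.heat t).pdCoeff l)] at h2
    have h3 := congrArg Complex.re h2
    rw [Complex.ofReal_re] at h3
    rw [h3, Complex.re_sum, hWdef]
    have hd : HasDerivAt (fun t : ℝ => -∑ k ∈ T, rz k j l * w k * Real.exp (-(2 * decay k) * t))
        (-∑ k ∈ T, rz k j l * w k * (Real.exp (-(2 * decay k) * t) * (-(2 * decay k)))) t := by
      refine HasDerivAt.neg (HasDerivAt.fun_sum fun k _ => HasDerivAt.const_mul _ ?_)
      have h3 : HasDerivAt (fun t : ℝ => -(2 * decay k) * t) (-(2 * decay k)) t := by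
        simpa using (hasDerivAt_id t).const_mul (-(2 * decay k))
      exact h3.exp
    refine hd.congr_deriv ?_
    rw [← Finset.sum_neg_distrib, Finset.mul_sum]
    refine Finset.sum_congr rfl fun k _ => ?_
    have e1 : pdCoeff j (heatCoeff a t) k * (starRingEnd ℂ) (pdCoeff l (heatCoeff b t) k) =
        ((4 * Real.pi ^ 2 * (k j * k l) * Real.exp (-(2 * decay k) * t) : ℝ) : ℂ) *
          (a k * (starRingEnd ℂ) (b k)) := by
      simp only [pdCoeff, heatCoeff, map_mul, Complex.conj_ofReal, Complex.conj_I, map_ofNat,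
        map_intCast]
      have : Real.exp (-(2 * decay k) * t) = Real.exp (-decay k * t) * Real.exp (-decay k * t) := by
        rw [← Real.exp_add]; congr 1; ring
      rw [this]
      push_cast
      linear_combination (-4 * Real.pi ^ 2 * (k j * k l) * Complex.exp (-decay k * t) ^ 2 * a k *
        (starRingEnd ℂ) (b k)) * Complex.I_sq
    rw [e1, Complex.re_ofReal_mul, ← rz_mul_decay]
    simp only [hw]
    ring
  have hest := fun t (ht : 0 ≤ t) => bellman_estimate (heatFlow_trig (T := T) a)
    (heatFlow_trig (T := T) b)
    (fun t ht x => (Complex.abs_re_le_norm _).trans (norm_trig_heat_le hnorm ht x)) hθ j l hW ht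
  simp only [heat0] at hest
  have hlim : Tendsto (fun t => |W t - W 0|) atTop (𝓝 |0 - W 0|) := by
    refine Tendsto.abs (Tendsto.sub_const ?_ _)
    rw [hWdef]
    have : (0 : ℝ) = -∑ k ∈ T, 0 := by simp
    rw [this]
    refine Tendsto.neg (tendsto_finsetSum _ fun k _ => ?_)
    by_cases hk : k = 0
    · subst hk; simp [rz_zero]
    · have hdec : 0 < 2 * decay k := by
        have := sum_sq_pos hk
        have := Real.pi_pos
        unfold decay; positivity
      have h5 : Tendsto (fun t : ℝ => Real.exp (-(2 * decay k) * t)) atTop (𝓝 0) := by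
        refine Real.tendsto_exp_atBot.comp ?_
        exact tendsto_id.const_mul_atTop_of_neg (by linarith)
      simpa using h5.const_mul (rz k j l * w k)
  have := le_of_tendsto hlim ((eventually_ge_atTop 0).mono hest)
  refine le_trans (le_of_eq ?_) this
  rw [zero_sub, abs_neg, hWdef]
  simp only [mul_zero, Real.exp_zero, mul_one, abs_neg]
  rw [Complex.re_sum]
  congr 1
  refine Finset.sum_congr rfl fun k _ => ?_
  rw [mul_assoc, Complex.re_ofReal_mul]

theorem tendsto_integral_comp {E : Type*} [NormedAddCommGroup E] [ProperSpace E]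
    {f : (Fin n → ℝ) → E} {g : ℕ → (Fin n → ℝ) → E} {Ψ : E → ℝ} (hΨ : Continuous Ψ) {M : ℝ}
    (hM : ∀ x, ‖f x‖ ≤ M) (hg : ∀ N, Continuous (g N))
    (h : ∀ N x, ‖f x - g N x‖ ≤ 1 / ((N : ℝ) + 1)) :
    Tendsto (fun N => ∫ x in cube n, Ψ (g N x)) atTop (𝓝 (∫ x in cube n, Ψ (f x))) := by
  obtain ⟨C, hC⟩ := (isCompact_closedBall (0 : E) (M + 1)).exists_bound_of_continuousOn
    hΨ.continuousOn
  refine tendsto_integral_of_dominated_convergence (fun _ => C)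
    (fun N => (integrableOn_cube (hΨ.comp (hg N))).aestronglyMeasurable) (integrable_const C)
    (fun N => Eventually.of_forall fun x => hC _ ?_) (Eventually.of_forall fun x => ?_)
  · rw [mem_closedBall_zero_iff]
    have h1 : ‖g N x‖ ≤ ‖f x‖ + ‖f x - g N x‖ := by
      have := norm_sub_le (f x) (f x - g N x); simpa using this
    have h2 : 1 / ((N : ℝ) + 1) ≤ 1 := by
      rw [div_le_one (by positivity)]; linarith [Nat.cast_nonneg (α := ℝ) N]
    linarith [hM x, h N x]
  · refine (hΨ.tendsto _).comp ?_
    rw [tendsto_iff_norm_sub_tendsto_zero]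
    refine squeeze_zero (fun _ => norm_nonneg _) (fun N => ?_) tendsto_one_div_add_atTop_nhds_zero_nat
    rw [norm_sub_rev]; exact h N x

theorem norm_fcoeff_sub_le {f g : (Fin n → ℝ) → ℝ} (hf : Continuous f) (hg : Continuous g) {ε : ℝ}
    (h : ∀ x, |f x - g x| ≤ ε) (k : Fin n → ℤ) : ‖fcoeff f k - fcoeff g k‖ ≤ ε := by
  have hc : ∀ {f : (Fin n → ℝ) → ℝ}, Continuous f →
      Continuous fun x => (f x : ℂ) * expo (-k) x := fun hf =>
    (Complex.continuous_ofReal.comp hf).mul (continuous_expo _)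
  rw [fcoeff, fcoeff, ← integral_sub (integrableOn_cube (hc hf)) (integrableOn_cube (hc hg))]
  refine (norm_integral_le_of_norm_le_const (C := ε) (Eventually.of_forall fun x => ?_)).trans ?_
  · rw [← sub_mul, norm_mul, norm_expo, mul_one, ← Complex.ofReal_sub, Complex.norm_real]
    exact h x
  · simp

/-- Only the factor `trig T a` has to be bounded by one. The function `f` enters through finitely
many Fourier coefficients and through two integrals, all stable under uniform approximation by
trigonometric polynomials. -/
theorem riesz_estimate {T : Finset (Fin (n + 1) → ℤ)} {a : (Fin (n + 1) → ℤ) → ℂ}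
    (ha : IsRealTrig T a) (h1 : ∀ x, |(trig T a x).re| ≤ 1) {f : (Fin (n + 1) → ℝ) → ℝ}
    (hf : Continuous f) (hp : IsPer f) {θ : ℝ} (hθ : 0 < θ) (j l : Fin (n + 1)) :
    |(∑ k ∈ T, (rz k j l : ℂ) * a k * (starRingEnd ℂ) (fcoeff f k)).re| ≤
      θ * (∫ x in cube (n + 1), wt (f x)) + (1 / θ + 4 * θ) * ∫ x in cube (n + 1), llog (f x) := by
  classical
  obtain ⟨M, hM⟩ := hp.exists_bound hf
  have happ := fun N : ℕ => exists_trig_approx hf hp (Nat.one_div_pos_of_nat (α := ℝ) (n := N))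
  choose S b hb happ using happ
  have hcb : ∀ N, Continuous fun x => (trig (S N) (b N) x).re := fun N =>
    Complex.continuous_re.comp (continuous_trig _ _)
  have hest : ∀ N, |(∑ k ∈ T, (rz k j l : ℂ) * a k * (starRingEnd ℂ)
      (fcoeff (fun x => (trig (S N) (b N) x).re) k)).re| ≤
      θ * (∫ x in cube (n + 1), wt (trig (S N) (b N) x).re) +
      (1 / θ + 4 * θ) * ∫ x in cube (n + 1), llog (trig (S N) (b N) x).re := by
    intro N
    have hn : ∀ k ∈ T ∪ S N, -k ∈ T ∪ S N := fun k hk => by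
      rcases Finset.mem_union.1 hk with h | h
      · exact Finset.mem_union_left _ (ha.neg_mem k h)
      · exact Finset.mem_union_right _ ((hb N).neg_mem k h)
    have ha' := ha.mono (T' := T ∪ S N) Finset.subset_union_left hn
    have hb' := (hb N).mono (T' := T ∪ S N) Finset.subset_union_right hn
    have e1 : ∀ x, trig T a x = trig (T ∪ S N) a x := fun x =>
      trig_eq_of_subset Finset.subset_union_left ha.eq_zero x
    have e2 : ∀ x, trig (S N) (b N) x = trig (T ∪ S N) (b N) x := fun x =>
      trig_eq_of_subset Finset.subset_union_right (hb N).eq_zero x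
    have := rz_add_riesz_trig ha' hb' (fun x => by rw [← e1]; exact h1 x) hθ j l
    simp only [e2, fcoeff_trig hb']
    refine le_trans (le_of_eq ?_) this
    congr 2
    refine Finset.sum_subset Finset.subset_union_left fun k _ hk => ?_
    rw [ha.eq_zero k hk]; simp
  refine le_of_tendsto_of_tendsto (b := atTop) ?_ ?_ (Eventually.of_forall hest)
  · refine Tendsto.abs ((Complex.continuous_re.tendsto _).comp
      (tendsto_finsetSum _ fun k _ => Tendsto.const_mul _ ?_))
    refine (Complex.continuous_conj.tendsto _).comp ?_
    rw [tendsto_iff_norm_sub_tendsto_zero]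
    refine squeeze_zero (fun _ => norm_nonneg _) (fun N => ?_) tendsto_one_div_add_atTop_nhds_zero_nat
    rw [norm_sub_rev]
    exact norm_fcoeff_sub_le hf (hcb N) (fun x => (happ N x).le) k
  · exact ((tendsto_integral_comp continuous_wt hM hcb fun N x => (happ N x).le).const_mul _).add
      ((tendsto_integral_comp continuous_llog hM hcb fun N x => (happ N x).le).const_mul _)

end Riesz

end

end SymDivQC

namespace SymDivQC

noncomputable section

attribute [local instance] Matrix.frobeniusNormedAddCommGroup Matrix.frobeniusNormedSpace

/-! ### Quasiconvexity of Tartar's form, with an error estimate -/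

section Tartar

/-- For a symmetric matrix `A` with rows `(a,b,c)`, `(b,d,e)`, `(c,e,f)` and the unit vector `n =
(x,y,z)`, Tartar's form is nonnegative when `A n = 0`, because `A` is then a form on the plane
`n^⊥`, where `(tr A)² ≤ 2|A|²`. In general the loss is at most `2 s t` with `s = n · A n` and `t =
tr A`, and Young's inequality splits it into the two terms on the left. -/
theorem tartar_symbol_scalars {a b c d e f x y z η : ℝ} (hn : x ^ 2 + y ^ 2 + z ^ 2 = 1)
    (hη : 0 < η) :
    -(1 / η) * ((a * x + b * y + c * z) ^ 2 + (b * x + d * y + e * z) ^ 2 +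
      (c * x + e * y + f * z) ^ 2) - η * (a + d + f) ^ 2 ≤
    2 * (a ^ 2 + d ^ 2 + f ^ 2 + 2 * (b ^ 2 + c ^ 2 + e ^ 2)) - (a + d + f) ^ 2 := by
  obtain ⟨u, hu⟩ : ∃ u, u = a * x + b * y + c * z := ⟨_, rfl⟩
  obtain ⟨v, hv⟩ : ∃ v, v = b * x + d * y + e * z := ⟨_, rfl⟩
  obtain ⟨w, hw⟩ : ∃ w, w = c * x + e * y + f * z := ⟨_, rfl⟩
  obtain ⟨s, hs⟩ : ∃ s, s = x * u + y * v + z * w := ⟨_, rfl⟩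
  obtain ⟨t, ht⟩ : ∃ t, t = a + d + f := ⟨_, rfl⟩
  rw [← hu, ← hv, ← hw, ← ht]
  obtain ⟨p, hp⟩ : ∃ p, p = (s + t) / 2 := ⟨_, rfl⟩
  -- With `P = Id - n ⊗ n`, the right side is the squared norm of `P A P - ((t - s)/2) P`, the
  -- trace-free part of `A` restricted to `n^⊥`. The coefficient `p` of `n ⊗ n` collects `s` from `P
  -- A P` and `(t - s)/2` from `P`.
  have key : a ^ 2 + d ^ 2 + f ^ 2 + 2 * (b ^ 2 + c ^ 2 + e ^ 2) - 2 * (u ^ 2 + v ^ 2 + w ^ 2) +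
      s ^ 2 - (t - s) ^ 2 / 2 =
      (a - 2 * u * x + p * x ^ 2 - (t - s) / 2) ^ 2 +
      (d - 2 * v * y + p * y ^ 2 - (t - s) / 2) ^ 2 +
      (f - 2 * w * z + p * z ^ 2 - (t - s) / 2) ^ 2 +
      2 * ((b - u * y - v * x + p * x * y) ^ 2 + (c - u * z - w * x + p * x * z) ^ 2 +
        (e - v * z - w * y + p * y * z) ^ 2) := by
    subst hp
    linear_combination (-(2 * (u ^ 2 + v ^ 2 + w ^ 2) + ((s + t) / 2) ^ 2 *
        (x ^ 2 + y ^ 2 + z ^ 2 + 1) - 4 * ((s + t) / 2) * (x * u + y * v + z * w) -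
        ((s + t) / 2) * (t - s))) * hn
      - (4 * u - (s + t) * x) * hu - (4 * v - (s + t) * y) * hv - (4 * w - (s + t) * z) * hw
      + (2 * (x * u + y * v + z * w + s) - (s + t) + 2 * (t - s)) * hs - (t - s) * ht
  have h0 : 0 ≤ a ^ 2 + d ^ 2 + f ^ 2 + 2 * (b ^ 2 + c ^ 2 + e ^ 2) -
      2 * (u ^ 2 + v ^ 2 + w ^ 2) + s ^ 2 - (t - s) ^ 2 / 2 := by
    rw [key]; positivity
  have hcs : s ^ 2 ≤ u ^ 2 + v ^ 2 + w ^ 2 := by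
    have : u ^ 2 + v ^ 2 + w ^ 2 - s ^ 2 = (x * v - y * u) ^ 2 + (x * w - z * u) ^ 2 +
        (y * w - z * v) ^ 2 := by
      rw [hs]; linear_combination (-(u ^ 2 + v ^ 2 + w ^ 2)) * hn
    have : 0 ≤ (x * v - y * u) ^ 2 + (x * w - z * u) ^ 2 + (y * w - z * v) ^ 2 := by positivity
    linarith
  have h2 : 0 ≤ (1 / η) * (s - η * t) ^ 2 := by positivity
  have h3 : (1 / η) * (s - η * t) ^ 2 = (1 / η) * s ^ 2 - 2 * s * t + η * t ^ 2 := by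
    field_simp
    ring
  have h4 : (1 / η) * s ^ 2 ≤ (1 / η) * (u ^ 2 + v ^ 2 + w ^ 2) :=
    mul_le_mul_of_nonneg_left hcs (by positivity)
  have h5 : (t - s) ^ 2 = t ^ 2 - 2 * s * t + s ^ 2 := by ring
  have h6 := sq_nonneg s
  rw [h3] at h2
  rw [h5] at h0
  generalize (1 / η) * s ^ 2 = X at *
  rw [neg_mul]
  generalize (1 / η) * (u ^ 2 + v ^ 2 + w ^ 2) = Y at *
  linarith

theorem tartar_symbol_real {a : Fin 3 → Fin 3 → ℝ} (ha : ∀ i j, a i j = a j i) {k : Fin 3 → ℤ}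
    (hk : k ≠ 0) {η : ℝ} (hη : 0 < η) :
    -(1 / η) * (∑ i, ∑ j, ∑ l, rz k j l * (a i l * a i j)) - η * (∑ i, a i i) ^ 2 ≤
      2 * (∑ i, ∑ j, a i j ^ 2) - (∑ i, a i i) ^ 2 := by
  have hN := sum_sq_pos hk
  set N := ∑ i, (k i : ℝ) ^ 2 with hNdef
  have hs : √N ^ 2 = N := Real.sq_sqrt hN.le
  have hs0 : √N ≠ 0 := (Real.sqrt_pos.2 hN).ne'
  have hrz : ∀ j l, rz k j l = (k j / √N) * (k l / √N) := fun j l => by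
    rw [rz, ← hNdef, div_mul_div_comm, ← sq, hs]
  have hn : ((k 0 : ℝ) / √N) ^ 2 + (k 1 / √N) ^ 2 + (k 2 / √N) ^ 2 = 1 := by
    rw [div_pow, div_pow, div_pow, hs, ← add_div, ← add_div, div_eq_one_iff_eq hN.ne', hNdef,
      Fin.sum_univ_three]
  have := tartar_symbol_scalars (a := a 0 0) (b := a 0 1) (c := a 0 2) (d := a 1 1) (e := a 1 2)
    (f := a 2 2) hn hη
  simp only [hrz]
  simp only [Fin.sum_univ_three]
  rw [ha 1 0, ha 2 0, ha 2 1]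
  refine le_trans (le_of_eq ?_) (this.trans (le_of_eq ?_)) <;> ring

theorem tartar_symbol {A : Fin 3 → Fin 3 → ℂ} (hA : ∀ i j, A i j = A j i) {k : Fin 3 → ℤ}
    (hk : k ≠ 0) {η : ℝ} (hη : 0 < η) :
    -(1 / η) * (∑ i, ∑ j, ∑ l, rz k j l * (A i l * (starRingEnd ℂ) (A i j)).re) -
      η * Complex.normSq (∑ i, A i i) ≤
      2 * (∑ i, ∑ j, Complex.normSq (A i j)) - Complex.normSq (∑ i, A i i) := by
  have h1 := tartar_symbol_real (a := fun i j => (A i j).re) (fun i j => by rw [hA]) hk hη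
  have h2 := tartar_symbol_real (a := fun i j => (A i j).im) (fun i j => by rw [hA]) hk hη
  simp only [Complex.normSq_apply, Complex.mul_re, Complex.conj_re, Complex.conj_im,
    Complex.re_sum, Complex.im_sum]
  have e1 : ∑ i, ∑ j, ∑ l, rz k j l * ((A i l).re * (A i j).re - (A i l).im * -(A i j).im) =
      (∑ i, ∑ j, ∑ l, rz k j l * ((A i l).re * (A i j).re)) +
      ∑ i, ∑ j, ∑ l, rz k j l * ((A i l).im * (A i j).im) := by
    simp only [← Finset.sum_add_distrib]
    refine Finset.sum_congr rfl fun i _ => Finset.sum_congr rfl fun j _ =>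
      Finset.sum_congr rfl fun l _ => by ring
  have e2 : ∑ i, ∑ j, ((A i j).re * (A i j).re + (A i j).im * (A i j).im) =
      (∑ i, ∑ j, (A i j).re ^ 2) + ∑ i, ∑ j, (A i j).im ^ 2 := by
    simp only [← Finset.sum_add_distrib]
    refine Finset.sum_congr rfl fun i _ => Finset.sum_congr rfl fun j _ => by ring
  rw [e1, e2]
  linarith

theorem IsRealTrig.add {n : ℕ} {T : Finset (Fin n → ℤ)} {a b : (Fin n → ℤ) → ℂ}
    (ha : IsRealTrig T a) (hb : IsRealTrig T b) : IsRealTrig T fun k => a k + b k where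
  neg_mem := ha.neg_mem
  eq_zero k hk := by rw [ha.eq_zero k hk, hb.eq_zero k hk, add_zero]
  conj_eq k := by rw [ha.conj_eq, hb.conj_eq, map_add]

theorem parseval {n : ℕ} {T : Finset (Fin (n + 1) → ℤ)} {a : (Fin (n + 1) → ℤ) → ℂ}
    (ha : IsRealTrig T a) :
    ∫ x in cube (n + 1), (trig T a x).re ^ 2 = ∑ k ∈ T, Complex.normSq (a k) := by
  have := congrArg Complex.re (integral_trig_mul ha
    (Complex.continuous_re.comp (continuous_trig T a)))
  simp only [Function.comp_def, fcoeff_trig ha, Complex.ofReal_re] at this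
  simp only [sq]
  rw [this, Complex.re_sum]
  simp only [Complex.mul_conj, Complex.ofReal_re]

theorem ofReal_integral_trig {n : ℕ} {T : Finset (Fin (n + 1) → ℤ)} {a : (Fin (n + 1) → ℤ) → ℂ}
    (ha : IsRealTrig T a) : ((∫ x in cube (n + 1), (trig T a x).re : ℝ) : ℂ) = a 0 := by
  rw [← fcoeff_trig ha 0, fcoeff, ← integral_complex_ofReal]
  simp [expo_zero]

theorem riesz_estimate_scaled {n : ℕ} {T : Finset (Fin (n + 1) → ℤ)} {a : (Fin (n + 1) → ℤ) → ℂ}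
    (ha : IsRealTrig T a) {M : ℝ} (hM : 0 < M) (h1 : ∀ x, |(trig T a x).re| ≤ M)
    {f : (Fin (n + 1) → ℝ) → ℝ} (hf : Continuous f) (hp : IsPer f) {θ : ℝ} (hθ : 0 < θ)
    (j l : Fin (n + 1)) :
    |(∑ k ∈ T, (rz k j l : ℂ) * a k * (starRingEnd ℂ) (fcoeff f k)).re| ≤
      M * (θ * (∫ x in cube (n + 1), wt (f x)) +
        (1 / θ + 4 * θ) * ∫ x in cube (n + 1), llog (f x)) := by
  have hb : IsRealTrig T fun k => ((M⁻¹ : ℝ) : ℂ) * a k :=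
    ha.mul (m := fun _ => ((M⁻¹ : ℝ) : ℂ)) fun k => (Complex.conj_ofReal _).symm
  have e : ∀ x, (trig T (fun k => ((M⁻¹ : ℝ) : ℂ) * a k) x).re = M⁻¹ * (trig T a x).re := by
    intro x
    rw [← Complex.re_ofReal_mul, trig, trig, Finset.mul_sum]
    simp only [mul_assoc]
  have := riesz_estimate hb (fun x => by
    rw [e, abs_mul, abs_of_pos (inv_pos.2 hM), inv_mul_le_iff₀ hM, mul_one]; exact h1 x) hf hp hθ j l
  have e2 : ∑ k ∈ T, (rz k j l : ℂ) * (((M⁻¹ : ℝ) : ℂ) * a k) * (starRingEnd ℂ) (fcoeff f k) =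
      ((M⁻¹ : ℝ) : ℂ) * ∑ k ∈ T, (rz k j l : ℂ) * a k * (starRingEnd ℂ) (fcoeff f k) := by
    rw [Finset.mul_sum]
    exact Finset.sum_congr rfl fun k _ => by ring
  rw [e2, Complex.re_ofReal_mul, abs_mul, abs_of_pos (inv_pos.2 hM), inv_mul_le_iff₀ hM] at this
  exact this

/-- The error in the quasiconvexity inequality caused by a field `f`. -/
def errTerm (θ : ℝ) (f : (Fin 3 → ℝ) → ℝ) : ℝ :=
  θ * (∫ x in cube 3, wt (f x)) + (1 / θ + 4 * θ) * ∫ x in cube 3, llog (f x)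

/-- Parseval turns the integral of Tartar's form into a sum over modes: `k = 0` gives the form of
the mean, and every other mode is bounded below by the symbol inequality. The negative part there is
`|A k|² / |k|²`, the failure of the field to be divergence-free, which `hdiv` converts into a
pairing with the error fields `f i j`. -/
theorem tartar_trig {T : Finset (Fin 3 → ℤ)} {A : Fin 3 → Fin 3 → (Fin 3 → ℤ) → ℂ}
    (hA : ∀ i j, IsRealTrig T (A i j)) (hsym : ∀ i j, A i j = A j i) {M : ℝ} (hM : 0 < M)
    (hb : ∀ i j x, |(trig T (A i j) x).re| ≤ M) {f : Fin 3 → Fin 3 → (Fin 3 → ℝ) → ℝ}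
    (hf : ∀ i j, Continuous (f i j)) (hp : ∀ i j, IsPer (f i j))
    (hdiv : ∀ k i, ∑ j, (k j : ℂ) * (A i j k + fcoeff (f i j) k) = 0) {η θ : ℝ} (hη : 0 < η)
    (hθ : 0 < θ) :
    2 * (∑ i, ∑ j, (∫ x in cube 3, (trig T (A i j) x).re) ^ 2) -
      (∑ i, ∫ x in cube 3, (trig T (A i i) x).re) ^ 2 ≤
    (∫ x in cube 3, (2 * (∑ i, ∑ j, (trig T (A i j) x).re ^ 2) -
      (∑ i, (trig T (A i i) x).re) ^ 2)) +
      (1 / η) * (∑ i, ∑ j, ∑ _l : Fin 3, M * errTerm θ (f i j)) + η * (3 * M) ^ 2 := by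
  have hc : ∀ a, Continuous fun x => (trig T a x).re := fun a =>
    Complex.continuous_re.comp (continuous_trig T a)
  set c : (Fin 3 → ℤ) → ℂ := fun k => ∑ i, A i i k with hcdef
  have hcT : IsRealTrig T c := by
    simp only [hcdef, Fin.sum_univ_three]
    exact ((hA 0 0).add (hA 1 1)).add (hA 2 2)
  have hctr : ∀ x, ∑ i, (trig T (A i i) x).re = (trig T c x).re := by
    intro x
    rw [← Complex.re_sum]
    simp only [trig, hcdef, Finset.sum_mul]
    rw [Finset.sum_comm]
  simp only [hctr]
  have htr2 : ∑ k ∈ T, Complex.normSq (c k) ≤ (3 * M) ^ 2 := by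
    rw [← parseval hcT]
    refine (integral_cube_mono ((hc c).pow 2) continuous_const fun x => ?_).trans
      (integral_cube_const ((3 * M) ^ 2)).le
    simp only [Pi.pow_apply]
    rw [← hctr, Fin.sum_univ_three]
    have h0 := abs_le.1 (hb 0 0 x); have h1 := abs_le.1 (hb 1 1 x); have h2 := abs_le.1 (hb 2 2 x)
    apply sq_le_sq' <;> linarith
  have hint : ∫ x in cube 3, (2 * (∑ i, ∑ j, (trig T (A i j) x).re ^ 2) - (trig T c x).re ^ 2) =
      ∑ k ∈ T, (2 * (∑ i, ∑ j, Complex.normSq (A i j k)) - Complex.normSq (c k)) := by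
    rw [integral_sub, integral_const_mul, integral_finsetSum]
    · rw [Finset.sum_sub_distrib, ← parseval hcT, ← Finset.mul_sum, Finset.sum_comm]
      congr 2
      refine Finset.sum_congr rfl fun i _ => ?_
      rw [integral_finsetSum, Finset.sum_comm]
      · exact Finset.sum_congr rfl fun j _ => parseval (hA i j)
      · intro j _; exact integrableOn_cube ((hc _).pow 2)
    · intro i _
      exact integrableOn_cube (continuous_finsetSum _ fun j _ => (hc _).pow 2)
    · exact integrableOn_cube (continuous_const.mul (continuous_finsetSum _ fun i _ =>
        continuous_finsetSum _ fun j _ => (hc _).pow 2))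
    · exact integrableOn_cube ((hc c).pow 2)
  have hmean : 2 * (∑ i, ∑ j, (∫ x in cube 3, (trig T (A i j) x).re) ^ 2) -
      (∑ i, ∫ x in cube 3, (trig T (A i i) x).re) ^ 2 =
      2 * (∑ i, ∑ j, Complex.normSq (A i j 0)) - Complex.normSq (c 0) := by
    have h1 : ∀ i j, Complex.normSq (A i j 0) = (∫ x in cube 3, (trig T (A i j) x).re) ^ 2 :=
      fun i j => by rw [← ofReal_integral_trig (hA i j), Complex.normSq_ofReal, sq]
    have h2 : Complex.normSq (c 0) = (∑ i, ∫ x in cube 3, (trig T (A i i) x).re) ^ 2 := by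
      rw [hcdef]
      simp only [← ofReal_integral_trig (hA _ _)]
      rw [← Complex.ofReal_sum, Complex.normSq_ofReal, sq]
    rw [h2]; simp only [h1]
  rw [hint, hmean]
  set D : (Fin 3 → ℤ) → ℝ := fun k =>
    ∑ i, ∑ j, ∑ l, rz k j l * (A i l k * (starRingEnd ℂ) (A i j k)).re with hD
  have hpt : ∀ k ∈ T, (if k = 0 then 2 * (∑ i, ∑ j, Complex.normSq (A i j 0)) -
      Complex.normSq (c 0) else 0) - (1 / η) * D k - η * Complex.normSq (c k) ≤
      2 * (∑ i, ∑ j, Complex.normSq (A i j k)) - Complex.normSq (c k) := by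
    intro k _
    split_ifs with h
    · subst h
      have : D 0 = 0 := by simp [hD, rz_zero]
      rw [this]
      nlinarith [mul_nonneg hη.le (Complex.normSq_nonneg (c 0))]
    · have := tartar_symbol (A := fun i j => A i j k) (fun i j => by rw [hsym]) h hη
      simp only [hD, hcdef]
      linarith
  have hsum := Finset.sum_le_sum hpt
  rw [Finset.sum_sub_distrib, Finset.sum_sub_distrib, Finset.sum_ite_eq', ← Finset.mul_sum,
    ← Finset.mul_sum] at hsum
  have h0T : (if (0 : Fin 3 → ℤ) ∈ T then 2 * (∑ i, ∑ j, Complex.normSq (A i j 0)) -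
      Complex.normSq (c 0) else 0) =
      2 * (∑ i, ∑ j, Complex.normSq (A i j 0)) - Complex.normSq (c 0) := by
    split_ifs with h
    · rfl
    · simp [hcdef, (hA _ _).eq_zero _ h]
  rw [h0T] at hsum
  -- In `D k` one factor `A i j k` meets `k j` in the sum over `j`, so `hdiv` allows replacing it by
  -- `-fcoeff (f i j) k`. The remaining factor is bounded by `M`, and the Riesz estimate applies to
  -- each triple `i, j, l`.
  have hDsum : ∑ k ∈ T, D k ≤ ∑ i, ∑ j, ∑ _l : Fin 3, M * errTerm θ (f i j) := by
    have e1 : ∀ k, D k = -∑ i, ∑ j, ∑ l,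
        ((rz k j l : ℂ) * A i l k * (starRingEnd ℂ) (fcoeff (f i j) k)).re := by
      intro k
      rw [hD, eq_neg_iff_add_eq_zero]
      simp only
      rw [← Finset.sum_add_distrib]
      refine Finset.sum_eq_zero fun i _ => ?_
      rw [Finset.sum_comm, Finset.sum_comm (f := fun j l => ((rz k j l : ℂ) * A i l k *
        (starRingEnd ℂ) (fcoeff (f i j) k)).re), ← Finset.sum_add_distrib]
      refine Finset.sum_eq_zero fun l _ => ?_
      rw [← Finset.sum_add_distrib]
      have h1 : ∀ j, rz k j l * (A i l k * (starRingEnd ℂ) (A i j k)).re +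
          ((rz k j l : ℂ) * A i l k * (starRingEnd ℂ) (fcoeff (f i j) k)).re =
          (((k l : ℂ) / (∑ i, (k i : ℝ) ^ 2 : ℝ)) * A i l k *
            (starRingEnd ℂ) ((k j : ℂ) * (A i j k + fcoeff (f i j) k))).re := by
        intro j
        rw [← Complex.re_ofReal_mul, ← Complex.add_re, rz]
        congr 1
        rw [map_mul, map_add, map_intCast]
        push_cast
        ring
      simp only [h1]
      rw [← Complex.re_sum, ← Finset.mul_sum, ← map_sum, hdiv]
      simp
    simp only [e1]
    rw [Finset.sum_neg_distrib, Finset.sum_comm, ← Finset.sum_neg_distrib]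
    refine Finset.sum_le_sum fun i _ => ?_
    rw [Finset.sum_comm, ← Finset.sum_neg_distrib]
    refine Finset.sum_le_sum fun j _ => ?_
    rw [Finset.sum_comm, ← Finset.sum_neg_distrib]
    refine Finset.sum_le_sum fun l _ => ?_
    rw [← Complex.re_sum]
    exact (neg_le_abs _).trans (riesz_estimate_scaled (hA i l) hM (hb i l) (hf i j) (hp i j) hθ j l)
  have h5 : 1 / η * ∑ k ∈ T, D k ≤ 1 / η * ∑ i, ∑ j, ∑ _l : Fin 3, M * errTerm θ (f i j) :=
    mul_le_mul_of_nonneg_left hDsum (by positivity)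
  have h6 := mul_le_mul_of_nonneg_left htr2 hη.le
  linarith

end Tartar

end

end SymDivQC

namespace SymDivQC

noncomputable section

attribute [local instance] Matrix.frobeniusNormedAddCommGroup Matrix.frobeniusNormedSpace

/-! ### Tartar's inequality for continuous fields close to divergence-free ones -/

section Outer

theorem tartar_eq_sum (σ : Sym 3) :
    tartar σ = 2 * (∑ i, ∑ j, σ.mat i j ^ 2) - (∑ i, σ.mat i i) ^ 2 := by
  rw [tartar, σ.norm_sq, tr_apply, Fin.sum_univ_three (f := fun i => σ.mat i i)]

theorem fcoeff_sub {n : ℕ} {f g : (Fin n → ℝ) → ℝ} (hf : Continuous f) (hg : Continuous g)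
    (k : Fin n → ℤ) : fcoeff (fun x => f x - g x) k = fcoeff f k - fcoeff g k := by
  have hc : ∀ {f : (Fin n → ℝ) → ℝ}, Continuous f →
      Continuous fun x => (f x : ℂ) * expo (-k) x := fun hf =>
    (Complex.continuous_ofReal.comp hf).mul (continuous_expo _)
  rw [fcoeff, fcoeff, fcoeff, ← integral_sub (integrableOn_cube (hc hf)) (integrableOn_cube (hc hg))]
  congr 1; ext x; push_cast; ring

/-- Integration by parts against the character turns the vanishing divergence into orthogonality of
the Fourier coefficient to `k`. -/
theorem fcoeff_div {n : ℕ} {φ : (Fin (n + 1) → ℝ) → Sym (n + 1)} (hφ : IsTestField φ)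
    (k : Fin (n + 1) → ℤ) (i : Fin (n + 1)) :
    ∑ j, (k j : ℂ) * fcoeff (fun x => (φ x).mat i j) k = 0 := by
  have hs := contDiff_entry hφ.smooth i
  have hcpd : ∀ j, Continuous (pd j fun x => (φ x).mat i j) := fun j =>
    ((hs j).continuous_fderiv (by simp)).clm_apply continuous_const
  have hce : ∀ {f : (Fin (n + 1) → ℝ) → ℝ}, Continuous f →
      Continuous fun x => (f x : ℂ) * expo (-k) x := fun hf =>
    (Complex.continuous_ofReal.comp hf).mul (continuous_expo _)
  have h1 : ∀ j, (∫ x in cube (n + 1), ((pd j (fun x => (φ x).mat i j) x : ℝ) : ℂ) * expo (-k) x) =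
      2 * Real.pi * Complex.I * ((k j : ℂ) * fcoeff (fun x => (φ x).mat i j) k) := by
    intro j
    have hpd : HasPd j (fun x => (((φ x).mat i j : ℝ) : ℂ) * expo (-k) x)
        (fun x => ((pd j (fun x => (φ x).mat i j) x : ℝ) : ℂ) * expo (-k) x -
          2 * Real.pi * Complex.I * (k j) * ((((φ x).mat i j : ℝ) : ℂ) * expo (-k) x)) := by
      intro x τ
      have a1 := (hasPd_of_differentiable ((hs j).differentiable (by simp)) j x τ).ofReal_comp
      have a2 := hasPd_expo (-k) j x τ
      refine (a1.mul a2).congr_deriv ?_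
      simp only [Pi.neg_apply, Int.cast_neg]
      ring
    have h0 := hpd.integral_eq_zero
      ((hce (hcpd j)).sub (continuous_const.mul (hce (hs j).continuous))) (fun x m => by
        simp only [hφ.periodic x m, isPer_expo (-k) x m])
    rw [integral_sub (integrableOn_cube (hce (hcpd j))) (integrableOn_cube
      (F := fun x => 2 * Real.pi * Complex.I * (k j) * ((((φ x).mat i j : ℝ) : ℂ) * expo (-k) x))
      (continuous_const.mul (hce (hs j).continuous))), integral_const_mul, sub_eq_zero] at h0
    rw [h0, fcoeff, mul_assoc]
  have h2 : ∑ j, (∫ x in cube (n + 1), ((pd j (fun x => (φ x).mat i j) x : ℝ) : ℂ) *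
      expo (-k) x) = 0 := by
    rw [← integral_finsetSum _ fun j _ => integrableOn_cube (hce (hcpd j))]
    have : ∀ x, ∑ j, ((pd j (fun x => (φ x).mat i j) x : ℝ) : ℂ) * expo (-k) x = 0 := by
      intro x
      rw [← Finset.sum_mul, ← Complex.ofReal_sum]
      have := hφ.div_eq_zero x i
      simp only [pd]
      rw [this]; simp
    simp [this]
  simp only [h1] at h2
  rw [← Finset.mul_sum] at h2
  exact (mul_eq_zero.1 h2).resolve_left (by simp [Real.pi_ne_zero])

theorem exists_trig_approx_sym {g : (Fin 3 → ℝ) → Sym 3} (hg : Continuous g) (hp : IsPer g) {ε : ℝ}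
    (hε : 0 < ε) : ∃ (T : Finset (Fin 3 → ℤ)) (A : Fin 3 → Fin 3 → (Fin 3 → ℤ) → ℂ),
      (∀ i j, IsRealTrig T (A i j)) ∧ (∀ i j, A i j = A j i) ∧
      ∀ i j x, |(g x).mat i j - (trig T (A i j) x).re| < ε := by
  classical
  have := fun i j => exists_trig_approx (continuous_entry hg i j)
    (hp.comp fun σ : Sym 3 => σ.mat i j) hε
  choose S a ha happ using this
  have hsub : ∀ i j, S i j ⊆ Finset.univ.biUnion fun i => Finset.univ.biUnion (S i) := fun i j =>
    (Finset.subset_biUnion_of_mem (S i) (Finset.mem_univ j)).trans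
      (Finset.subset_biUnion_of_mem (fun i => Finset.univ.biUnion (S i)) (Finset.mem_univ i))
  have hneg : ∀ k ∈ Finset.univ.biUnion fun i => Finset.univ.biUnion (S i),
      -k ∈ Finset.univ.biUnion fun i => Finset.univ.biUnion (S i) := by
    intro k hk
    simp only [Finset.mem_biUnion, Finset.mem_univ, true_and] at hk ⊢
    obtain ⟨i, j, h⟩ := hk
    exact ⟨i, j, (ha i j).neg_mem k h⟩
  refine ⟨_, fun i j => a (min i j) (max i j), fun i j => (ha _ _).mono (hsub _ _) hneg,
    fun i j => by
      simp only [min_comm i j, max_comm i j], fun i j x => ?_⟩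
  rw [← trig_eq_of_subset (hsub _ _) (ha _ _).eq_zero]
  refine lt_of_le_of_lt (le_of_eq ?_) (happ (min i j) (max i j) x)
  rcases le_total i j with h | h
  · rw [min_eq_left h, max_eq_right h]
  · rw [min_eq_right h, max_eq_left h, (g x).mat_symm]

/-- The field `g` need not be divergence-free; its deviation from the test field `φ` is paid for by
`errTerm`. Trigonometric approximations of `g` may exceed `M` by up to one, hence `M + 1`. -/
theorem tartar_stability {φ g : (Fin 3 → ℝ) → Sym 3} (hφ : IsTestField φ) (hg : Continuous g)
    (hp : IsPer g) {M : ℝ} (hM : 0 ≤ M) (hb : ∀ x, ‖g x‖ ≤ M) {η θ : ℝ} (hη : 0 < η)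
    (hθ : 0 < θ) :
    tartar (∫ x in cube 3, g x) ≤ (∫ x in cube 3, tartar (g x)) +
      (1 / η) * (∑ i, ∑ j, ∑ _l : Fin 3, (M + 1) *
        errTerm θ fun x => (φ x).mat i j - (g x).mat i j) + η * (3 * (M + 1)) ^ 2 := by
  have happ := fun N : ℕ => exists_trig_approx_sym hg hp (Nat.one_div_pos_of_nat (α := ℝ) (n := N))
  choose T A hA hsym happ using happ
  have hcT : ∀ N i j, Continuous fun x => (trig (T N) (A N i j) x).re := fun N i j =>
    Complex.continuous_re.comp (continuous_trig _ _)
  have hcφ : ∀ i j, Continuous fun x => (φ x).mat i j := fun i j =>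
    continuous_entry hφ.smooth.continuous i j
  have hcg : ∀ i j, Continuous fun x => (g x).mat i j := fun i j => continuous_entry hg i j
  have hest := fun N => tartar_trig (hA N) (hsym N) (M := M + 1) (by linarith) (fun i j x => by
      have h1 := (happ N i j x).le
      have h2 : 1 / ((N : ℝ) + 1) ≤ 1 := by
        rw [div_le_one (by positivity)]; linarith [Nat.cast_nonneg (α := ℝ) N]
      have h3 := (Sym.abs_entry_le (g x) i j).trans (hb x)
      rw [abs_le] at *
      constructor <;> linarith)
    (f := fun i j x => (φ x).mat i j - (trig (T N) (A N i j) x).re)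
    (fun i j => (hcφ i j).sub (hcT N i j))
    (fun i j x m => by simp only [hφ.periodic x m, isPer_trig _ _ x m])
    (fun k i => by
      have := fcoeff_div hφ k i
      simp only [fcoeff_sub (hcφ _ _) (hcT N _ _), fcoeff_trig (hA N _ _)]
      simpa using this) hη hθ
  refine le_of_tendsto_of_tendsto (b := atTop) ?_ ?_ (Eventually.of_forall hest)
  · rw [tartar_eq_sum]
    simp only [integral_mat (integrableOn_cube hg)]
    have : ∀ i j, Tendsto (fun N => ∫ x in cube 3, (trig (T N) (A N i j) x).re) atTop
        (𝓝 (∫ x in cube 3, (g x).mat i j)) := fun i j =>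
      tendsto_integral_comp (Ψ := fun y : ℝ => y) continuous_id
        (fun x => (Sym.abs_entry_le (g x) i j).trans (hb x)) (fun N => hcT N i j)
        fun N x => (happ N i j x).le
    exact ((tendsto_finsetSum _ fun i _ => tendsto_finsetSum _ fun j _ =>
      (this i j).pow 2).const_mul 2).sub ((tendsto_finsetSum _ fun i _ => this i i).pow 2)
  · refine Tendsto.add (Tendsto.add ?_ (Tendsto.const_mul _ (tendsto_finsetSum _ fun i _ =>
      tendsto_finsetSum _ fun j _ => tendsto_finsetSum _ fun _ _ => Tendsto.const_mul _ ?_)))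
      tendsto_const_nhds
    · simp only [tartar_eq_sum]
      refine tendsto_integral_comp (E := Fin 3 → Fin 3 → ℝ)
        (Ψ := fun m => 2 * (∑ i, ∑ j, m i j ^ 2) - (∑ i, m i i) ^ 2) (by fun_prop) (M := M)
        (f := fun x i j => (g x).mat i j) (g := fun N x i j => (trig (T N) (A N i j) x).re)
        (fun x => ?_) (fun N => continuous_pi fun i => continuous_pi fun j => hcT N i j)
        fun N x => ?_
      · refine (pi_norm_le_iff_of_nonneg hM).2 fun i => (pi_norm_le_iff_of_nonneg hM).2 fun j => ?_
        exact (Sym.abs_entry_le (g x) i j).trans (hb x)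
      · have h0 : (0 : ℝ) ≤ 1 / ((N : ℝ) + 1) := by positivity
        exact (pi_norm_le_iff_of_nonneg h0).2 fun i => (pi_norm_le_iff_of_nonneg h0).2 fun j =>
          (happ N i j x).le
    · obtain ⟨C, hC⟩ := IsPer.exists_bound (F := fun x => (φ x).mat i j - (g x).mat i j)
        (fun x m => by simp only [hφ.periodic x m, hp x m]) ((hcφ i j).sub (hcg i j))
      have hd : ∀ N x, ‖((φ x).mat i j - (g x).mat i j) -
          ((φ x).mat i j - (trig (T N) (A N i j) x).re)‖ ≤ 1 / ((N : ℝ) + 1) := fun N x => by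
        rw [sub_sub_sub_cancel_left, norm_sub_rev]; exact (happ N i j x).le
      exact ((tendsto_integral_comp continuous_wt hC (fun N => (hcφ i j).sub (hcT N i j))
        hd).const_mul _).add ((tendsto_integral_comp continuous_llog hC
          (fun N => (hcφ i j).sub (hcT N i j)) hd).const_mul _)

theorem IsTestField.exists_bound {n : ℕ} {φ : (Fin n → ℝ) → Sym n} (hφ : IsTestField φ) :
    ∃ M, 0 ≤ M ∧ ∀ x, ‖φ x‖ ≤ M := by
  obtain ⟨M, hM⟩ := IsPer.exists_bound (F := φ) hφ.periodic hφ.smooth.continuous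
  exact ⟨M, (norm_nonneg _).trans (hM 0), hM⟩

theorem le_zero_of_forall_pos {X : ℝ} {F : ℝ → ℝ} (hF : Continuous F) (h0 : F 0 = 0)
    (h : ∀ η, 0 < η → X ≤ F η) : X ≤ 0 := by
  have : Tendsto F (𝓝[>] 0) (𝓝 0) := by
    have := hF.tendsto 0; rw [h0] at this; exact this.mono_left nhdsWithin_le_nhds
  exact ge_of_tendsto this (eventually_mem_nhdsWithin.mono fun η hη => h η hη)

/-- Tartar's form is symmetric div-quasiconvex. -/
theorem tartar_le_integral {φ : (Fin 3 → ℝ) → Sym 3} (hφ : IsTestField φ) :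
    tartar (∫ x in cube 3, φ x) ≤ ∫ x in cube 3, tartar (φ x) := by
  obtain ⟨M, hM, hb⟩ := hφ.exists_bound
  rw [← sub_nonpos]
  -- With `g = φ` the error field vanishes and `errTerm θ` reduces to `θ`. The choice `θ = η²` makes
  -- the 27 terms, divided by `η`, tend to zero with `η`.
  refine le_zero_of_forall_pos (F := fun η => 27 * (M + 1) * η + η * (3 * (M + 1)) ^ 2)
    (by fun_prop) (by simp) fun η hη => ?_
  have := tartar_stability hφ hφ.smooth.continuous hφ.periodic hM hb hη (sq_pos_of_pos hη)
  simp only [sub_self, errTerm, wt, llog_zero, Finset.sum_const, Finset.card_univ,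
    Fintype.card_fin, nsmul_eq_mul, integral_cube_const] at this
  have e : 1 / η * ((3 : ℕ) * ((3 : ℕ) * ((3 : ℕ) * ((M + 1) * (η ^ 2 * √(1 + 0 ^ 2) +
      (1 / η ^ 2 + 4 * η ^ 2) * 0))))) = 27 * (M + 1) * η := by
    norm_num
    field_simp
    ring
  rw [e] at this
  linarith

end Outer

end

end SymDivQC

namespace SymDivQC

noncomputable section

attribute [local instance] Matrix.frobeniusNormedAddCommGroup Matrix.frobeniusNormedSpace

/-! ### Outer bounds for the hulls -/

section Hull

theorem isTestField_const {n : ℕ} (ξ : Sym n) : IsTestField fun _ : Fin n → ℝ => ξ where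
  smooth := contDiff_const
  periodic _ _ := rfl
  div_eq_zero x i := by simp

theorem envelope_nonneg {n : ℕ} {f : Sym n → ℝ} (hf : ∀ η, 0 ≤ f η) (ξ : Sym n) :
    0 ≤ envelope f ξ :=
  Real.sInf_nonneg (by rintro _ ⟨φ, -, -, rfl⟩; exact integral_cube_nonneg fun x => hf _)

theorem exists_of_mem_hull {n : ℕ} {p : ℝ} {K : Set (Sym n)} {ξ : Sym n} (h : ξ ∈ hull p K) {ε : ℝ}
    (hε : 0 < ε) : ∃ φ : (Fin n → ℝ) → Sym n, IsTestField φ ∧ ∫ x in cube n, φ x = ξ ∧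
      ∫ x in cube n, Metric.infDist (φ x) K ^ p < ε := by
  have h' : sInf _ = (0 : ℝ) := h
  have hne : {r | ∃ φ : (Fin n → ℝ) → Sym n, IsTestField φ ∧ ∫ x in cube n, φ x = ξ ∧
      r = ∫ x in cube n, Metric.infDist (φ x) K ^ p}.Nonempty :=
    ⟨_, fun _ => ξ, isTestField_const ξ, by simp, rfl⟩
  obtain ⟨_, ⟨φ, h1, h2, rfl⟩, h3⟩ := exists_lt_of_csInf_lt hne (h'.trans_lt hε)
  exact ⟨φ, h1, h2, h3⟩

theorem mem_hull_of_forall {n : ℕ} {p : ℝ} {K : Set (Sym n)} {ξ : Sym n}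
    (h : ∀ ε, 0 < ε → ∃ φ : (Fin n → ℝ) → Sym n, IsTestField φ ∧ ∫ x in cube n, φ x = ξ ∧
      ∫ x in cube n, Metric.infDist (φ x) K ^ p ≤ ε) : ξ ∈ hull p K := by
  refine le_antisymm (le_of_forall_pos_le_add fun ε hε => ?_)
    (envelope_nonneg (fun η => Real.rpow_nonneg Metric.infDist_nonneg _) ξ)
  obtain ⟨φ, h1, h2, h3⟩ := h ε hε
  rw [zero_add]
  have hb : BddBelow {r | ∃ φ : (Fin n → ℝ) → Sym n, IsTestField φ ∧ ∫ x in cube n, φ x = ξ ∧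
      r = ∫ x in cube n, Metric.infDist (φ x) K ^ p} := by
    refine ⟨0, ?_⟩
    rintro _ ⟨φ, -, -, rfl⟩
    exact integral_cube_nonneg fun x => Real.rpow_nonneg Metric.infDist_nonneg _
  exact (csInf_le hb ⟨φ, h1, h2, rfl⟩).trans h3

theorem le_add_rpow {p τ d : ℝ} (hp : 1 < p) (hτ : 0 < τ) (hd : 0 ≤ d) :
    d ≤ τ + τ ^ (1 - p) * d ^ p := by
  rcases le_or_gt d τ with h | h
  · have : 0 ≤ τ ^ (1 - p) * d ^ p := by positivity
    linarith
  · have hd' : 0 < d := hτ.trans h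
    have h1 : d = d ^ (1 - p) * d ^ p := by
      rw [← Real.rpow_add hd']; simp
    have h2 : d ^ (1 - p) ≤ τ ^ (1 - p) :=
      Real.rpow_le_rpow_of_nonpos hτ h.le (by linarith)
    have h3 := mul_le_mul_of_nonneg_right h2 (by positivity : 0 ≤ d ^ p)
    linarith

/-- Near zero `d arsinh d` is small by continuity; away from zero the logarithmic factor is
dominated by `d ^ (p - 1)`. This is the point where `p > 1` is needed. -/
theorem llog_le {p τ : ℝ} (hp : 1 < p) (hτ : 0 < τ) :
    ∃ C : ℝ, 0 ≤ C ∧ ∀ v d : ℝ, |v| ≤ d → llog v ≤ τ + C * d ^ p := by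
  have hcont : Continuous fun d : ℝ => d * Real.arsinh d :=
    continuous_id.mul Real.continuous_arsinh
  obtain ⟨ρ, hρ, hball⟩ := Metric.continuous_iff.1 hcont 0 τ hτ
  have hs : 0 < p - 1 := by linarith
  refine ⟨(2 + 1 / ρ) ^ (p - 1) / (p - 1), by positivity, fun v d hvd => ?_⟩
  have hd : 0 ≤ d := (abs_nonneg v).trans hvd
  have h1 : llog v ≤ d * Real.arsinh d := by
    have h2 : v * Real.arsinh v = |v| * Real.arsinh |v| := by
      rcases abs_cases v with ⟨h, _⟩ | ⟨h, _⟩ <;> rw [h]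
      rw [Real.arsinh_neg]; ring
    have h3 : 1 ≤ wt v := by
      rw [wt, Real.one_le_sqrt]; linarith [sq_nonneg v]
    have h4 : |v| * Real.arsinh |v| ≤ d * Real.arsinh d :=
      mul_le_mul hvd (Real.arsinh_le_arsinh.2 hvd) (Real.arsinh_nonneg_iff.2 (abs_nonneg v)) hd
    rw [llog, h2]; linarith
  refine h1.trans ?_
  rcases lt_or_ge d ρ with h | h
  · have := hball d (by rw [Real.dist_eq, sub_zero, abs_of_nonneg hd]; exact h)
    rw [Real.dist_eq] at this
    have := (le_abs_self _).trans this.le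
    simp only [zero_mul, sub_zero] at this
    have : 0 ≤ (2 + 1 / ρ) ^ (p - 1) / (p - 1) * d ^ p := by positivity
    linarith
  · have hd0 : 0 < d := hρ.trans_le h
    have h5 : Real.arsinh d ≤ Real.log (2 * d + 1) := by
      rw [Real.arsinh]
      refine Real.log_le_log (by positivity) ?_
      have := wt_le d
      rw [wt, abs_of_nonneg hd] at this
      linarith
    have h6 : Real.log (2 * d + 1) ≤ (2 * d + 1) ^ (p - 1) / (p - 1) :=
      Real.log_le_rpow_div (by positivity) hs
    have h7 : (2 * d + 1) ^ (p - 1) ≤ ((2 + 1 / ρ) * d) ^ (p - 1) := by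
      refine Real.rpow_le_rpow (by positivity) ?_ hs.le
      have : 1 ≤ 1 / ρ * d := by rw [one_div, ← div_eq_inv_mul, one_le_div hρ]; exact h
      linarith
    rw [Real.mul_rpow (by positivity) hd] at h7
    have h8 : d * d ^ (p - 1) = d ^ p := by
      nth_rewrite 1 [← Real.rpow_one d]
      rw [← Real.rpow_add hd0]; congr 1; ring
    have h9 : Real.arsinh d ≤ (2 + 1 / ρ) ^ (p - 1) * d ^ (p - 1) / (p - 1) :=
      h5.trans (h6.trans (div_le_div_of_nonneg_right h7 hs.le))
    calc d * Real.arsinh d ≤ d * ((2 + 1 / ρ) ^ (p - 1) * d ^ (p - 1) / (p - 1)) :=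
          mul_le_mul_of_nonneg_left h9 hd
      _ = (2 + 1 / ρ) ^ (p - 1) / (p - 1) * (d * d ^ (p - 1)) := by ring
      _ ≤ _ := by rw [h8]; linarith

/-- Radial truncation at radius `R`. -/
def trunc (R : ℝ) (σ : Sym 3) : Sym 3 := (R / max R ‖σ‖) • σ

theorem continuous_trunc {R : ℝ} (hR : 0 < R) : Continuous (trunc R) := by
  unfold trunc
  have : ∀ σ : Sym 3, max R ‖σ‖ ≠ 0 := fun σ => (hR.trans_le (le_max_left _ _)).ne'
  fun_prop (disch := exact this)

theorem norm_trunc_le {R : ℝ} (hR : 0 < R) (σ : Sym 3) : ‖trunc R σ‖ ≤ R := by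
  have h0 : 0 < max R ‖σ‖ := hR.trans_le (le_max_left _ _)
  rw [trunc, norm_smul, Real.norm_of_nonneg (by positivity), div_mul_eq_mul_div, div_le_iff₀ h0]
  exact mul_le_mul_of_nonneg_left (le_max_right _ _) hR.le

/-- Truncation moves `σ` by the excess of its norm over `R`, and a set inside the ball of radius `R`
is at least that far away. -/
theorem norm_sub_trunc_le {R : ℝ} (hR : 0 < R) {K : Set (Sym 3)} (hK : K.Nonempty)
    (hKR : ∀ κ ∈ K, ‖κ‖ ≤ R) (σ : Sym 3) : ‖σ - trunc R σ‖ ≤ Metric.infDist σ K := by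
  have h0 : 0 < max R ‖σ‖ := hR.trans_le (le_max_left _ _)
  have h1 : ‖σ - trunc R σ‖ = max R ‖σ‖ * ((1 - R / max R ‖σ‖) * (‖σ‖ / max R ‖σ‖)) := by
    have : σ - trunc R σ = (1 - R / max R ‖σ‖) • σ := by rw [trunc, sub_smul, one_smul]
    rw [this, norm_smul, Real.norm_of_nonneg]
    · field_simp
    · rw [sub_nonneg, div_le_one h0]; exact le_max_left _ _
  rw [Metric.le_infDist hK]
  intro κ hκ
  have h2 : ‖σ‖ ≤ ‖κ‖ + dist σ κ := by
    rw [dist_eq_norm]; have := norm_add_le κ (σ - κ); simpa using this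
  have h3 : max R ‖σ‖ - R ≤ dist σ κ := by
    rcases max_cases R ‖σ‖ with ⟨h, _⟩ | ⟨h, _⟩ <;> rw [h]
    · simp
    · linarith [hKR κ hκ]
  refine le_trans ?_ h3
  rw [h1]
  have h4 : ‖σ‖ / max R ‖σ‖ ≤ 1 := by rw [div_le_one h0]; exact le_max_right _ _
  have h5 : 0 ≤ 1 - R / max R ‖σ‖ := by
    rw [sub_nonneg, div_le_one h0]; exact le_max_left _ _
  calc _ ≤ max R ‖σ‖ * ((1 - R / max R ‖σ‖) * 1) := by gcongr
    _ = _ := by field_simp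

/-- A continuous function that is nonpositive on `K` is controlled by the distance from `K`. -/
theorem exists_le_add_infDist {K : Set (Sym 3)} (hK : IsCompact K) (hKn : K.Nonempty)
    {h : Sym 3 → ℝ} (hc : Continuous h) (hh : ∀ κ ∈ K, h κ ≤ 0) (R : ℝ) {δ : ℝ} (hδ : 0 < δ) :
    ∃ C : ℝ, 0 ≤ C ∧ ∀ σ, ‖σ‖ ≤ R → h σ ≤ δ + C * Metric.infDist σ K := by
  have hB := isCompact_closedBall (0 : Sym 3) R
  obtain ⟨S, hS⟩ := hB.exists_bound_of_continuousOn hc.continuousOn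
  have hU := (hB.union hK).uniformContinuousOn_of_continuous hc.continuousOn
  obtain ⟨ρ, hρ, hU⟩ := Metric.uniformContinuousOn_iff.1 hU δ hδ
  refine ⟨|S| / ρ, by positivity, fun σ hσ => ?_⟩
  have hσ' : σ ∈ Metric.closedBall (0 : Sym 3) R := by rwa [mem_closedBall_zero_iff]
  obtain ⟨κ, hκ, e⟩ := hK.exists_infDist_eq_dist hKn σ
  rcases lt_or_ge (Metric.infDist σ K) ρ with hlt | hge
  · have := hU σ (Or.inl hσ') κ (Or.inr hκ) (by rw [← e]; exact hlt)
    rw [Real.dist_eq] at this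
    have h1 := (le_abs_self _).trans this.le
    have h2 := hh κ hκ
    have : 0 ≤ |S| / ρ * Metric.infDist σ K := mul_nonneg (by positivity) Metric.infDist_nonneg
    linarith
  · have h1 : h σ ≤ |S| := (le_abs_self _).trans ((hS σ hσ').trans (le_abs_self S))
    have h2 : |S| ≤ |S| / ρ * Metric.infDist σ K := by
      rw [div_mul_eq_mul_div, le_div_iff₀ hρ]
      exact mul_le_mul_of_nonneg_left hge (abs_nonneg S)
    linarith

theorem continuous_infDist {K : Set (Sym 3)} : Continuous fun σ => Metric.infDist σ K :=
  Metric.continuous_infDist_pt K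

theorem integral_infDist_le {p : ℝ} (hp : 1 < p) {K : Set (Sym 3)} {φ : (Fin 3 → ℝ) → Sym 3}
    (hφ : Continuous φ) {τ : ℝ} (hτ : 0 < τ) : ∫ x in cube 3, Metric.infDist (φ x) K ≤
      τ + τ ^ (1 - p) * ∫ x in cube 3, Metric.infDist (φ x) K ^ p := by
  have c1 : Continuous fun x => Metric.infDist (φ x) K := continuous_infDist.comp hφ
  have c2 : Continuous fun x => Metric.infDist (φ x) K ^ p :=
    c1.rpow_const fun _ => Or.inr (by linarith)
  have := integral_cube_mono c1 (by fun_prop : Continuous fun x =>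
      τ + τ ^ (1 - p) * Metric.infDist (φ x) K ^ p)
    fun x => le_add_rpow hp hτ (Metric.infDist_nonneg (x := φ x) (s := K))
  rwa [integral_add (integrable_const _) (integrableOn_cube (F := fun x => τ ^ (1 - p) * Metric.infDist (φ x) K ^ p)
    (continuous_const.mul c2)),
    integral_cube_const, integral_const_mul] at this

theorem exists_seq_of_mem_hull {p : ℝ} (hp : 1 < p) {K : Set (Sym 3)} {ξ : Sym 3}
    (hξ : ξ ∈ hull p K) : ∃ φ : ℕ → (Fin 3 → ℝ) → Sym 3, (∀ N, IsTestField (φ N)) ∧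
      (∀ N, ∫ x in cube 3, φ N x = ξ) ∧
      Tendsto (fun N => ∫ x in cube 3, Metric.infDist (φ N x) K ^ p) atTop (𝓝 0) ∧
      Tendsto (fun N => ∫ x in cube 3, Metric.infDist (φ N x) K) atTop (𝓝 0) := by
  choose φ h1 h2 h3 using fun N : ℕ => exists_of_mem_hull hξ (Nat.one_div_pos_of_nat (α := ℝ)
    (n := N))
  have t1 : Tendsto (fun N => ∫ x in cube 3, Metric.infDist (φ N x) K ^ p) atTop (𝓝 0) :=
    squeeze_zero (fun N => integral_cube_nonneg fun x => Real.rpow_nonneg Metric.infDist_nonneg _)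
      (fun N => (h3 N).le) tendsto_one_div_add_atTop_nhds_zero_nat
  refine ⟨φ, h1, h2, t1, ?_⟩
  refine tendsto_order.2 ⟨fun a ha => Eventually.of_forall fun N =>
    ha.trans_le (integral_cube_nonneg fun x => Metric.infDist_nonneg), fun a ha => ?_⟩
  have t2 : Tendsto (fun N => a / 2 + (a / 2) ^ (1 - p) *
      ∫ x in cube 3, Metric.infDist (φ N x) K ^ p) atTop (𝓝 (a / 2 + (a / 2) ^ (1 - p) * 0)) :=
    (t1.const_mul _).const_add _
  filter_upwards [t2.eventually_lt_const (by linarith : a / 2 + (a / 2) ^ (1 - p) * 0 < a)] with N hN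
  exact (integral_infDist_le hp (h1 N).smooth.continuous (by linarith)).trans_lt hN

/-- The fields in a sequence realizing `ξ` are close to `K` only in `L^p`, which does not control
the quadratic form if `p < 2`. Their truncations at a radius containing `K` are bounded, so the form
of the truncated fields is controlled by the distance from `K`, and `tartar_stability` accounts for
the lost divergence constraint. -/
theorem tartar_hull {p : ℝ} (hp : 1 < p) {K : Set (Sym 3)} (hK : IsCompact K) (hKn : K.Nonempty)
    {α c : ℝ} (hc : ∀ κ ∈ K, tartar κ + α * tr κ ≤ c) {ξ : Sym 3} (hξ : ξ ∈ hull p K) :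
    tartar ξ + α * tr ξ ≤ c := by
  obtain ⟨R0, hR0⟩ := hK.isBounded.exists_norm_le
  obtain ⟨R, hR, hKR⟩ : ∃ R, 0 < R ∧ ∀ κ ∈ K, ‖κ‖ ≤ R :=
    ⟨max R0 1, by positivity, fun κ hκ => (hR0 κ hκ).trans (le_max_left _ _)⟩
  obtain ⟨φ, hφ, hmean, tp, t1⟩ := exists_seq_of_mem_hull hp hξ
  have hcφ := fun N => (hφ N).smooth.continuous
  have ct := continuous_tartar
  have cg : ∀ N, Continuous fun x => trunc R (φ N x) := fun N => (continuous_trunc hR).comp (hcφ N)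
  have cd : ∀ N, Continuous fun x => Metric.infDist (φ N x) K := fun N =>
    continuous_infDist.comp (hcφ N)
  have cdp : ∀ N, Continuous fun x => Metric.infDist (φ N x) K ^ p := fun N =>
    (cd N).rpow_const fun _ => Or.inr (by linarith)
  have cent : ∀ N i j, Continuous fun x => (φ N x).mat i j - (trunc R (φ N x)).mat i j :=
    fun N i j => (continuous_entry (hcφ N) i j).sub (continuous_entry (cg N) i j)
  have hdiff : ∀ N i j x, |(φ N x).mat i j - (trunc R (φ N x)).mat i j| ≤
      Metric.infDist (φ N x) K := fun N i j x =>
    (Sym.abs_entry_le (φ N x - trunc R (φ N x)) i j).trans (norm_sub_trunc_le hR hKn hKR _)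
  have hgm : Tendsto (fun N => ∫ x in cube 3, trunc R (φ N x)) atTop (𝓝 ξ) := by
    rw [tendsto_iff_norm_sub_tendsto_zero]
    refine squeeze_zero (fun _ => norm_nonneg _) (fun N => ?_) t1
    rw [← hmean N, ← integral_sub (integrableOn_cube (cg N)) (integrableOn_cube (hcφ N))]
    refine norm_integral_le_of_norm_le (integrableOn_cube (cd N)) (Eventually.of_forall fun x => ?_)
    rw [norm_sub_rev]
    exact norm_sub_trunc_le hR hKn hKR _
  rw [← sub_nonpos]
  -- The limit along the sequence is taken at fixed `η`. With `θ = η²` and the tolerance `η⁴` in the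
  -- bound for `llog`, the error `(1/η)(θ + (1/θ + 4θ) η⁴)` equals `2η + 4η⁵`.
  refine le_zero_of_forall_pos (F := fun η => η + 27 * (R + 1) * (η + η + 4 * η ^ 5) +
    η * (3 * (R + 1)) ^ 2) (by fun_prop) (by simp) fun η hη => ?_
  obtain ⟨C, hC0, hC⟩ := exists_le_add_infDist hK hKn
    (h := fun σ => tartar σ + α * tr σ - c) (by fun_prop) (fun κ hκ => sub_nonpos.2 (hc κ hκ)) R hη
  obtain ⟨L, hL0, hL⟩ := llog_le hp (pow_pos hη 4)
  set θ := η ^ 2 with hθdef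
  have hθ : 0 < θ := by positivity
  have hest : ∀ N, tartar (∫ x in cube 3, trunc R (φ N x)) +
      α * tr (∫ x in cube 3, trunc R (φ N x)) - c ≤
      η + C * (2 * ∫ x in cube 3, Metric.infDist (φ N x) K) +
      (1 / η) * (27 * ((R + 1) * (θ * (1 + ∫ x in cube 3, Metric.infDist (φ N x) K) +
        (1 / θ + 4 * θ) * (η ^ 4 + L * ∫ x in cube 3, Metric.infDist (φ N x) K ^ p)))) +
      η * (3 * (R + 1)) ^ 2 := by
    intro N
    have h1 := tartar_stability (hφ N) (cg N) (fun x m => by simp only [(hφ N).periodic x m]) hR.le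
      (fun x => norm_trunc_le hR (φ N x)) hη hθ
    have herr : ∀ i j, errTerm θ (fun x => (φ N x).mat i j - (trunc R (φ N x)).mat i j) ≤
        θ * (1 + ∫ x in cube 3, Metric.infDist (φ N x) K) +
        (1 / θ + 4 * θ) * (η ^ 4 + L * ∫ x in cube 3, Metric.infDist (φ N x) K ^ p) := by
      intro i j
      have e1 : ∫ x in cube 3, wt ((φ N x).mat i j - (trunc R (φ N x)).mat i j) ≤
          1 + ∫ x in cube 3, Metric.infDist (φ N x) K := by
        have := cd N
        refine (integral_cube_mono (G := fun x => 1 + Metric.infDist (φ N x) K)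
          (continuous_wt.comp (cent N i j)) (by fun_prop)
          fun x => (wt_le _).trans (add_le_add_right (hdiff N i j x) 1)).trans ?_
        rw [integral_add (integrable_const _) (integrableOn_cube (cd N)), integral_cube_const]
      have e2 : ∫ x in cube 3, llog ((φ N x).mat i j - (trunc R (φ N x)).mat i j) ≤
          η ^ 4 + L * ∫ x in cube 3, Metric.infDist (φ N x) K ^ p := by
        have := cdp N
        refine (integral_cube_mono (G := fun x => η ^ 4 + L * Metric.infDist (φ N x) K ^ p)
          (continuous_llog.comp (cent N i j)) (by fun_prop) fun x => hL _ _ (hdiff N i j x)).trans ?_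
        rw [integral_add (integrable_const _) (integrableOn_cube (by fun_prop)),
          integral_cube_const, integral_const_mul]
      rw [errTerm]
      gcongr
    have h2 : ∑ i, ∑ j, ∑ _l : Fin 3, (R + 1) *
        errTerm θ (fun x => (φ N x).mat i j - (trunc R (φ N x)).mat i j) ≤
        27 * ((R + 1) * (θ * (1 + ∫ x in cube 3, Metric.infDist (φ N x) K) +
        (1 / θ + 4 * θ) * (η ^ 4 + L * ∫ x in cube 3, Metric.infDist (φ N x) K ^ p))) := by
      refine (Finset.sum_le_sum fun i _ => Finset.sum_le_sum fun j _ => Finset.sum_le_sum fun _ _ =>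
        mul_le_mul_of_nonneg_left (herr i j) (by linarith)).trans (le_of_eq ?_)
      simp only [Finset.sum_const, Finset.card_univ, Fintype.card_fin, nsmul_eq_mul]
      push_cast; ring
    have h3 : (∫ x in cube 3, tartar (trunc R (φ N x))) +
        α * tr (∫ x in cube 3, trunc R (φ N x)) - c ≤
        η + C * (2 * ∫ x in cube 3, Metric.infDist (φ N x) K) := by
      rw [← tr.integral_comp_comm (integrableOn_cube (cg N)), ← integral_const_mul]
      have c1 : Continuous fun x => tartar (trunc R (φ N x)) := ct.comp (cg N)
      have c2 : Continuous fun x => α * tr (trunc R (φ N x)) :=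
        continuous_const.mul (tr.continuous.comp (cg N))
      rw [← integral_add (integrableOn_cube c1) (integrableOn_cube c2)]
      have e0 : (∫ x in cube 3, (tartar (trunc R (φ N x)) + α * tr (trunc R (φ N x)))) - c =
          ∫ x in cube 3, (tartar (trunc R (φ N x)) + α * tr (trunc R (φ N x)) - c) := by
        rw [integral_sub (integrableOn_cube (by fun_prop)) (integrable_const _),
          integral_cube_const]
      rw [e0]
      have := cd N
      refine (integral_cube_mono (G := fun x => η + C * (2 * Metric.infDist (φ N x) K))
        (by fun_prop) (by fun_prop)
        fun x => (hC _ (norm_trunc_le hR (φ N x))).trans (add_le_add_right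
          (mul_le_mul_of_nonneg_left (b := Metric.infDist (trunc R (φ N x)) K)
          (c := 2 * Metric.infDist (φ N x) K) ?_ hC0) η)).trans ?_
      · have e1 := Metric.infDist_le_infDist_add_dist (s := K) (x := trunc R (φ N x)) (y := φ N x)
        have e2 := norm_sub_trunc_le hR hKn hKR (φ N x)
        rw [dist_comm, dist_eq_norm] at e1
        linarith
      · rw [integral_add (integrable_const _) (integrableOn_cube (by fun_prop)), integral_cube_const, integral_const_mul,
          integral_const_mul]
    have h4 := mul_le_mul_of_nonneg_left h2 (by positivity : 0 ≤ 1 / η)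
    linarith
  have hlim := le_of_tendsto_of_tendsto (b := atTop)
    (((ct.tendsto ξ).comp hgm).add (((tr.continuous.tendsto ξ).comp hgm).const_mul α) |>.sub_const c)
    (((((t1.const_mul 2).const_mul C).const_add η).add (((((t1.const_add 1).const_mul θ).add
      (((tp.const_mul L).const_add (η ^ 4)).const_mul (1 / θ + 4 * θ))).const_mul
      (R + 1)).const_mul 27 |>.const_mul (1 / η))).add_const (η * (3 * (R + 1)) ^ 2))
    (Eventually.of_forall hest)
  refine hlim.trans (le_of_eq ?_)
  rw [hθdef]
  field_simp
  ring

/-- Tartar's form plus an affine function is quasiconvex, its positive part is admissible in the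
definition of the hull, and this positive part vanishes on `K`. -/
theorem tartar_hullInfty {K : Set (Sym 3)} (hKn : K.Nonempty)
    {α c : ℝ} (hc : ∀ κ ∈ K, tartar κ + α * tr κ ≤ c) {ξ : Sym 3} (hξ : ξ ∈ hullInfty K) :
    tartar ξ + α * tr ξ ≤ c := by
  have ct := continuous_tartar
  have hcont : Continuous fun σ => max (tartar σ + α * tr σ - c) 0 := by fun_prop
  have h := hξ (fun σ => max (tartar σ + α * tr σ - c) 0) hcont (fun _ => le_max_right _ _)
    ⟨by borelize (Sym 3); exact hcont.measurable, fun σ => ?_, fun φ hφ => ?_⟩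
  · have h2 : sSup ((fun σ => max (tartar σ + α * tr σ - c) 0) '' K) ≤ 0 :=
      csSup_le (hKn.image _) (by
        rintro _ ⟨κ, hκ, rfl⟩
        exact max_le (sub_nonpos.2 (hc κ hκ)) le_rfl)
    have := (le_max_left _ _).trans (h.trans h2)
    linarith
  · exact ⟨_, (hcont.continuousAt (x := σ)).norm.eventually_le_const (lt_add_one _), _,
      fun η hη => hη⟩
  · have cφ := hφ.smooth.continuous
    refine max_le ?_ (integral_cube_nonneg fun x => le_max_right _ _)
    have h1 := tartar_le_integral hφ
    have c1 : Continuous fun x => tartar (φ x) := ct.comp cφ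
    have c2 : Continuous fun x => α * tr (φ x) := by fun_prop
    have h2 : (∫ x in cube 3, (tartar (φ x) + α * tr (φ x) - c)) =
        (∫ x in cube 3, tartar (φ x)) + α * tr (∫ x in cube 3, φ x) - c := by
      rw [integral_sub (integrableOn_cube (by fun_prop)) (integrable_const _),
        integral_add (integrableOn_cube c1) (integrableOn_cube c2), integral_cube_const,
        integral_const_mul, tr.integral_comp_comm (integrableOn_cube cφ)]
    have h3 : ∫ x in cube 3, (tartar (φ x) + α * tr (φ x) - c) ≤
        ∫ x in cube 3, max (tartar (φ x) + α * tr (φ x) - c) 0 :=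
      integral_cube_mono ((c1.add c2).sub continuous_const) (hcont.comp cφ) fun x => le_max_left _ _
    linarith

/-- Jensen's inequality on the cube. -/
theorem convex_le_integral {F : Sym 3 → ℝ} (hF : ConvexOn ℝ univ F) (hc : Continuous F)
    {φ : (Fin 3 → ℝ) → Sym 3} (hφ : Continuous φ) :
    F (∫ x in cube 3, φ x) ≤ ∫ x in cube 3, F (φ x) :=
  hF.map_integral_le hc.continuousOn isClosed_univ (Eventually.of_forall fun _ => mem_univ _)
    (integrableOn_cube hφ) (integrableOn_cube (hc.comp hφ))

/-- Jensen's inequality applies to the fields themselves; the Lipschitz bound dominates `F` by a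
multiple of the distance from `K`, whose mean tends to zero. -/
theorem convex_hull_le {p : ℝ} (hp : 1 < p) {K : Set (Sym 3)} (hK : IsCompact K) (hKn : K.Nonempty)
    {F : Sym 3 → ℝ} (hF : ConvexOn ℝ univ F) (hc : Continuous F) {L : ℝ}
    (hL : ∀ σ κ, F σ ≤ F κ + L * dist σ κ) (hFK : ∀ κ ∈ K, F κ ≤ 0) {ξ : Sym 3}
    (hξ : ξ ∈ hull p K) : F ξ ≤ 0 := by
  obtain ⟨φ, hφ, hmean, -, t1⟩ := exists_seq_of_mem_hull hp hξ
  have t2 := t1.const_mul L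
  rw [mul_zero] at t2
  refine ge_of_tendsto t2 (Eventually.of_forall fun N => ?_)
  rw [← hmean N, ← integral_const_mul]
  have cφ := (hφ N).smooth.continuous
  refine (convex_le_integral hF hc cφ).trans (integral_cube_mono (hc.comp cφ)
    (continuous_const.mul (continuous_infDist.comp cφ)) fun x => ?_)
  obtain ⟨κ, hκ, e⟩ := hK.exists_infDist_eq_dist hKn (φ N x)
  have := hL (φ N x) κ
  have := hFK κ hκ
  rw [e]; linarith

theorem convex_hullInfty_le {K : Set (Sym 3)} (hKn : K.Nonempty) {F : Sym 3 → ℝ}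
    (hF : ConvexOn ℝ univ F) (hc : Continuous F) (hFK : ∀ κ ∈ K, F κ ≤ 0) {ξ : Sym 3}
    (hξ : ξ ∈ hullInfty K) : F ξ ≤ 0 := by
  have hcont : Continuous fun σ => max (F σ) 0 := by fun_prop
  have hconv : ConvexOn ℝ univ fun σ => max (F σ) 0 := hF.sup (convexOn_const 0 convex_univ)
  have h := hξ (fun σ => max (F σ) 0) hcont (fun _ => le_max_right _ _)
    ⟨by borelize (Sym 3); exact hcont.measurable, fun σ => ?_, fun φ hφ =>
      convex_le_integral hconv hcont hφ.smooth.continuous⟩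
  · refine (le_max_left _ _).trans (h.trans (csSup_le (hKn.image _) ?_))
    rintro _ ⟨κ, hκ, rfl⟩
    exact max_le (hFK κ hκ) le_rfl
  · exact ⟨_, (hcont.continuousAt (x := σ)).norm.eventually_le_const (lt_add_one _), _,
      fun η hη => hη⟩

end Hull

end

end SymDivQC

namespace SymDivQC

noncomputable section

/-! ### Geometry of the `(p, q)`-plane -/

section Plane

/-- The set is the projection of a closed set along the compact factor `T`. The slopes `α` are
sorted in this way by the side on which a line of slope `α` touches `T` from above. -/
theorem isClosed_maximizer {T : Set (ℝ × ℝ)} (hT : IsCompact T) {C : Set (ℝ × ℝ)}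
    (hC : IsClosed C) :
    IsClosed {α : ℝ | ∃ z ∈ T, z ∈ C ∧ ∀ w ∈ T, w.2 - α * w.1 ≤ z.2 - α * z.1} := by
  have : CompactSpace T := isCompact_iff_compactSpace.1 hT
  have h1 : IsClosed {x : ℝ × T | (x.2 : ℝ × ℝ) ∈ C ∧ ∀ w ∈ T, w.2 - x.1 * w.1 ≤
      (x.2 : ℝ × ℝ).2 - x.1 * (x.2 : ℝ × ℝ).1} := by
    have e : {x : ℝ × T | (x.2 : ℝ × ℝ) ∈ C ∧ ∀ w ∈ T, w.2 - x.1 * w.1 ≤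
        (x.2 : ℝ × ℝ).2 - x.1 * (x.2 : ℝ × ℝ).1} = (fun x : ℝ × T => (x.2 : ℝ × ℝ)) ⁻¹' C ∩
        ⋂ w ∈ T, {x : ℝ × T | w.2 - x.1 * w.1 ≤ (x.2 : ℝ × ℝ).2 - x.1 * (x.2 : ℝ × ℝ).1} := by
      ext x; simp
    rw [e]
    refine (hC.preimage (by fun_prop)).inter ?_
    exact isClosed_iInter fun w => isClosed_iInter fun _ => isClosed_le (by fun_prop) (by fun_prop)
  have h2 := isClosedMap_fst_of_compactSpace _ h1
  convert h2 using 1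
  ext α
  constructor
  · rintro ⟨z, hz, hzC, h⟩
    exact ⟨(α, ⟨z, hz⟩), ⟨hzC, h⟩, rfl⟩
  · rintro ⟨⟨a, z⟩, ⟨hzC, h⟩, rfl⟩
    exact ⟨z, z.2, hzC, h⟩

/-- A compact planar set has a line above it touching it on both sides of `x₀`. -/
theorem exists_support_line {T : Set (ℝ × ℝ)} (hT : IsCompact T) {x₀ : ℝ}
    (hl : ∃ z ∈ T, z.1 < x₀) (hr : ∃ z ∈ T, x₀ < z.1) :
    ∃ α β : ℝ, (∀ z ∈ T, z.2 ≤ α * z.1 + β) ∧ ∃ z₁ ∈ T, ∃ z₂ ∈ T, z₁.1 ≤ x₀ ∧ x₀ ≤ z₂.1 ∧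
      z₁.2 = α * z₁.1 + β ∧ z₂.2 = α * z₂.1 + β := by
  have hmax : ∀ α : ℝ, ∃ z ∈ T, ∀ w ∈ T, w.2 - α * w.1 ≤ z.2 - α * z.1 := fun α =>
    hT.exists_isMaxOn (hl.imp fun _ h => h.1) (f := fun z : ℝ × ℝ => z.2 - α * z.1)
      (by fun_prop)
  obtain ⟨S, hS⟩ : ∃ S, ∀ z ∈ T, |z.2| ≤ S := by
    obtain ⟨S, hS⟩ := hT.exists_bound_of_continuousOn (f := fun z : ℝ × ℝ => z.2) (by fun_prop)
    exact ⟨S, hS⟩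
  -- The slopes with a touching point to the left of `x₀` and those with one to the right form two
  -- closed sets covering the line; once both are nonempty, a common slope exists.
  have h := isPreconnected_closed_iff.1 (isPreconnected_univ (α := ℝ)) _ _
    (isClosed_maximizer hT (isClosed_le continuous_fst continuous_const : IsClosed {z : ℝ × ℝ | z.1 ≤ x₀}))
    (isClosed_maximizer hT (isClosed_le continuous_const continuous_fst : IsClosed {z : ℝ × ℝ | x₀ ≤ z.1}))
    (fun α _ => by
      obtain ⟨z, hz, h⟩ := hmax α
      rcases le_total z.1 x₀ with hle | hle
      · exact Or.inl ⟨z, hz, hle, h⟩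
      · exact Or.inr ⟨z, hz, hle, h⟩) ?_ ?_
  · obtain ⟨α, -, ⟨z₁, hz₁, h₁, hm₁⟩, ⟨z₂, hz₂, h₂, hm₂⟩⟩ := h
    have := hm₁ z₂ hz₂
    have := hm₂ z₁ hz₁
    exact ⟨α, z₁.2 - α * z₁.1, fun z hz => by linarith [hm₁ z hz], z₁, hz₁, z₂, hz₂, h₁, h₂,
      by ring, by linarith⟩
  · obtain ⟨u, hu, hux⟩ := hl
    have hg : 0 < x₀ - u.1 := by linarith
    -- A slope so steep that passing from `u` beyond `x₀` costs more than `2S + 1`, whereas second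
    -- coordinates in `T` differ by at most `2S`.
    obtain ⟨z, hz, hm⟩ := hmax ((2 * S + 1) / (x₀ - u.1))
    refine ⟨_, trivial, z, hz, ?_, hm⟩
    by_contra hc
    have hc' : x₀ < z.1 := not_le.1 hc
    have h1 := hm u hu
    have h2 := abs_le.1 (hS u hu)
    have h3 := abs_le.1 (hS z hz)
    have h0 : 0 < (2 * S + 1) / (x₀ - u.1) := by
      have := (abs_nonneg _).trans (hS u hu); positivity
    have h4 : (2 * S + 1) / (x₀ - u.1) * (x₀ - u.1) = 2 * S + 1 := div_mul_cancel₀ _ hg.ne'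
    nlinarith [mul_pos h0 (sub_pos.2 hc')]
  · obtain ⟨u, hu, hux⟩ := hr
    have hg : 0 < u.1 - x₀ := by linarith
    obtain ⟨z, hz, hm⟩ := hmax (-((2 * S + 1) / (u.1 - x₀)))
    refine ⟨_, trivial, z, hz, ?_, hm⟩
    by_contra hc
    have hc' : z.1 < x₀ := not_le.1 hc
    have h1 := hm u hu
    have h2 := abs_le.1 (hS u hu)
    have h3 := abs_le.1 (hS z hz)
    have h0 : 0 < (2 * S + 1) / (u.1 - x₀) := by
      have := (abs_nonneg _).trans (hS u hu); positivity
    have h4 : (2 * S + 1) / (u.1 - x₀) * (u.1 - x₀) = 2 * S + 1 := div_mul_cancel₀ _ hg.ne'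
    nlinarith [mul_pos h0 (sub_pos.2 hc')]

/-- A bound on the tangent directions bounds difference quotients. -/
theorem eventually_slope_le {S : Set (ℝ × ℝ)} {y : ℝ × ℝ} {κ κ' : ℝ}
    (h : ∀ e ∈ tangentConeAt ℝ S y, |e.2| ≤ κ * |e.1|) (hκ : κ < κ') :
    ∀ᶠ z in 𝓝[S] y, |z.2 - y.2| ≤ κ' * |z.1 - y.1| := by
  by_contra hc
  rw [not_eventually] at hc
  obtain ⟨z, hz, hlt⟩ := exists_seq_forall_of_frequently
    (hc.and_eventually (eventually_mem_nhdsWithin (a := y) (s := S)))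
  have hlt' : ∀ n, κ' * |(z n).1 - y.1| < |(z n).2 - y.2| := fun n => not_le.1 (hlt n).1
  have hne : ∀ n, z n - y ≠ 0 := fun n h0 => by
    have := hlt' n
    rw [sub_eq_zero] at h0
    rw [h0] at this; simp at this
  have hunit : ∀ n, ‖z n - y‖⁻¹ • (z n - y) ∈ Metric.sphere (0 : ℝ × ℝ) 1 := fun n => by
    rw [mem_sphere_zero_iff_norm, norm_smul, norm_inv, norm_norm,
      inv_mul_cancel₀ (norm_ne_zero_iff.2 (hne n))]
  obtain ⟨e, he, ψ, hψ, hlim⟩ := (isCompact_sphere (0 : ℝ × ℝ) 1).tendsto_subseq hunit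
  have hz0 : Tendsto (fun n => z n - y) atTop (𝓝 0) := by
    have := (hz.mono_right nhdsWithin_le_nhds).sub_const y
    rwa [sub_self] at this
  have hmem : e ∈ tangentConeAt ℝ S y := by
    refine mem_tangentConeAt_of_seq atTop (fun n => ‖z (ψ n) - y‖⁻¹) (fun n => z (ψ n) - y)
      (hz0.comp hψ.tendsto_atTop) (Eventually.of_forall fun n => ?_) hlim
    simpa using (hlt (ψ n)).2
  have h1 := h e hmem
  have h2 : κ' * |e.1| ≤ |e.2| := by
    have t1 : Tendsto (fun n => κ' * |(‖z (ψ n) - y‖⁻¹ • (z (ψ n) - y)).1|) atTop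
        (𝓝 (κ' * |e.1|)) := (((continuous_fst.tendsto e).comp hlim).abs).const_mul κ'
    have t2 : Tendsto (fun n => |(‖z (ψ n) - y‖⁻¹ • (z (ψ n) - y)).2|) atTop (𝓝 |e.2|) :=
      ((continuous_snd.tendsto e).comp hlim).abs
    refine le_of_tendsto_of_tendsto t1 t2 (Eventually.of_forall fun n => ?_)
    simp only [Prod.smul_fst, Prod.smul_snd, Prod.fst_sub, Prod.snd_sub, smul_eq_mul, abs_mul]
    have := mul_le_mul_of_nonneg_left (hlt' (ψ n)).le (abs_nonneg ‖z (ψ n) - y‖⁻¹)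
    linarith
  have h3 : |e.1| = 0 := by nlinarith [abs_nonneg e.1]
  have h4 : |e.2| = 0 := by
    rw [h3, mul_zero] at h1; exact le_antisymm h1 (abs_nonneg _)
  have h5 : e = 0 := Prod.ext (abs_eq_zero.1 h3) (abs_eq_zero.1 h4)
  rw [h5] at he
  simp at he

/-- The function `4q² - 3p²`. -/
def wfun (y : ℝ × ℝ) : ℝ := 4 * y.2 ^ 2 - 3 * y.1 ^ 2

theorem continuous_wfun : Continuous wfun := by unfold wfun; fun_prop

/-- In the difference of two values of `sepFun y₀` the term with `q₀` cancels, and `p₀` survives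
only as the coefficient `6 p₀` of the pressure. -/
theorem separated_iff {H : Set (ℝ × ℝ)} {y : ℝ × ℝ} :
    Separated H y ↔ ∃ α : ℝ, ∀ z ∈ H, wfun z + α * z.1 < wfun y + α * y.1 := by
  constructor
  · rintro ⟨y₀, -, h⟩
    refine ⟨6 * y₀.1, fun z hz => ?_⟩
    have := h z hz
    simp only [sepFun, wfun] at *
    linarith
  · rintro ⟨α, h⟩
    refine ⟨(α / 6, 0), le_rfl, fun z hz => ?_⟩
    have := h z hz
    simp only [sepFun, wfun] at *
    linarith

theorem not_separated_iff {H : Set (ℝ × ℝ)} {y : ℝ × ℝ} :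
    ¬ Separated H y ↔ ∀ α : ℝ, ∃ z ∈ H, wfun y + α * y.1 ≤ wfun z + α * z.1 := by
  rw [separated_iff]; push Not; rfl

theorem subset_hat {H : Set (ℝ × ℝ)} (hH : ∀ y ∈ H, 0 ≤ y.2) : H ⊆ hat H :=
  fun y hy => ⟨hH y hy, 0, le_rfl, by simpa using hy⟩

theorem hat_of_le {H : Set (ℝ × ℝ)} {p q q' : ℝ} (h : (p, q') ∈ hat H) (hq : 0 ≤ q) (hqq : q ≤ q') :
    (p, q) ∈ hat H := by
  obtain ⟨-, a, ha, h⟩ := h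
  refine ⟨hq, q' - q + a, by linarith, ?_⟩
  convert h using 2
  simp only; ring

theorem convexHull_hat_nonneg {H : Set (ℝ × ℝ)} {y : ℝ × ℝ} (h : y ∈ convexHull ℝ (hat H)) :
    0 ≤ y.2 := by
  have hc : Convex ℝ {z : ℝ × ℝ | 0 ≤ z.2} := (convex_Ici (0 : ℝ)).linear_preimage
    (LinearMap.snd ℝ ℝ ℝ)
  exact convexHull_min (fun z hz => hz.1) hc h

theorem convexHull_hat_le {H : Set (ℝ × ℝ)} {s t : ℝ} (hs : ∀ z ∈ H, z.2 ≤ s * z.1 + t)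
    {y : ℝ × ℝ} (h : y ∈ convexHull ℝ (hat H)) : y.2 ≤ s * y.1 + t := by
  have hc : Convex ℝ {z : ℝ × ℝ | z.2 - s * z.1 ≤ t} := (convex_Iic t).linear_preimage
    (LinearMap.snd ℝ ℝ ℝ - s • LinearMap.fst ℝ ℝ ℝ)
  have : y.2 - s * y.1 ≤ t := by
    refine convexHull_min (fun z hz => ?_) hc h
    obtain ⟨-, a, ha, hz⟩ := hz
    have := hs _ hz
    simp only [mem_ofPred_eq] at *
    linarith
  linarith

theorem subset_Hsdqc {H : Set (ℝ × ℝ)} (hH : ∀ y ∈ H, 0 ≤ y.2) : H ⊆ Hsdqc H := fun y hy =>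
  ⟨subset_convexHull ℝ _ (subset_hat hH hy), not_separated_iff.2 fun _ => ⟨y, hy, le_rfl⟩⟩

/-- Points over an extreme pressure that cannot be separated belong to `Ĥ`. -/
theorem mem_hat_of_extreme {H : Set (ℝ × ℝ)} (hH : ∀ y ∈ H, 0 ≤ y.2) (hHc : IsCompact H)
    {y : ℝ × ℝ} (hy : 0 ≤ y.2) (hsep : ¬ Separated H y) {s : ℝ} (hs : s ≠ 0)
    (hext : ∀ z ∈ H, 0 ≤ s * (z.1 - y.1)) : y ∈ hat H := by
  rw [not_separated_iff] at hsep
  -- The weights `-(n s)` penalize pressures different from that of `y` more and more. An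
  -- accumulation point of the `z n` therefore has the pressure of `y`, and its value of `wfun` is
  -- no smaller.
  choose z hz hle using fun n : ℕ => hsep (-(n * s))
  obtain ⟨z₀, hz₀, ψ, hψ, hlim⟩ := hHc.tendsto_subseq hz
  obtain ⟨S, hS⟩ := hHc.exists_bound_of_continuousOn continuous_wfun.continuousOn
  have h1 : z₀.1 = y.1 := by
    have hb : ∀ n : ℕ, s * ((z n).1 - y.1) ≤ (S - wfun y) * (1 / ((n : ℝ))) ∨ n = 0 := by
      intro n
      rcases Nat.eq_zero_or_pos n with h | h
      · exact Or.inr h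
      · left
        have hn : (0 : ℝ) < n := by exact_mod_cast h
        have := hle n
        have := (le_abs_self _).trans (hS (z n) (hz n))
        rw [mul_one_div, le_div_iff₀ hn]
        nlinarith
    have t1 : Tendsto (fun n => s * ((z (ψ n)).1 - y.1)) atTop (𝓝 (s * (z₀.1 - y.1))) :=
      (((continuous_fst.tendsto z₀).comp hlim).sub_const _).const_mul s
    have t2 : Tendsto (fun n => (S - wfun y) * (1 / ((ψ n : ℕ) : ℝ))) atTop
        (𝓝 ((S - wfun y) * 0)) :=
      ((tendsto_one_div_atTop_nhds_zero_nat (𝕜 := ℝ)).comp hψ.tendsto_atTop).const_mul _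
    rw [mul_zero] at t2
    have h2 : s * (z₀.1 - y.1) ≤ 0 := by
      refine le_of_tendsto_of_tendsto t1 t2 ?_
      filter_upwards [eventually_gt_atTop 0] with n hn
      have : ψ n ≠ 0 := by have := hψ.id_le n; simp only [id] at this; omega
      exact (hb (ψ n)).resolve_right this
    have h3 := le_antisymm h2 (hext z₀ hz₀)
    have := (mul_eq_zero.1 h3).resolve_left hs
    linarith
  have h2 : wfun y ≤ wfun z₀ := by
    have t1 : Tendsto (fun n => wfun (z (ψ n))) atTop (𝓝 (wfun z₀)) :=
      (continuous_wfun.tendsto z₀).comp hlim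
    refine ge_of_tendsto t1 (Eventually.of_forall fun n => ?_)
    have := hle (ψ n)
    have := mul_nonneg (Nat.cast_nonneg (α := ℝ) (ψ n)) (hext _ (hz (ψ n)))
    nlinarith
  have h3 : y.2 ≤ z₀.2 := by
    simp only [wfun, h1] at h2
    exact (sq_le_sq₀ hy (hH z₀ hz₀)).1 (by linarith)
  exact ⟨hy, z₀.2 - y.2, by linarith, by convert hz₀ using 1; ext <;> simp [h1]⟩

end Plane

end

end SymDivQC

namespace SymDivQC

noncomputable section

/-! ### The upper boundary of `H^sdqc` and its slope -/

section Hyperbola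

theorem mem_frontier_of_top {S : Set (ℝ × ℝ)} {x c : ℝ} (h : (x, c) ∈ S)
    (h' : ∀ δ, 0 < δ → (x, c + δ) ∉ S) : (x, c) ∈ frontier S := by
  refine ⟨subset_closure h, fun hi => ?_⟩
  obtain ⟨ε, hε, hb⟩ := Metric.mem_nhds_iff.1 (mem_interior_iff_mem_nhds.1 hi)
  refine h' (ε / 2) (by positivity) (hb ?_)
  rw [Metric.mem_ball, Prod.dist_eq]
  simp [abs_of_pos hε, hε]

theorem mem_hat_of_wfun_le {H : Set (ℝ × ℝ)} (hH : ∀ y ∈ H, 0 ≤ y.2) {y z : ℝ × ℝ} (hy : 0 ≤ y.2)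
    (hz : z ∈ H) (h1 : z.1 = y.1) (h2 : wfun y ≤ wfun z) : y ∈ hat H := by
  have h3 : y.2 ≤ z.2 := by
    simp only [wfun, h1] at h2
    exact (sq_le_sq₀ hy (hH z hz)).1 (by linarith)
  exact ⟨hy, z.2 - y.2, by linarith, by convert hz using 1; ext <;> simp [h1]⟩

theorem wfun_le_of_not_separated {H : Set (ℝ × ℝ)} {y : ℝ × ℝ} (h : ¬ Separated H y) {α β : ℝ}
    (hαβ : ∀ z ∈ H, wfun z ≤ α * z.1 + β) : wfun y ≤ α * y.1 + β := by
  obtain ⟨z, hz, hle⟩ := not_separated_iff.1 h (-α)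
  have := hαβ z hz
  linarith

/-- A point below a chord belongs to the convex hull of `Ĥ`. -/
theorem mem_convexHull_of_chord {H : Set (ℝ × ℝ)} (hH : ∀ y ∈ H, 0 ≤ y.2) {x c s t : ℝ}
    {u₁ u₂ : ℝ × ℝ} (hu₁ : u₁ ∈ H) (hu₂ : u₂ ∈ H) (hl₁ : u₁.2 = s * u₁.1 + t)
    (hl₂ : u₂.2 = s * u₂.1 + t) (hux₁ : u₁.1 < x) (hux₂ : x < u₂.1) (hc : 0 ≤ c)
    (hcl : c ≤ s * x + t) : (x, c) ∈ convexHull ℝ (hat H) := by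
  obtain ⟨τ, hτ0, hτ1, hτ⟩ : ∃ τ : ℝ, 0 ≤ τ ∧ τ ≤ 1 ∧ c = τ * (s * x + t) := by
    rcases (hc.trans hcl).eq_or_lt with h | h
    · exact ⟨0, le_rfl, zero_le_one, by rw [← h] at hcl; linarith⟩
    · exact ⟨c / (s * x + t), by positivity, by rwa [div_le_one h], by field_simp⟩
  have hmem : ∀ u ∈ H, (u.1, τ * u.2) ∈ hat H := fun u hu =>
    hat_of_le (subset_hat hH hu) (mul_nonneg hτ0 (hH u hu))
      (by simpa using mul_le_mul_of_nonneg_right hτ1 (hH u hu))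
  have hd : 0 < u₂.1 - u₁.1 := by linarith
  have hcomb := (convex_convexHull ℝ (hat H)) (subset_convexHull ℝ _ (hmem u₁ hu₁))
    (subset_convexHull ℝ _ (hmem u₂ hu₂))
    (a := (u₂.1 - x) / (u₂.1 - u₁.1)) (b := (x - u₁.1) / (u₂.1 - u₁.1))
    (div_nonneg (by linarith) hd.le) (div_nonneg (by linarith) hd.le) (by field_simp; ring)
  convert hcomb using 1
  ext
  · simp only [Prod.smul_mk, Prod.mk_add_mk, smul_eq_mul]
    field_simp; ring
  · simp only [Prod.smul_mk, Prod.mk_add_mk, smul_eq_mul]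
    rw [hτ, hl₁, hl₂]
    field_simp; ring

/-- A point below two chords belongs to `H^sdqc`. -/
theorem mem_Hsdqc_of_chords {H : Set (ℝ × ℝ)} (hH : ∀ y ∈ H, 0 ≤ y.2) {x c α β s t : ℝ}
    {z₁ z₂ u₁ u₂ : ℝ × ℝ} (hz₁ : z₁ ∈ H) (hz₂ : z₂ ∈ H) (hu₁ : u₁ ∈ H) (hu₂ : u₂ ∈ H)
    (hw₁ : wfun z₁ = α * z₁.1 + β) (hw₂ : wfun z₂ = α * z₂.1 + β) (hl₁ : u₁.2 = s * u₁.1 + t)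
    (hl₂ : u₂.2 = s * u₂.1 + t) (hzx₁ : z₁.1 < x) (hzx₂ : x < z₂.1) (hux₁ : u₁.1 < x)
    (hux₂ : x < u₂.1) (hc : 0 ≤ c) (hcl : c ≤ s * x + t) (hcw : wfun (x, c) ≤ α * x + β) :
    (x, c) ∈ Hsdqc H := by
  constructor
  · exact mem_convexHull_of_chord hH hu₁ hu₂ hl₁ hl₂ hux₁ hux₂ hc hcl
  · rw [not_separated_iff]
    intro γ
    by_contra hcon
    push Not at hcon
    have h1 := hcon z₁ hz₁
    have h2 := hcon z₂ hz₂
    simp only at h1 h2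
    -- At `(x, c)` the function `wfun + γ p` is at most `(α + γ) x + β`, a weighted mean of its
    -- values at `z₁` and `z₂`; it cannot strictly exceed both.
    nlinarith [mul_pos (sub_pos.2 hzx₁) (sub_pos.2 h2), mul_pos (sub_pos.2 hzx₂) (sub_pos.2 h1)]

theorem quadratic_pos_of_concave {a b c x₁ x₂ p : ℝ} (ha : a < 0) (h1 : x₁ < p) (h2 : p < x₂)
    (hx₁ : 0 ≤ a * x₁ ^ 2 + b * x₁ + c) (hx₂ : 0 ≤ a * x₂ ^ 2 + b * x₂ + c) :
    0 < a * p ^ 2 + b * p + c := by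
  have e : (x₂ - x₁) * (a * p ^ 2 + b * p + c) = (x₂ - p) * (a * x₁ ^ 2 + b * x₁ + c) +
      (p - x₁) * (a * x₂ ^ 2 + b * x₂ + c) + (-a) * ((p - x₁) * (x₂ - p) * (x₂ - x₁)) := by ring
  have h3 : 0 < (x₂ - x₁) * (a * p ^ 2 + b * p + c) := by
    rw [e]
    have := mul_nonneg (sub_pos.2 h2).le hx₁
    have := mul_nonneg (sub_pos.2 h1).le hx₂
    have := mul_pos (neg_pos.2 ha) (mul_pos (mul_pos (sub_pos.2 h1) (sub_pos.2 h2))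
      (sub_pos.2 (h1.trans h2)))
    linarith
  exact (mul_pos_iff_of_pos_left (by linarith)).1 h3

set_option maxHeartbeats 1000000 in
/-- Every point of `H^sdqc` outside `Ĥ` lies below a branch of a hyperbola that joins two points of
`H` and is not too steep at the given pressure. -/
theorem exists_hyperbola {H : Set (ℝ × ℝ)} (hH : ∀ y ∈ H, 0 ≤ y.2) (hHc : IsCompact H)
    (hconn : IsConnected (Hsdqc H))
    (htan : ∀ y ∈ frontier (Hsdqc H) \ hat H,
      ∀ e ∈ tangentConeAt ℝ (frontier (Hsdqc H)) y, |e.2| ≤ √3 / 4 * |e.1|)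
    {y : ℝ × ℝ} (hy : y ∈ Hsdqc H) : y ∈ hat H ∨ ∃ α β : ℝ, ∃ z₁ ∈ H, ∃ z₂ ∈ H,
      z₁.1 < y.1 ∧ y.1 < z₂.1 ∧ wfun z₁ = α * z₁.1 + β ∧ wfun z₂ = α * z₂.1 + β ∧
      wfun y ≤ α * y.1 + β ∧ (6 * y.1 + α) ^ 2 ≤ 3 * (3 * y.1 ^ 2 + α * y.1 + β) := by
  rw [or_iff_not_imp_left]
  intro hyhat
  obtain ⟨p, q⟩ := y
  have hq : 0 ≤ q := convexHull_hat_nonneg hy.1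
  have hl : ∃ z ∈ H, z.1 < p := by
    by_contra hc
    push Not at hc
    exact hyhat (mem_hat_of_extreme hH hHc hq hy.2 one_ne_zero fun z hz => by
      have := hc z hz; simp only; linarith)
  have hr : ∃ z ∈ H, p < z.1 := by
    by_contra hc
    push Not at hc
    exact hyhat (mem_hat_of_extreme hH hHc hq hy.2 (s := -1) (by norm_num) fun z hz => by
      have := hc z hz; simp only; linarith)
  -- In the coordinates `(p, wfun)` the hyperbolas become straight lines, so the hyperbola comes
  -- from a support line of the image of `H`.
  obtain ⟨α, β, hαβ, z₁, hz₁, z₂, hz₂, hzp₁, hzp₂, hw₁, hw₂⟩ :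
      ∃ α β : ℝ, (∀ z ∈ H, wfun z ≤ α * z.1 + β) ∧ ∃ z₁ ∈ H, ∃ z₂ ∈ H, z₁.1 ≤ p ∧ p ≤ z₂.1 ∧
        wfun z₁ = α * z₁.1 + β ∧ wfun z₂ = α * z₂.1 + β := by
    have hc : Continuous fun z : ℝ × ℝ => (z.1, wfun z) := continuous_fst.prodMk continuous_wfun
    obtain ⟨α, β, h, _, ⟨z₁, hz₁, rfl⟩, _, ⟨z₂, hz₂, rfl⟩, h1, h2, h3, h4⟩ :=
      exists_support_line (hHc.image hc) (x₀ := p)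
        (by obtain ⟨z, hz, h⟩ := hl; exact ⟨_, mem_image_of_mem _ hz, h⟩)
        (by obtain ⟨z, hz, h⟩ := hr; exact ⟨_, mem_image_of_mem _ hz, h⟩)
    exact ⟨α, β, fun z hz => h _ (mem_image_of_mem _ hz), z₁, hz₁, z₂, hz₂, h1, h2, h3, h4⟩
  obtain ⟨s, t, hst, u₁, hu₁, u₂, hu₂, hup₁, hup₂, hl₁, hl₂⟩ := exists_support_line hHc hl hr
  have hwy : wfun (p, q) ≤ α * p + β := wfun_le_of_not_separated hy.2 hαβ
  have hqℓ : q ≤ s * p + t := convexHull_hat_le hst hy.1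
  have hzp₁' : z₁.1 < p := hzp₁.lt_of_ne fun h => hyhat
    (mem_hat_of_wfun_le hH hq hz₁ h (by rw [hw₁, h]; exact hwy))
  have hzp₂' : p < z₂.1 := hzp₂.lt_of_ne fun h => hyhat
    (mem_hat_of_wfun_le hH hq hz₂ h.symm (by rw [hw₂, ← h]; exact hwy))
  have hup₁' : u₁.1 < p := hup₁.lt_of_ne fun h => hyhat
    (hat_of_le (subset_hat hH (by rw [← h]; exact hu₁)) hq (by rw [hl₁, h]; exact hqℓ))
  have hup₂' : p < u₂.1 := hup₂.lt_of_ne fun h => hyhat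
    (hat_of_le (subset_hat hH (by rw [h]; exact hu₂)) hq (by rw [hl₂, ← h]; exact hqℓ))
  refine ⟨α, β, z₁, hz₁, z₂, hz₂, hzp₁', hzp₂', hw₁, hw₂, hwy, ?_⟩
  set R : ℝ → ℝ := fun x => (3 * x ^ 2 + α * x + β) / 4 with hRdef
  set ℓ : ℝ → ℝ := fun x => s * x + t with hℓdef
  have hRc : Continuous R := by fun_prop
  have hℓc : Continuous ℓ := by fun_prop
  -- Connectedness enters here: every pressure between `z₁` and `z₂` occurs in `H^sdqc`, and a point
  -- there satisfies `4 q² ≤ 4 R x`.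
  have hRnn : ∀ x, z₁.1 < x → x < z₂.1 → 0 ≤ R x := by
    intro x h1 h2
    have hsub := (hconn.isPreconnected.image Prod.fst continuous_fst.continuousOn).Icc_subset
      (mem_image_of_mem _ (subset_Hsdqc hH hz₁)) (mem_image_of_mem _ (subset_Hsdqc hH hz₂))
    obtain ⟨⟨x', q'⟩, hm, rfl⟩ := hsub ⟨h1.le, h2.le⟩
    have := wfun_le_of_not_separated hm.2 hαβ
    simp only [wfun, hRdef] at *
    nlinarith [sq_nonneg q']
  have hℓnn : ∀ x, u₁.1 < x → x < u₂.1 → 0 ≤ ℓ x := by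
    intro x h1 h2
    have a1 := hH u₁ hu₁
    have a2 := hH u₂ hu₂
    rw [hl₁] at a1; rw [hl₂] at a2
    simp only [hℓdef]
    nlinarith [mul_nonneg a1 (sub_pos.2 h2).le, mul_nonneg a2 (sub_pos.2 h1).le]
  set T : ℝ → ℝ := fun x => √(R x) with hTdef
  have hTc : Continuous T := hRc.sqrt
  have hTnn : ∀ x, 0 ≤ T x := fun x => Real.sqrt_nonneg _
  have hTsq : ∀ x, z₁.1 < x → x < z₂.1 → T x ^ 2 = R x := fun x h1 h2 => Real.sq_sqrt (hRnn x h1 h2)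
  -- Near `p` the upper boundary of `H^sdqc` is the graph of `c`: the convex hull imposes the bound
  -- `ℓ`, non-separation the bound `T`.
  set c : ℝ → ℝ := fun x => min (ℓ x) (T x) with hcdef
  have hcc : Continuous c := hℓc.min hTc
  have hqc : q ≤ c p := le_min hqℓ (Real.le_sqrt_of_sq_le (by
    simp only [wfun, hRdef] at *; linarith))
  have hchat : (p, c p) ∉ hat H := fun h => hyhat (hat_of_le h hq hqc)
  have hnear : ∀ᶠ x in 𝓝 p, z₁.1 < x ∧ x < z₂.1 ∧ u₁.1 < x ∧ x < u₂.1 := by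
    filter_upwards [lt_mem_nhds hzp₁', gt_mem_nhds hzp₂', lt_mem_nhds hup₁', gt_mem_nhds hup₂']
      with x h1 h2 h3 h4
    exact ⟨h1, h2, h3, h4⟩
  have hfr : ∀ᶠ x in 𝓝 p, (x, c x) ∈ frontier (Hsdqc H) := by
    filter_upwards [hnear] with x ⟨h1, h2, h3, h4⟩
    have hc0 : 0 ≤ c x := le_min (hℓnn x h3 h4) (hTnn x)
    have hcT : c x ≤ T x := min_le_right _ _
    refine mem_frontier_of_top (mem_Hsdqc_of_chords hH hz₁ hz₂ hu₁ hu₂ hw₁ hw₂ hl₁ hl₂ h1 h2 h3 h4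
      hc0 (min_le_left _ _) ?_) fun δ hδ hmem => ?_
    · have := hTsq x h1 h2
      simp only [wfun, hRdef] at *
      nlinarith
    · have a1 := convexHull_hat_le hst hmem.1
      have a2 := wfun_le_of_not_separated hmem.2 hαβ
      have a3 := hTsq x h1 h2
      simp only at a1
      rcases min_choice (ℓ x) (T x) with h | h
      · have : c x = s * x + t := h
        linarith
      · have h' : c x = T x := h
        have := hTnn x
        simp only [wfun, h', hRdef] at a2 a3
        nlinarith
  have hrate : ∀ κ, √3 / 4 < κ → ∀ᶠ x in 𝓝 p, |c x - c p| ≤ κ * |x - p| := by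
    intro κ hκ
    have h1 := eventually_slope_le (htan (p, c p) ⟨hfr.self_of_nhds, hchat⟩) hκ
    have h2 : Tendsto (fun x => (x, c x)) (𝓝 p) (𝓝[frontier (Hsdqc H)] (p, c p)) :=
      tendsto_nhdsWithin_iff.2 ⟨(continuous_id.prodMk hcc).tendsto p, hfr⟩
    exact h2.eventually h1
  have hs3 : 0 < √3 := by positivity
  have hs3sq : √3 ^ 2 = 3 := Real.sq_sqrt (by norm_num)
  -- If the chord were active at `p`, its slope would satisfy `4 s² ≥ 3`. Otherwise `4 (ℓ² - R)` is
  -- a strictly concave quadratic, nonnegative at `z₁` and `z₂` because `H` lies below `ℓ`, hence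
  -- positive at `p`, against `ℓ p ≤ T p`. So steep a chord violates the tangent condition.
  have hTℓ : T p < ℓ p := by
    by_contra hcon
    have hle : ℓ p ≤ T p := not_lt.1 hcon
    have hcp : c p = ℓ p := min_eq_left hle
    have hsteep : 3 ≤ 4 * s ^ 2 := by
      by_contra hlt
      have h0 := quadratic_pos_of_concave (a := 4 * s ^ 2 - 3) (b := 8 * s * t - α)
        (c := 4 * t ^ 2 - β) (by linarith) hzp₁' hzp₂' ?_ ?_
      · have a1 := hTsq p hzp₁' hzp₂'
        have a2 := hℓnn p hup₁' hup₂'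
        have a3 : ℓ p ^ 2 ≤ T p ^ 2 := by gcongr
        rw [a1] at a3
        simp only [hℓdef, hRdef] at a3
        nlinarith
      · have a1 := hst z₁ hz₁
        have a2 := hH z₁ hz₁
        have a3 : z₁.2 ^ 2 ≤ (s * z₁.1 + t) ^ 2 := by gcongr
        simp only [wfun] at hw₁
        nlinarith
      · have a1 := hst z₂ hz₂
        have a2 := hH z₂ hz₂
        have a3 : z₂.2 ^ 2 ≤ (s * z₂.1 + t) ^ 2 := by gcongr
        simp only [wfun] at hw₂
        nlinarith
    -- The threshold is the midpoint between the admissible slope `√3/4` and the forced slope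
    -- `√3/2`.
    have habs : 3 * √3 / 8 < |s| := by
      have : (3 * √3 / 8) ^ 2 < |s| ^ 2 := by rw [sq_abs]; nlinarith
      exact lt_of_pow_lt_pow_left₀ 2 (abs_nonneg s) this
    obtain ⟨ε, hε, hb⟩ := Metric.eventually_nhds_iff.1 (hrate (3 * √3 / 8) (by linarith))
    -- On the downhill side of the chord, `c ≤ ℓ` forces `c` to fall at least as fast as the chord,
    -- whatever `T` does.
    have key : ∀ σ : ℝ, |σ| = 1 → s * σ = |s| → False := by
      intro σ hσ hsσ
      have h1 := hb (y := p - σ * (ε / 2)) (by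
        rw [Real.dist_eq]
        have : p - σ * (ε / 2) - p = -(σ * (ε / 2)) := by ring
        rw [this, abs_neg, abs_mul, hσ, one_mul, abs_of_pos (by positivity)]; linarith)
      have h2 : c (p - σ * (ε / 2)) ≤ ℓ (p - σ * (ε / 2)) := min_le_left _ _
      have h3 : ℓ (p - σ * (ε / 2)) = ℓ p - |s| * (ε / 2) := by
        simp only [hℓdef]; rw [← hsσ]; ring
      have h4 : |p - σ * (ε / 2) - p| = ε / 2 := by
        have : p - σ * (ε / 2) - p = -(σ * (ε / 2)) := by ring
        rw [this, abs_neg, abs_mul, hσ, one_mul, abs_of_pos (by positivity)]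
      rw [h4, hcp] at h1
      have h5 := (neg_le_abs _).trans h1
      have h6 := mul_lt_mul_of_pos_right habs (half_pos hε)
      linarith
    rcases abs_cases s with ⟨h, _⟩ | ⟨h, _⟩
    · exact key 1 (by norm_num) (by rw [h]; ring)
    · exact key (-1) (by norm_num) (by rw [h]; ring)
  have hcT : ∀ᶠ x in 𝓝 p, c x = T x := by
    filter_upwards [hTc.continuousAt.eventually_lt hℓc.continuousAt hTℓ] with x hx
    exact min_eq_right hx.le
  -- The slope bound for `T = √R` is stated as `|R'| ≤ 2 κ T`. Multiplying the difference quotient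
  -- by `T x + T p` avoids any division by `T p`, which may vanish.
  have hκ : ∀ κ, √3 / 4 < κ → |(6 * p + α) / 4| ≤ 2 * κ * T p := by
    intro κ hκ
    have hev : ∀ᶠ x in 𝓝[≠] p, |(6 * p + α) / 4 + 3 / 4 * (x - p)| ≤ κ * (T x + T p) := by
      filter_upwards [(hrate κ hκ).filter_mono nhdsWithin_le_nhds,
        hcT.filter_mono nhdsWithin_le_nhds, hnear.filter_mono nhdsWithin_le_nhds,
        self_mem_nhdsWithin] with x h1 h2 ⟨h3, h4, _, _⟩ hne
      rw [h2, hcT.self_of_nhds] at h1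
      have hpos : 0 < |x - p| := abs_pos.2 (sub_ne_zero.2 hne)
      have e1 : (x - p) * ((6 * p + α) / 4 + 3 / 4 * (x - p)) = (T x - T p) * (T x + T p) := by
        have e2 := hTsq x h3 h4
        have e3 := hTsq p hzp₁' hzp₂'
        have : (T x - T p) * (T x + T p) = T x ^ 2 - T p ^ 2 := by ring
        rw [this, e2, e3]; simp only [hRdef]; ring
      have e4 := congrArg abs e1
      rw [abs_mul, abs_mul, abs_of_nonneg (add_nonneg (hTnn x) (hTnn p))] at e4
      have e5 := mul_le_mul_of_nonneg_right h1 (add_nonneg (hTnn x) (hTnn p))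
      rw [← e4, mul_right_comm, mul_comm |x - p|] at e5
      exact le_of_mul_le_mul_right e5 hpos
    have t1 : Tendsto (fun x => |(6 * p + α) / 4 + 3 / 4 * (x - p)|) (𝓝[≠] p)
        (𝓝 |(6 * p + α) / 4 + 3 / 4 * (p - p)|) :=
      ((by fun_prop : Continuous fun x => |(6 * p + α) / 4 + 3 / 4 * (x - p)|).tendsto p).mono_left
        nhdsWithin_le_nhds
    have t2 : Tendsto (fun x => κ * (T x + T p)) (𝓝[≠] p) (𝓝 (κ * (T p + T p))) :=
      ((by fun_prop : Continuous fun x => κ * (T x + T p)).tendsto p).mono_left nhdsWithin_le_nhds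
    have := le_of_tendsto_of_tendsto t1 t2 hev
    rw [sub_self, mul_zero, add_zero] at this
    linarith
  have hfin : |(6 * p + α) / 4| ≤ 2 * (√3 / 4) * T p := by
    have t1 : Tendsto (fun κ : ℝ => 2 * κ * T p) (𝓝[>] (√3 / 4)) (𝓝 (2 * (√3 / 4) * T p)) :=
      ((by fun_prop : Continuous fun κ : ℝ => 2 * κ * T p).tendsto _).mono_left nhdsWithin_le_nhds
    exact ge_of_tendsto t1 (eventually_mem_nhdsWithin.mono fun κ h => hκ κ h)
  have hsq : ((6 * p + α) / 4) ^ 2 ≤ (2 * (√3 / 4) * T p) ^ 2 := by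
    rw [← sq_abs]; gcongr
  have e : (2 * (√3 / 4) * T p) ^ 2 = 3 / 4 * R p := by
    rw [← hTsq p hzp₁' hzp₂']; nlinarith
  rw [e] at hsq
  simp only [hRdef] at hsq
  simp only
  linarith

end Hyperbola

end

end SymDivQC

namespace SymDivQC

noncomputable section

attribute [local instance] Matrix.frobeniusNormedAddCommGroup Matrix.frobeniusNormedSpace

/-! ### Laminates -/

section TestFields

variable {n : ℕ}

theorem IsTestField.differentiable_entry {φ : (Fin n → ℝ) → Sym n} (hφ : IsTestField φ)
    (i j : Fin n) : Differentiable ℝ fun x => (φ x).mat i j :=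
  (contDiff_entry hφ.smooth i j).differentiable (by simp)

theorem IsTestField.add {φ ψ : (Fin n → ℝ) → Sym n} (hφ : IsTestField φ) (hψ : IsTestField ψ) :
    IsTestField fun x => φ x + ψ x where
  smooth := hφ.smooth.add hψ.smooth
  periodic x i := by rw [hφ.periodic, hψ.periodic]
  div_eq_zero x i := by
    rw [← add_zero (0 : ℝ)]
    nth_rw 1 [← hφ.div_eq_zero x i]
    rw [← hψ.div_eq_zero x i, ← Finset.sum_add_distrib]
    refine Finset.sum_congr rfl fun j _ => ?_
    have h := fderiv_fun_add (hφ.differentiable_entry i j x) (hψ.differentiable_entry i j x)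
    simp only [Sym.mat_add, Matrix.add_apply, h, add_apply]

theorem IsTestField.const_smul {φ : (Fin n → ℝ) → Sym n} (hφ : IsTestField φ) (c : ℝ) :
    IsTestField fun x => c • φ x where
  smooth := hφ.smooth.const_smul c
  periodic x i := by rw [hφ.periodic]
  div_eq_zero x i := by
    rw [← mul_zero c, ← hφ.div_eq_zero x i, Finset.mul_sum]
    refine Finset.sum_congr rfl fun j _ => ?_
    have h := fderiv_fun_const_smul (hφ.differentiable_entry i j x) c
    simp only [smul_eq_mul] at h
    simp only [Sym.mat_smul, Matrix.smul_apply, smul_eq_mul]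
    rw [h]; rfl

end TestFields

/-! ### Periodic functions of one variable -/

section Periodic

theorem periodic_deriv {f : ℝ → ℝ} (hf : Function.Periodic f 1) : Function.Periodic (deriv f) 1 := by
  intro x
  have h : (fun y => f (y + 1)) = f := funext hf
  rw [← deriv_comp_add_const, h]

theorem contDiff_deriv {f : ℝ → ℝ} (hf : ContDiff ℝ ∞ f) : ContDiff ℝ ∞ (deriv f) :=
  (contDiff_infty_iff_deriv.1 hf).2

/-- A smooth periodic function of mean zero has a smooth periodic antiderivative of mean zero. -/
theorem exists_antideriv {h : ℝ → ℝ} (hh : ContDiff ℝ ∞ h) (hp : Function.Periodic h 1)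
    (h0 : ∫ s in (0 : ℝ)..1, h s = 0) : ∃ G : ℝ → ℝ, ContDiff ℝ ∞ G ∧ Function.Periodic G 1 ∧
      ∫ s in (0 : ℝ)..1, G s = 0 ∧ deriv G = h := by
  set P : ℝ → ℝ := fun s => ∫ t in (0 : ℝ)..s, h t with hP
  have hd : ∀ s, HasDerivAt P (h s) s := fun s => hh.continuous.integral_hasStrictDerivAt 0 s |>.hasDerivAt
  have hPc : Continuous P := continuous_iff_continuousAt.2 fun s => (hd s).continuousAt
  set m := ∫ s in (0 : ℝ)..1, P s with hm
  have hd' : ∀ s, HasDerivAt (fun s => P s - m) (h s) s := fun s => (hd s).sub_const m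
  have hder : deriv (fun s => P s - m) = h := funext fun s => (hd' s).deriv
  refine ⟨fun s => P s - m, contDiff_infty_iff_deriv.2 ⟨fun s => (hd' s).differentiableAt, ?_⟩,
    fun s => ?_, ?_, hder⟩
  · rw [hder]; exact hh
  · have e : P (s + 1) = P s + ∫ t in s..s + 1, h t :=
      (intervalIntegral.integral_add_adjacent_intervals (hh.continuous.intervalIntegrable _ _)
        (hh.continuous.intervalIntegrable _ _)).symm
    have e2 := hp.intervalIntegral_add_eq s 0
    rw [zero_add, h0] at e2
    simp only [e, e2, add_zero]
  · rw [intervalIntegral.integral_sub (hPc.intervalIntegrable _ _) (by simp)]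
    simp [hm]

/-- The mean over a period is not changed by an integer scaling and a shift of the argument. -/
theorem integral_comp_int_mul_add {g : ℝ → ℝ} (hg : Continuous g) (hp : Function.Periodic g 1)
    {m : ℤ} (hm : m ≠ 0) (a : ℝ) :
    ∫ τ in (0 : ℝ)..1, g (m * τ + a) = ∫ s in (0 : ℝ)..1, g s := by
  have hm' : (m : ℝ) ≠ 0 := by exact_mod_cast hm
  rw [intervalIntegral.integral_comp_mul_add (fun s => g s) hm' a]
  have h := hp.intervalIntegral_add_zsmul_eq m a (fun t₁ t₂ => hg.intervalIntegrable t₁ t₂)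
  have e : (m : ℝ) * 1 + a = a + m • (1 : ℝ) := by simp; ring
  rw [mul_zero, zero_add, e, h]
  have h2 := hp.intervalIntegral_add_eq a 0
  rw [zero_add] at h2
  simp only [h2, zsmul_eq_mul, smul_eq_mul]
  field_simp

end Periodic

/-! ### Smoothed indicators of an interval, made periodic -/

section Profile

/-- The function `χ` smooths the periodic indicator of `(0, lam)`. The exceptional set is recorded
by the continuous function `b`, at least one on the transition layer, so that its smallness is
expressed by an integral. -/
theorem exists_profile {lam ρ : ℝ} (h0 : 0 ≤ lam) (h1 : lam ≤ 1) (hρ : 0 < ρ) :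
    ∃ χ b : ℝ → ℝ, ContDiff ℝ ∞ χ ∧ Function.Periodic χ 1 ∧ (∀ s, χ s ∈ Icc (0 : ℝ) 1) ∧
      Continuous b ∧ Function.Periodic b 1 ∧ (∀ s, 0 ≤ b s) ∧ ∫ s in (0 : ℝ)..1, b s ≤ ρ ∧
      |(∫ s in (0 : ℝ)..1, χ s) - lam| ≤ ρ ∧
      ∀ s, 1 ≤ b s ∨ χ =ᶠ[𝓝 s] (fun _ => 0) ∨ χ =ᶠ[𝓝 s] fun _ => 1 := by
  -- Each factor changes sign under `s ↦ s + 1`, so the product is periodic; on `(0, 1)` it is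
  -- positive before `lam` and negative after. The profile is a function of `g`, so no gluing is
  -- needed.
  set g : ℝ → ℝ := fun s => Real.sin (Real.pi * s) * Real.sin (Real.pi * (lam - s)) with hg
  have gs : ContDiff ℝ ∞ g := by
    refine ContDiff.mul (Real.contDiff_sin.comp (contDiff_const.mul contDiff_id))
      (Real.contDiff_sin.comp (contDiff_const.mul (contDiff_const.sub contDiff_id)))
  have gc : Continuous g := gs.continuous
  have gp : Function.Periodic g 1 := by
    intro s
    have e1 : Real.pi * (s + 1) = Real.pi * s + Real.pi := by ring
    have e2 : Real.pi * (lam - (s + 1)) = Real.pi * (lam - s) - Real.pi := by ring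
    simp only [hg, e1, e2, Real.sin_add_pi, Real.sin_sub_pi]; ring
  have pi_pos := Real.pi_pos
  have gpos : ∀ s, 0 < s → s < lam → 0 < g s := fun s hs hs' => mul_pos
    (Real.sin_pos_of_pos_of_lt_pi (by positivity) (by nlinarith))
    (Real.sin_pos_of_pos_of_lt_pi (mul_pos pi_pos (by linarith)) (by nlinarith))
  have gneg : ∀ s, lam < s → s < 1 → g s < 0 := fun s hs hs' => mul_neg_of_pos_of_neg
    (Real.sin_pos_of_pos_of_lt_pi (mul_pos pi_pos (by linarith)) (by nlinarith))
    (Real.sin_neg_of_neg_of_neg_pi_lt (mul_neg_of_pos_of_neg pi_pos (by linarith)) (by nlinarith))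
  set b : ℝ → ℝ → ℝ := fun δ s => max 0 (2 - |g s| / δ) with hb
  have bc : ∀ δ, Continuous (b δ) := fun δ => by fun_prop
  have hlim : Tendsto (fun δ => ∫ s in (0 : ℝ)..1, b δ s) (𝓝[>] 0) (𝓝 (∫ _ in (0 : ℝ)..1, (0 : ℝ))) := by
    refine intervalIntegral.tendsto_integral_filter_of_dominated_convergence (fun _ => 2)
      (Eventually.of_forall fun δ => (bc δ).aestronglyMeasurable) ?_ (by simp) ?_
    · filter_upwards [self_mem_nhdsWithin] with δ hδ
      refine Eventually.of_forall fun s _ => ?_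
      rw [Real.norm_of_nonneg (le_max_left _ _)]
      have : 0 ≤ |g s| / δ := div_nonneg (abs_nonneg _) (le_of_lt hδ)
      exact max_le zero_le_two (by linarith)
    · have hae : ∀ᵐ s : ℝ, s ≠ 0 ∧ s ≠ lam ∧ s ≠ 1 := by
        have hn : ∀ c : ℝ, ∀ᵐ s : ℝ, s ≠ c := fun c => by
          simp [ae_iff, measure_singleton]
        filter_upwards [hn 0, hn lam, hn 1] with s a b c using ⟨a, b, c⟩
      filter_upwards [hae] with s ⟨n0, nl, n1⟩ hs
      rw [uIoc_of_le zero_le_one] at hs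
      have hne : 0 < |g s| := by
        rw [abs_pos]
        rcases lt_or_gt_of_ne nl with h | h
        · exact (gpos s hs.1 h).ne'
        · exact (gneg s h (hs.2.lt_of_ne n1)).ne
      refine tendsto_const_nhds.congr' ?_
      filter_upwards [self_mem_nhdsWithin,
        mem_nhdsWithin_of_mem_nhds (Iio_mem_nhds (half_pos hne))] with δ hδ hδ'
      have : 2 ≤ |g s| / δ := by
        rw [le_div_iff₀ hδ]; have : δ < |g s| / 2 := hδ'; linarith
      simp only [hb]
      rw [max_eq_left (by linarith)]
  rw [intervalIntegral.integral_zero] at hlim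
  obtain ⟨δ, hδρ, hδ⟩ := ((hlim.eventually (gt_mem_nhds hρ)).and self_mem_nhdsWithin).exists
  have hδ : 0 < δ := hδ
  set χ : ℝ → ℝ := fun s => Real.smoothTransition (g s / δ) with hχ
  have χs : ContDiff ℝ ∞ χ := Real.smoothTransition.contDiff.comp (gs.div_const δ)
  have χI : ∀ s, χ s ∈ Icc (0 : ℝ) 1 := fun s =>
    ⟨Real.smoothTransition.nonneg _, Real.smoothTransition.le_one _⟩
  have hb0 : ∀ s, 0 ≤ b δ s := fun s => le_max_left _ _
  have hb1 : ∀ s, |g s| ≤ δ → 1 ≤ b δ s := fun s h => by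
    have : |g s| / δ ≤ 1 := by rwa [div_le_one hδ]
    exact le_max_of_le_right (by linarith)
  have χ1 : ∀ s, δ ≤ g s → χ s = 1 := fun s h =>
    Real.smoothTransition.one_of_one_le ((one_le_div hδ).2 h)
  have χ0 : ∀ s, g s ≤ 0 → χ s = 0 := fun s h =>
    Real.smoothTransition.zero_of_nonpos (div_nonpos_of_nonpos_of_nonneg h hδ.le)
  refine ⟨χ, b δ, χs, fun s => by simp only [hχ, gp s], χI, bc δ,
    fun s => by simp only [hb, gp s], hb0, hδρ.le, ?_, fun s => ?_⟩
  · have i1 := fun u v => χs.continuous.intervalIntegrable (μ := volume) u v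
    have i2 := fun u v => (bc δ).intervalIntegrable (μ := volume) u v
    have e1 : (∫ s in (0 : ℝ)..1, χ s) - lam =
        (∫ s in (0 : ℝ)..lam, (χ s - 1)) + ∫ s in lam..1, χ s := by
      rw [intervalIntegral.integral_sub (i1 _ _) (by simp),
        ← intervalIntegral.integral_add_adjacent_intervals (i1 0 lam) (i1 lam 1)]
      simp; ring
    have e2 := intervalIntegral.integral_add_adjacent_intervals (i2 0 lam) (i2 lam 1)
    have e3 : |∫ s in (0 : ℝ)..lam, (χ s - 1)| ≤ ∫ s in (0 : ℝ)..lam, b δ s := by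
      rw [← Real.norm_eq_abs]
      refine intervalIntegral.norm_integral_le_of_norm_le h0 ?_ (i2 _ _)
      have hn : ∀ᵐ s : ℝ, s ≠ lam := by simp [ae_iff, measure_singleton]
      filter_upwards [hn] with s hs hs'
      have hpos := gpos s hs'.1 (hs'.2.lt_of_ne hs)
      rw [Real.norm_eq_abs, abs_sub_comm, abs_of_nonneg (by linarith [(χI s).2])]
      rcases le_total δ (g s) with h | h
      · rw [χ1 s h, sub_self]; exact hb0 s
      · have := hb1 s (by rwa [abs_of_pos hpos])
        linarith [(χI s).1]
    have e4 : |∫ s in lam..1, χ s| ≤ ∫ s in lam..1, b δ s := by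
      rw [← Real.norm_eq_abs]
      refine intervalIntegral.norm_integral_le_of_norm_le h1 ?_ (i2 _ _)
      have hn : ∀ᵐ s : ℝ, s ≠ 1 := by simp [ae_iff, measure_singleton]
      filter_upwards [hn] with s hs hs'
      rw [χ0 s (gneg s hs'.1 (hs'.2.lt_of_ne hs)).le, norm_zero]
      exact hb0 s
    rw [e1]
    have := abs_add_le (∫ s in (0 : ℝ)..lam, (χ s - 1)) (∫ s in lam..1, χ s)
    linarith
  · rcases le_or_gt |g s| δ with h | h
    · exact Or.inl (hb1 s h)
    · right
      rcases lt_abs.1 h with h | h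
      · right
        filter_upwards [gc.continuousAt.eventually (lt_mem_nhds h)] with t ht using χ1 t ht.le
      · left
        have : g s < 0 := by linarith
        filter_upwards [gc.continuousAt.eventually (gt_mem_nhds this)] with t ht using χ0 t ht.le

end Profile

end

end SymDivQC

namespace SymDivQC

noncomputable section

attribute [local instance] Matrix.frobeniusNormedAddCommGroup Matrix.frobeniusNormedSpace

/-! ### Localized divergence-free oscillations from potentials -/

section Layers

/-- The polarization of `v ↦ |v|² Id - v ⊗ v`. -/
def cof (u v : Fin 3 → ℝ) : Sym 3 :=
  symPart fun i j => (if i = j then u ⬝ᵥ v else 0) - (u i * v j + u j * v i) / 2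

theorem cof_mat (u v : Fin 3 → ℝ) (i j : Fin 3) :
    (cof u v).mat i j = (if i = j then u ⬝ᵥ v else 0) - (u i * v j + u j * v i) / 2 :=
  symPart_mat_of_symm (fun i j => by simp only [eq_comm (a := i)]; ring) i j

theorem cof_smul_left (c : ℝ) (u v : Fin 3 → ℝ) : cof (c • u) v = c • cof u v := by
  ext i j
  simp only [Sym.mat_smul, Matrix.smul_apply, cof_mat, smul_dotProduct, Pi.smul_apply, smul_eq_mul]
  split_ifs <;> ring

theorem cof_smul_right (c : ℝ) (u v : Fin 3 → ℝ) : cof u (c • v) = c • cof u v := by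
  ext i j
  simp only [Sym.mat_smul, Matrix.smul_apply, cof_mat, dotProduct_smul, Pi.smul_apply, smul_eq_mul]
  split_ifs <;> ring

theorem continuous_cof_self : Continuous fun v => cof v v :=
  continuous_of_entries fun i j => by
    simp only [cof_mat, dotProduct]
    split_ifs <;> fun_prop

/-- Integer vectors with nonvanishing first component point in almost all directions. -/
theorem exists_int_cof_near (v : Fin 3 → ℝ) {ε : ℝ} (hε : 0 < ε) :
    ∃ (m : Fin 3 → ℤ) (t : ℝ), m 0 ≠ 0 ∧ ‖t • cof (fun i => (m i : ℝ)) (fun i => (m i : ℝ)) - cof v v‖ < ε := by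
  obtain ⟨δ, hδ, h⟩ := Metric.continuousAt_iff.1 (continuous_cof_self.continuousAt (x := v)) ε hε
  obtain ⟨Q, hQ⟩ := exists_nat_gt (1 / δ)
  have hQ0 : (0 : ℝ) < Q := (by positivity : 0 < 1 / δ).trans hQ
  have hm : ∀ r : ℝ, ∃ k : ℤ, k ≠ 0 ∧ |(k : ℝ) - Q * r| ≤ 1 := by
    intro r
    have h1 := Int.floor_le (Q * r)
    have h2 := Int.lt_floor_add_one (Q * r)
    by_cases h0 : ⌊Q * r⌋ = 0
    · refine ⟨1, one_ne_zero, ?_⟩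
      rw [h0] at h1 h2
      rw [abs_le]; push_cast at *; constructor <;> linarith
    · exact ⟨⌊Q * r⌋, h0, by rw [abs_le]; constructor <;> linarith⟩
  choose m hm0 hm1 using fun i => hm (v i)
  refine ⟨m, (Q : ℝ)⁻¹ * (Q : ℝ)⁻¹, hm0 0, ?_⟩
  rw [mul_smul, ← cof_smul_right, ← cof_smul_left, ← dist_eq_norm]
  refine h ?_
  rw [dist_pi_lt_iff hδ]
  intro i
  have e : (Q : ℝ)⁻¹ * (m i : ℝ) - v i = (Q : ℝ)⁻¹ * ((m i : ℝ) - Q * v i) := by field_simp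
  rw [Real.dist_eq, Pi.smul_apply, smul_eq_mul, e, abs_mul, abs_of_pos (inv_pos.2 hQ0)]
  calc (Q : ℝ)⁻¹ * |(m i : ℝ) - Q * v i| ≤ (Q : ℝ)⁻¹ * 1 := by gcongr; exact hm1 i
    _ < δ := by
      rw [mul_one, inv_lt_comm₀ hQ0 hδ]; simpa using hQ

/-- A function of `x₂` and of the phase `ℓ · x`. -/
def wave (f g : ℝ → ℝ) (l : Fin 3 → ℤ) (x : Fin 3 → ℝ) : ℝ :=
  f (x 2) * g ((fun i => (l i : ℝ)) ⬝ᵥ x)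

theorem contDiff_wave {f g : ℝ → ℝ} (hf : ContDiff ℝ ∞ f) (hg : ContDiff ℝ ∞ g) (l : Fin 3 → ℤ) :
    ContDiff ℝ ∞ (wave f g l) := by
  have h : ContDiff ℝ ∞ fun x : Fin 3 → ℝ => (fun i => (l i : ℝ)) ⬝ᵥ x := by
    unfold dotProduct; fun_prop
  exact (hf.comp (contDiff_apply ℝ ℝ 2)).mul (hg.comp h)

theorem continuous_wave {f g : ℝ → ℝ} (hf : Continuous f) (hg : Continuous g) (l : Fin 3 → ℤ) :
    Continuous (wave f g l) := by
  unfold wave dotProduct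
  fun_prop

theorem isPer_wave {f g : ℝ → ℝ} (hf : Function.Periodic f 1) (hg : Function.Periodic g 1)
    (l : Fin 3 → ℤ) : IsPer (wave f g l) := by
  intro x i
  have h1 : f ((x + Pi.single i 1 : Fin 3 → ℝ) 2) = f (x 2) := by
    by_cases h : (2 : Fin 3) = i
    · subst h; simpa using hf (x 2)
    · simp [Pi.single_eq_of_ne h]
  have h2 := hg.int_mul (l i) ((fun i => (l i : ℝ)) ⬝ᵥ x)
  rw [mul_one] at h2
  simp only [wave, h1, dotProduct_add, dotProduct_single, mul_one, h2]

theorem fderiv_wave {f g : ℝ → ℝ} (hf : Differentiable ℝ f) (hg : Differentiable ℝ g)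
    (l : Fin 3 → ℤ) (x : Fin 3 → ℝ) (j : Fin 3) : fderiv ℝ (wave f g l) x (Pi.single j 1) =
      wave (deriv f) g l x * (Pi.single 2 1 : Fin 3 → ℝ) j + wave f (deriv g) l x * l j := by
  have h2 : HasFDerivAt (fun y : Fin 3 → ℝ => y 2) (ContinuousLinearMap.proj (R := ℝ) 2) x :=
    (ContinuousLinearMap.proj (R := ℝ) (φ := fun _ : Fin 3 => ℝ) 2).hasFDerivAt
  have h3 : HasFDerivAt (fun y : Fin 3 → ℝ => (fun i => (l i : ℝ)) ⬝ᵥ y)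
      (∑ i, (l i : ℝ) • ContinuousLinearMap.proj (R := ℝ) (φ := fun _ : Fin 3 => ℝ) i) x := by
    unfold dotProduct
    exact HasFDerivAt.fun_sum fun i _ =>
      ((ContinuousLinearMap.proj (R := ℝ) (φ := fun _ : Fin 3 => ℝ) i).hasFDerivAt).const_mul _
  have h := ((hf _).hasDerivAt.comp_hasFDerivAt x h2).mul ((hg _).hasDerivAt.comp_hasFDerivAt x h3)
  have h' : HasFDerivAt (wave f g l) _ x := h
  rw [h'.fderiv]
  simp only [add_apply, smul_apply, ContinuousLinearMap.proj_apply, smul_eq_mul,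
    Function.comp_apply, wave, Fin.sum_univ_three]
  fin_cases j <;> simp <;> ring

/-- Averaging over the coordinate `x₀` leaves `f (x₂)` fixed while the phase runs through `l 0`
whole periods. This is why `l 0 ≠ 0` is required. -/
theorem integral_wave {f g : ℝ → ℝ} (hf : Continuous f) (hg : Continuous g)
    (hgp : Function.Periodic g 1) {l : Fin 3 → ℤ} (hl : l 0 ≠ 0) :
    ∫ x in cube 3, wave f g l x = (∫ x in cube 3, f (x 2)) * ∫ s in (0 : ℝ)..1, g s := by
  rw [integral_cube_average (continuous_wave hf hg l) 0, ← integral_mul_const]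
  refine integral_congr_ae (Eventually.of_forall fun x => ?_)
  have e : ∀ τ : ℝ, wave f g l (Function.update x 0 τ) =
      f (x 2) * g (l 0 * τ + (l 1 * x 1 + l 2 * x 2)) := by
    intro τ
    simp [wave, dotProduct, Fin.sum_univ_three, add_assoc]
  simp only [e, intervalIntegral.integral_const_mul, integral_comp_int_mul_add hg hgp hl]

theorem integral_comp_coord (f : ℝ → ℝ) (hf : Continuous f) (i : Fin 3) :
    ∫ x in cube 3, f (x i) = ∫ s in (0 : ℝ)..1, f s :=
  integral_cube_eq_of_average (by fun_prop) i fun x => by simp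

/-- The field `Δu Id - D²u` for `u(x) = f(x₂) H(ℓ · x)`. -/
def layer (f H : ℝ → ℝ) (l : Fin 3 → ℤ) (x : Fin 3 → ℝ) : Sym 3 :=
  wave f (deriv (deriv H)) l x • cof (fun i => (l i : ℝ)) (fun i => (l i : ℝ)) +
    wave (deriv f) (deriv H) l x • ((2 : ℝ) • cof (fun i => (l i : ℝ)) (Pi.single 2 1)) +
    wave (deriv (deriv f)) H l x • cof (Pi.single 2 1) (Pi.single 2 1)

/-- The divergence of `Δu Id - D²u` is `∇Δu - ∇Δu = 0` for every potential `u`. The cutoff `f` acts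
on the potential, so oscillations can be confined to a slab without violating the constraint. -/
theorem isTestField_layer {f H : ℝ → ℝ} (hf : ContDiff ℝ ∞ f) (hfp : Function.Periodic f 1)
    (hH : ContDiff ℝ ∞ H) (hHp : Function.Periodic H 1) (l : Fin 3 → ℤ) :
    IsTestField (layer f H l) where
  smooth := (((contDiff_wave hf (contDiff_deriv (contDiff_deriv hH)) l).smul contDiff_const).add
    ((contDiff_wave (contDiff_deriv hf) (contDiff_deriv hH) l).smul contDiff_const)).add
    ((contDiff_wave (contDiff_deriv (contDiff_deriv hf)) hH l).smul contDiff_const)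
  periodic x i := by
    simp only [layer, isPer_wave hfp (periodic_deriv (periodic_deriv hHp)) l x i,
      isPer_wave (periodic_deriv hfp) (periodic_deriv hHp) l x i,
      isPer_wave (periodic_deriv (periodic_deriv hfp)) hHp l x i]
  div_eq_zero x i := by
    have df := fun {g : ℝ → ℝ} (hg : ContDiff ℝ ∞ g) => hg.differentiable (by simp)
    have hf' := contDiff_deriv hf
    have hf'' := contDiff_deriv hf'
    have hH' := contDiff_deriv hH
    have hH'' := contDiff_deriv hH'
    have dw := fun {f g : ℝ → ℝ} (hf : ContDiff ℝ ∞ f) (hg : ContDiff ℝ ∞ g) =>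
      (((contDiff_wave hf hg l).differentiable (by simp)) x).hasFDerivAt
    have key : ∀ j, fderiv ℝ (fun y => (layer f H l y).mat i j) x (Pi.single j 1) =
        (wave (deriv f) (deriv (deriv H)) l x * (Pi.single 2 1 : Fin 3 → ℝ) j +
          wave f (deriv (deriv (deriv H))) l x * l j) *
            (cof (fun i => (l i : ℝ)) (fun i => (l i : ℝ))).mat i j +
        (wave (deriv (deriv f)) (deriv H) l x * (Pi.single 2 1 : Fin 3 → ℝ) j +
          wave (deriv f) (deriv (deriv H)) l x * l j) *
            (2 * (cof (fun i => (l i : ℝ)) (Pi.single 2 1)).mat i j) +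
        (wave (deriv (deriv (deriv f))) H l x * (Pi.single 2 1 : Fin 3 → ℝ) j +
          wave (deriv (deriv f)) (deriv H) l x * l j) *
            (cof (Pi.single 2 1) (Pi.single 2 1)).mat i j := by
      intro j
      have h := (((dw hf hH'').mul_const
        ((cof (fun i => (l i : ℝ)) (fun i => (l i : ℝ))).mat i j)).add
        ((dw hf' hH').mul_const (2 * (cof (fun i => (l i : ℝ)) (Pi.single 2 1)).mat i j))).add
        ((dw hf'' hH).mul_const ((cof (Pi.single 2 1) (Pi.single 2 1)).mat i j))
      have h' : HasFDerivAt (fun y => (layer f H l y).mat i j) _ x := h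
      rw [h'.fderiv]
      simp only [add_apply, smul_apply, smul_eq_mul, fderiv_wave (df hf) (df hH''),
        fderiv_wave (df hf') (df hH'), fderiv_wave (df hf'') (df hH)]
      ring
    simp only [key, Fin.sum_univ_three, cof_mat, dotProduct]
    fin_cases i <;> simp <;> ring

theorem integral_layer {f H : ℝ → ℝ} (hf : ContDiff ℝ ∞ f) (hH : ContDiff ℝ ∞ H)
    (hHp : Function.Periodic H 1) (h0 : ∫ s in (0 : ℝ)..1, H s = 0)
    (h2 : ∫ s in (0 : ℝ)..1, deriv (deriv H) s = 0) {l : Fin 3 → ℤ} (hl : l 0 ≠ 0) :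
    ∫ x in cube 3, layer f H l x = 0 := by
  have hf' := contDiff_deriv hf
  have hf'' := contDiff_deriv hf'
  have hH' := contDiff_deriv hH
  have hH'' := contDiff_deriv hH'
  have h1 : ∫ s in (0 : ℝ)..1, deriv H s = 0 := by
    rw [intervalIntegral.integral_deriv_eq_sub (fun s _ => hH.differentiable (by simp) s)
      (hH'.continuous.intervalIntegrable _ _)]
    have := hHp 0
    rw [zero_add] at this
    rw [this, sub_self]
  have c1 := continuous_wave hf.continuous hH''.continuous l
  have c2 := continuous_wave hf'.continuous hH'.continuous l
  have c3 := continuous_wave hf''.continuous hH.continuous l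
  unfold layer
  rw [integral_add (integrableOn_cube (by fun_prop)) (integrableOn_cube (by fun_prop)),
    integral_add (integrableOn_cube (by fun_prop)) (integrableOn_cube (by fun_prop)),
    integral_smul_const, integral_smul_const, integral_smul_const,
    integral_wave hf.continuous hH''.continuous (periodic_deriv (periodic_deriv hHp)) hl,
    integral_wave hf'.continuous hH'.continuous (periodic_deriv hHp) hl,
    integral_wave hf''.continuous hH.continuous hHp hl, h0, h1, h2]
  simp

end Layers

end

end SymDivQC

namespace SymDivQC

noncomputable section

attribute [local instance] Matrix.frobeniusNormedAddCommGroup Matrix.frobeniusNormedSpace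

/-! ### Realization of second order laminates by smooth fields -/

section Laminates

theorem exists_bound_of_periodic {f : ℝ → ℝ} (hf : Continuous f) (hp : Function.Periodic f 1) :
    ∃ M, 0 ≤ M ∧ ∀ s, |f s| ≤ M := by
  obtain ⟨M, hM⟩ := (hp.isBounded_of_continuous one_ne_zero hf).exists_norm_le
  exact ⟨M, (abs_nonneg _).trans (hM _ (mem_range_self 0)), fun s => hM _ (mem_range_self s)⟩

/-- The layers of direction `N m` are oscillations between multiples of `cof m m`, up to `O(1/N)`. -/
theorem exists_layer_approx {f h : ℝ → ℝ} (hf : ContDiff ℝ ∞ f) (hfp : Function.Periodic f 1)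
    (hh : ContDiff ℝ ∞ h) (hp : Function.Periodic h 1) (h0 : ∫ s in (0 : ℝ)..1, h s = 0)
    {m : Fin 3 → ℤ} (hm : m 0 ≠ 0) (c : ℝ) :
    ∃ (ψ : (Fin 3 → ℝ) → Sym 3) (l : Fin 3 → ℤ), l 0 ≠ 0 ∧ IsTestField ψ ∧
      ∫ x in cube 3, ψ x = 0 ∧
      (∀ x, ‖ψ x - wave f h l x • c • cof (fun i => (m i : ℝ)) (fun i => (m i : ℝ))‖ ≤ 1) ∧
      ∀ x, deriv f (x 2) = 0 → deriv (deriv f) (x 2) = 0 →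
        ψ x = wave f h l x • c • cof (fun i => (m i : ℝ)) (fun i => (m i : ℝ)) := by
  -- The profile `h` is the second derivative of `H`, so that `f h` multiplies the leading matrix in
  -- the layer with potential `f(x₂) H(ℓ · x)`.
  obtain ⟨G, hG, hGp, hG0, rfl⟩ := exists_antideriv hh hp h0
  obtain ⟨H, hH, hHp, hH0, rfl⟩ := exists_antideriv hG hGp hG0
  have hf' := contDiff_deriv hf
  have hfp' := periodic_deriv hfp
  obtain ⟨D₁, hD₁, hD₁'⟩ := exists_bound_of_periodic hf'.continuous hfp'
  obtain ⟨D₂, hD₂, hD₂'⟩ := exists_bound_of_periodic (contDiff_deriv hf').continuous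
    (periodic_deriv hfp')
  obtain ⟨L₁, hL₁, hL₁'⟩ := exists_bound_of_periodic hG.continuous hGp
  obtain ⟨L₂, hL₂, hL₂'⟩ := exists_bound_of_periodic hH.continuous hHp
  set mr : Fin 3 → ℝ := fun i => (m i : ℝ) with hmr
  set k : Fin 3 → ℝ := Pi.single 2 1 with hk
  set C₁ : Sym 3 := (c * 2) • cof mr k with hC₁
  set C₂ : Sym 3 := c • cof k k with hC₂
  -- With `l = N m` the leading matrix scales like `N²`. After division by `N²` the terms containing
  -- derivatives of `f` carry factors `1/N` and `1/N²`, and this `N` makes their sum at most one.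
  obtain ⟨N, hN⟩ := exists_nat_gt (D₁ * L₁ * ‖C₁‖ + D₂ * L₂ * ‖C₂‖ + 1)
  have hE : 0 ≤ D₁ * L₁ * ‖C₁‖ := by positivity
  have hE' : 0 ≤ D₂ * L₂ * ‖C₂‖ := by positivity
  have hN0 : (0 : ℝ) < N := by linarith
  have hN1 : (1 : ℝ) ≤ N := by linarith
  set l : Fin 3 → ℤ := fun i => N * m i with hl
  have hlr : (fun i => (l i : ℝ)) = (N : ℝ) • mr := by
    ext i; simp [hl, hmr]
  have hform : ∀ x, (c * ((N : ℝ)⁻¹ * (N : ℝ)⁻¹)) • layer f H l x =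
      wave f (deriv (deriv H)) l x • c • cof mr mr +
        ((N : ℝ)⁻¹ * wave (deriv f) (deriv H) l x) • C₁ +
        ((N : ℝ)⁻¹ * (N : ℝ)⁻¹ * wave (deriv (deriv f)) H l x) • C₂ := by
    intro x
    simp only [layer, hlr, cof_smul_left, cof_smul_right, smul_add, smul_smul, hC₁, hC₂, ← hk]
    match_scalars <;> field_simp
  clear_value C₁ C₂
  have hl0 : l 0 ≠ 0 := by
    have : N ≠ 0 := by rintro rfl; simp at hN0
    simp [hl, hm, this]
  refine ⟨fun x => (c * ((N : ℝ)⁻¹ * (N : ℝ)⁻¹)) • layer f H l x, l, hl0,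
    (isTestField_layer hf hfp hH hHp l).const_smul _, ?_, fun x => ?_, fun x h1 h2 => ?_⟩
  · rw [integral_smul, integral_layer hf hH hHp hH0 h0 hl0, smul_zero]
  · have w1 : |wave (deriv f) (deriv H) l x| ≤ D₁ * L₁ := by
      rw [wave, abs_mul]; exact mul_le_mul (hD₁' _) (hL₁' _) (abs_nonneg _) hD₁
    have w2 : |wave (deriv (deriv f)) H l x| ≤ D₂ * L₂ := by
      rw [wave, abs_mul]; exact mul_le_mul (hD₂' _) (hL₂' _) (abs_nonneg _) hD₂
    beta_reduce
    rw [hform, add_assoc, add_sub_cancel_left]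
    refine (norm_add_le _ _).trans ?_
    have hNi : (N : ℝ)⁻¹ ≤ 1 := inv_le_one_of_one_le₀ hN1
    have hNp : 0 < (N : ℝ)⁻¹ := inv_pos.2 hN0
    rw [norm_smul, norm_smul, Real.norm_eq_abs, Real.norm_eq_abs, abs_mul, abs_mul, abs_mul,
      abs_of_pos hNp]
    calc (N : ℝ)⁻¹ * |wave (deriv f) (deriv H) l x| * ‖C₁‖ +
          (N : ℝ)⁻¹ * (N : ℝ)⁻¹ * |wave (deriv (deriv f)) H l x| * ‖C₂‖
        ≤ (N : ℝ)⁻¹ * (D₁ * L₁) * ‖C₁‖ + (N : ℝ)⁻¹ * 1 * (D₂ * L₂) * ‖C₂‖ := by gcongr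
      _ = (N : ℝ)⁻¹ * (D₁ * L₁ * ‖C₁‖ + D₂ * L₂ * ‖C₂‖) := by ring
      _ ≤ (N : ℝ)⁻¹ * N := by gcongr; linarith
      _ = 1 := inv_mul_cancel₀ hN0.ne'
  · beta_reduce; rw [hform]; simp [wave, h1, h2]

/-- Where the cutoff `f` is locally one, the field oscillates between values close to `(1 - lam) X`
and `-lam X`, with `X = a • cof n n`, except on the set where `β ≥ 1`. Where `f` is locally zero the
field vanishes. In the transition region only the uniform bound matters. -/
theorem exists_layer {f : ℝ → ℝ} (hf : ContDiff ℝ ∞ f) (hfp : Function.Periodic f 1)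
    (hfI : ∀ s, f s ∈ Icc (0 : ℝ) 1) (n : Fin 3 → ℝ) (a : ℝ) {lam ρ : ℝ} (h0 : 0 ≤ lam)
    (h1 : lam ≤ 1) (hρ : 0 < ρ) : ∃ (ψ : (Fin 3 → ℝ) → Sym 3) (β : (Fin 3 → ℝ) → ℝ),
      IsTestField ψ ∧ ∫ x in cube 3, ψ x = 0 ∧ (∀ x, ‖ψ x‖ ≤ ‖a • cof n n‖ + 2) ∧
      Continuous β ∧ (∀ x, 0 ≤ β x) ∧ ∫ x in cube 3, β x ≤ ρ ∧
      (∀ x, f =ᶠ[𝓝 (x 2)] (fun _ => 0) → ψ x = 0) ∧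
      ∀ x, f =ᶠ[𝓝 (x 2)] (fun _ => 1) → 1 ≤ β x ∨
        ‖ψ x - (1 - lam) • a • cof n n‖ ≤ ρ ∨ ‖ψ x + lam • a • cof n n‖ ≤ ρ := by
  set X : Sym 3 := a • cof n n with hX
  obtain ⟨ρ₁, hρ₁, hρ₁1, hρ₁ρ⟩ : ∃ ρ₁, 0 < ρ₁ ∧ ρ₁ ≤ 1 ∧ ρ₁ * (1 + ‖X‖) ≤ ρ := by
    have hp : 0 < 1 + ‖X‖ := by positivity
    refine ⟨min 1 (ρ / (1 + ‖X‖)), lt_min one_pos (by positivity), min_le_left _ _, ?_⟩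
    rw [← le_div_iff₀ hp]; exact min_le_right _ _
  obtain ⟨χ, b, hχ, hχp, hχI, hb, hbp, hb0, hbi, hχi, hχb⟩ := exists_profile h0 h1 hρ₁
  set μ := ∫ s in (0 : ℝ)..1, χ s with hμ
  have iχ : IntervalIntegrable χ volume 0 1 := hχ.continuous.intervalIntegrable _ _
  have hμ0 : 0 ≤ μ := intervalIntegral.integral_nonneg zero_le_one fun s _ => (hχI s).1
  have hμ1 : μ ≤ 1 := by
    have := intervalIntegral.integral_mono (μ := volume) zero_le_one iχ
      (by simp : IntervalIntegrable (fun _ => (1 : ℝ)) volume 0 1) fun s => (hχI s).2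
    simpa using this
  -- Periodicity needs an integer wave vector, so `cof n n` is replaced by a nearby multiple of `cof
  -- m m`.
  obtain ⟨m, t, hm, hmt⟩ := exists_int_cof_near n (ε := ρ₁ / (|a| + 1)) (by positivity)
  obtain ⟨ψ, l, hl, hψ, hψi, hψ1, hψ2⟩ := exists_layer_approx hf hfp
    (h := fun s => χ s - μ) (hχ.sub contDiff_const) (fun s => by simp only [hχp s])
    (by rw [intervalIntegral.integral_sub iχ (by simp)]; simp [hμ]) hm (a * t)
  set Y : Sym 3 := (a * t) • cof (fun i => (m i : ℝ)) (fun i => (m i : ℝ)) with hY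
  have hYX : ‖Y - X‖ ≤ ρ₁ := by
    rw [hY, hX, mul_smul, ← smul_sub, norm_smul, Real.norm_eq_abs]
    calc |a| * _ ≤ (|a| + 1) * (ρ₁ / (|a| + 1)) := by gcongr; linarith
      _ = ρ₁ := by field_simp
  have hYn : ‖Y‖ ≤ ‖X‖ + 1 := by
    have := norm_le_norm_add_norm_sub' Y X
    linarith
  have hclose : ∀ v : ℝ, |v| ≤ 1 → ‖v • (Y - X) + (lam - μ) • X‖ ≤ ρ := by
    intro v hv
    refine (norm_add_le _ _).trans (le_trans ?_ hρ₁ρ)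
    rw [norm_smul, norm_smul, Real.norm_eq_abs, Real.norm_eq_abs, abs_sub_comm lam]
    calc |v| * ‖Y - X‖ + |μ - lam| * ‖X‖ ≤ 1 * ρ₁ + ρ₁ * ‖X‖ := by gcongr
      _ = _ := by ring
  refine ⟨ψ, wave (fun _ => 1) b l, hψ, hψi, fun x => ?_,
    continuous_wave continuous_const hb l, fun x => by simpa [wave] using hb0 _, ?_, fun x hx => ?_,
    fun x hx => ?_⟩
  · have hw : |wave f (fun s => χ s - μ) l x| ≤ 1 := by
      rw [wave, abs_mul]
      refine mul_le_one₀ (abs_le.2 ⟨?_, (hfI _).2⟩) (abs_nonneg _) (abs_le.2 ⟨?_, ?_⟩)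
      · linarith [(hfI (x 2)).1]
      · linarith [(hχI ((fun i => (l i : ℝ)) ⬝ᵥ x)).1]
      · linarith [(hχI ((fun i => (l i : ℝ)) ⬝ᵥ x)).2]
    have h2 := norm_le_norm_add_norm_sub' (ψ x) (wave f (fun s => χ s - μ) l x • Y)
    rw [norm_smul, Real.norm_eq_abs] at h2
    have h3 := mul_le_of_le_one_left (norm_nonneg Y) hw
    linarith [hψ1 x]
  · rw [integral_wave continuous_const hb hbp hl, integral_cube_const, one_mul]
    refine hbi.trans (le_trans ?_ hρ₁ρ)
    nlinarith [norm_nonneg X]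
  · have d1 : deriv f =ᶠ[𝓝 (x 2)] fun _ => 0 := by simpa using hx.deriv
    have d2 : deriv (deriv f) =ᶠ[𝓝 (x 2)] fun _ => 0 := by simpa using d1.deriv
    rw [hψ2 x d1.eq_of_nhds d2.eq_of_nhds]
    simp [wave, hx.eq_of_nhds]
  · have d1 : deriv f =ᶠ[𝓝 (x 2)] fun _ => 0 := by simpa using hx.deriv
    have d2 : deriv (deriv f) =ᶠ[𝓝 (x 2)] fun _ => 0 := by simpa using d1.deriv
    rw [hψ2 x d1.eq_of_nhds d2.eq_of_nhds]
    simp only [wave, hx.eq_of_nhds, one_mul]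
    refine (hχb ((fun i => (l i : ℝ)) ⬝ᵥ x)).imp id fun h => h.symm.imp (fun h => ?_) fun h => ?_
    · rw [h.eq_of_nhds]
      convert hclose (1 - μ) (abs_le.2 ⟨by linarith, by linarith⟩) using 2
      module
    · rw [h.eq_of_nhds]
      convert hclose (-μ) (abs_le.2 ⟨by linarith, by linarith⟩) using 2
      module

/-- `ξ` is the mean of bounded test fields which take values close to `K` off small sets. -/
def IsApproximable (K : Set (Sym 3)) (ξ : Sym 3) : Prop :=
  ∃ M : ℝ, ∀ ρ, 0 < ρ → ∃ (φ : (Fin 3 → ℝ) → Sym 3) (β : (Fin 3 → ℝ) → ℝ), IsTestField φ ∧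
    ∫ x in cube 3, φ x = ξ ∧ (∀ x, ‖φ x‖ ≤ M) ∧ Continuous β ∧ (∀ x, 0 ≤ β x) ∧
    ∫ x in cube 3, β x ≤ ρ ∧ ∀ x, Metric.infDist (φ x) K ≤ ρ ∨ 1 ≤ β x

/-- Laminates of second order supported in `K` are approximable. -/
theorem isApproximable_laminate {K : Set (Sym 3)} {A₁ A₂ B₁ B₂ : Sym 3} (hA₁ : A₁ ∈ K)
    (hA₂ : A₂ ∈ K) (hB₁ : B₁ ∈ K) (hB₂ : B₂ ∈ K) {n m : Fin 3 → ℝ} {a b lam lamA lamB : ℝ}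
    (hA : A₁ - A₂ = a • cof n n) (hB : B₁ - B₂ = b • cof m m) (h0 : 0 ≤ lam) (h1 : lam ≤ 1)
    (hA0 : 0 ≤ lamA) (hA1 : lamA ≤ 1) (hB0 : 0 ≤ lamB) (hB1 : lamB ≤ 1) {A B : Sym 3}
    (eA : A = lamA • A₁ + (1 - lamA) • A₂) (eB : B = lamB • B₁ + (1 - lamB) • B₂)
    (hC : ∀ i, (A - B).mat i 2 = 0) : IsApproximable K (lam • A + (1 - lam) • B) := by
  set ξ := lam • A + (1 - lam) • B with hξ
  refine ⟨‖ξ‖ + ‖A - B‖ + (‖a • cof n n‖ + 2) + (‖b • cof m m‖ + 2), fun ρ hρ => ?_⟩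
  obtain ⟨ρ₁, hρ₁, hρ₁ρ⟩ : ∃ ρ₁, 0 < ρ₁ ∧ ρ₁ * (3 + ‖A - B‖) ≤ ρ :=
    ⟨ρ / (3 + ‖A - B‖), by positivity, by field_simp; rfl⟩
  obtain ⟨χ, b₀, hχ, hχp, hχI, hb, hbp, hb0, hbi, hχi, hχb⟩ := exists_profile h0 h1 hρ₁
  obtain ⟨ψA, βA, hψA, hψAi, hψAM, hβA, hβA0, hβAi, hA0', hA1'⟩ :=
    exists_layer hχ hχp hχI n a hA0 hA1 hρ₁
  obtain ⟨ψB, βB, hψB, hψBi, hψBM, hβB, hβB0, hβBi, hB0', hB1'⟩ :=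
    exists_layer (f := fun s => 1 - χ s) (contDiff_const.sub hχ) (fun s => by simp only [hχp s])
      (fun s => ⟨by linarith [(hχI s).2], by linarith [(hχI s).1]⟩) m b hB0 hB1 hρ₁
  set μ := ∫ s in (0 : ℝ)..1, χ s with hμ
  have iχ : IntervalIntegrable χ volume 0 1 := hχ.continuous.intervalIntegrable _ _
  have hμ0 : 0 ≤ μ := intervalIntegral.integral_nonneg zero_le_one fun s _ => (hχI s).1
  have hμ1 : μ ≤ 1 := by
    have := intervalIntegral.integral_mono (μ := volume) zero_le_one iχ
      (by simp : IntervalIntegrable (fun _ => (1 : ℝ)) volume 0 1) fun s => (hχI s).2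
    simpa using this
  have hχ2 : ContDiff ℝ ∞ fun x : Fin 3 → ℝ => χ (x 2) - μ :=
    (hχ.comp (contDiff_apply ℝ ℝ 2)).sub contDiff_const
  -- This field varies only with `x₂`, and the corresponding column of `A - B` vanishes, so its
  -- divergence is zero.
  have hstep : IsTestField fun x : Fin 3 → ℝ => (χ (x 2) - μ) • (A - B) := by
    refine ⟨hχ2.smul contDiff_const, fun x i => ?_, fun x i => ?_⟩
    · have h1 : χ ((x + Pi.single i 1 : Fin 3 → ℝ) 2) = χ (x 2) := by
        by_cases h : (2 : Fin 3) = i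
        · subst h; simpa using hχp (x 2)
        · simp [Pi.single_eq_of_ne h]
      rw [h1]
    · refine Finset.sum_eq_zero fun j _ => ?_
      have d1 : HasFDerivAt (fun x : Fin 3 → ℝ => χ (x 2) - μ)
          (deriv χ (x 2) • ContinuousLinearMap.proj (R := ℝ) (φ := fun _ : Fin 3 => ℝ) 2) x :=
        (((hχ.differentiable (by simp)) _).hasDerivAt.comp_hasFDerivAt x
          (ContinuousLinearMap.proj (R := ℝ) (φ := fun _ : Fin 3 => ℝ) 2).hasFDerivAt).sub_const μ
      have d2 : HasFDerivAt (fun x : Fin 3 → ℝ => ((χ (x 2) - μ) • (A - B)).mat i j) _ x :=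
        d1.mul_const ((A - B).mat i j)
      rw [d2.fderiv]
      simp only [smul_apply, ContinuousLinearMap.proj_apply, smul_eq_mul]
      by_cases hj : j = 2
      · rw [hj, hC i]; ring
      · rw [Pi.single_eq_of_ne (Ne.symm hj)]; ring
  have cstep := hstep.smooth.continuous
  have cA := hψA.smooth.continuous
  have cB := hψB.smooth.continuous
  have cb2 : Continuous fun x : Fin 3 → ℝ => b₀ (x 2) := by fun_prop
  -- The step between values near `A` and `B` in the direction `x₂` is refined by `ψA` in the slabs
  -- where `χ = 1` and by `ψB` where `χ = 0`. The three exceptional sets are covered by the sum of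
  -- the corresponding majorants.
  refine ⟨fun x => ξ + (χ (x 2) - μ) • (A - B) + ψA x + ψB x, fun x => b₀ (x 2) + βA x + βB x,
    (((isTestField_const ξ).add hstep).add hψA).add hψB, ?_, fun x => ?_, by fun_prop,
    fun x => add_nonneg (add_nonneg (hb0 _) (hβA0 x)) (hβB0 x), ?_, fun x => ?_⟩
  · rw [integral_add (integrableOn_cube (by fun_prop)) (integrableOn_cube cB),
      integral_add (integrableOn_cube (by fun_prop)) (integrableOn_cube cA),
      integral_add (integrableOn_cube continuous_const) (integrableOn_cube cstep), hψAi, hψBi,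
      integral_cube_const, integral_smul_const,
      integral_comp_coord (fun s => χ s - μ) (by have := hχ.continuous; fun_prop) 2,
      intervalIntegral.integral_sub iχ (by simp)]
    simp [hμ]
  · refine (norm_add_le _ _).trans (add_le_add ((norm_add_le _ _).trans
      (add_le_add ((norm_add_le _ _).trans (add_le_add le_rfl ?_)) (hψAM x))) (hψBM x))
    rw [norm_smul, Real.norm_eq_abs]
    refine mul_le_of_le_one_left (norm_nonneg _) (abs_le.2 ⟨?_, ?_⟩)
    · linarith [(hχI (x 2)).1]
    · linarith [(hχI (x 2)).2]
  · rw [integral_add (integrableOn_cube (by fun_prop)) (integrableOn_cube hβB),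
      integral_add (integrableOn_cube cb2) (integrableOn_cube hβA), integral_comp_coord b₀ hb 2]
    nlinarith [norm_nonneg (A - B)]
  · have hclose : ∀ κ y z : Sym 3, κ ∈ K → ‖y‖ ≤ ρ₁ → z = κ + ((lam - μ) • (A - B) + y) →
        Metric.infDist z K ≤ ρ := by
      rintro κ y z hκ hy rfl
      refine (Metric.infDist_le_dist_of_mem hκ).trans (le_trans ?_ hρ₁ρ)
      rw [dist_eq_norm, add_sub_cancel_left]
      refine (norm_add_le _ _).trans ?_
      rw [norm_smul, Real.norm_eq_abs, abs_sub_comm]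
      nlinarith [mul_le_mul_of_nonneg_right hχi (norm_nonneg (A - B))]
    have hn1 := hb0 (x 2)
    have hn2 := hβA0 x
    have hn3 := hβB0 x
    rcases hχb (x 2) with h | h | h
    · right; linarith
    · have h' : (fun s => 1 - χ s) =ᶠ[𝓝 (x 2)] fun _ => 1 := by
        filter_upwards [h] with s hs; rw [hs, sub_zero]
      rcases hB1' x h' with h3 | h3 | h3
      · right; linarith
      · left
        refine hclose B₁ _ _ hB₁ h3 ?_
        beta_reduce
        rw [hA0' x h, h.eq_of_nhds, ← hB, hξ, eB]
        module
      · left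
        refine hclose B₂ _ _ hB₂ h3 ?_
        beta_reduce
        rw [hA0' x h, h.eq_of_nhds, ← hB, hξ, eB]
        module
    · have h' : (fun s => 1 - χ s) =ᶠ[𝓝 (x 2)] fun _ => 0 := by
        filter_upwards [h] with s hs; rw [hs, sub_self]
      rcases hA1' x h with h3 | h3 | h3
      · right; linarith
      · left
        refine hclose A₁ _ _ hA₁ h3 ?_
        beta_reduce
        rw [hB0' x h', h.eq_of_nhds, ← hA, hξ, eA]
        module
      · left
        refine hclose A₂ _ _ hA₂ h3 ?_
        beta_reduce
        rw [hB0' x h', h.eq_of_nhds, ← hA, hξ, eA]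
        module

end Laminates

end

end SymDivQC

namespace SymDivQC

noncomputable section

attribute [local instance] Matrix.frobeniusNormedAddCommGroup Matrix.frobeniusNormedSpace

/-! ### Approximable matrices belong to all hulls -/

section Approximable

variable {K : Set (Sym 3)} {ξ : Sym 3}

theorem IsApproximable.exists_infDist_le (hKn : K.Nonempty) (h : IsApproximable K ξ) :
    ∃ M : ℝ, 1 ≤ M ∧ ∀ ρ, 0 < ρ → ∃ (φ : (Fin 3 → ℝ) → Sym 3) (β : (Fin 3 → ℝ) → ℝ),
      IsTestField φ ∧ ∫ x in cube 3, φ x = ξ ∧ (∀ x, ‖φ x‖ ≤ M) ∧ Continuous β ∧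
      (∀ x, 0 ≤ β x) ∧ ∫ x in cube 3, β x ≤ ρ ∧
      ∀ x, Metric.infDist (φ x) K ≤ M ∧ (Metric.infDist (φ x) K ≤ ρ ∨ 1 ≤ β x) := by
  obtain ⟨κ, hκ⟩ := hKn
  obtain ⟨M, hM⟩ := h
  refine ⟨max 1 (M + ‖κ‖), le_max_left _ _, fun ρ hρ => ?_⟩
  obtain ⟨φ, β, h1, h2, h3, h4, h5, h6, h7⟩ := hM ρ hρ
  refine ⟨φ, β, h1, h2, fun x => (h3 x).trans (le_max_of_le_right (by linarith [norm_nonneg κ])),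
    h4, h5, h6, fun x => ⟨le_max_of_le_right ?_, h7 x⟩⟩
  refine (Metric.infDist_le_dist_of_mem hκ).trans ?_
  rw [dist_eq_norm]
  exact (norm_sub_le _ _).trans (add_le_add_left (h3 x) _)

/-- The distance is at most `ρ ≤ 1` off the exceptional set and at most `M` everywhere, so `dist^p ≤
ρ + M^p β`. -/
theorem IsApproximable.mem_hull (hKn : K.Nonempty) (h : IsApproximable K ξ) {p : ℝ} (hp : 1 < p) :
    ξ ∈ hull p K := by
  obtain ⟨M, hM1, hM⟩ := h.exists_infDist_le hKn
  refine mem_hull_of_forall fun ε hε => ?_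
  have hMp : 0 < 1 + M ^ p := by positivity
  obtain ⟨φ, β, h1, h2, -, h4, h5, h6, h7⟩ := hM (min 1 (ε / (1 + M ^ p)))
    (lt_min one_pos (by positivity))
  set ρ := min 1 (ε / (1 + M ^ p)) with hρ
  have hρ0 : 0 < ρ := lt_min one_pos (by positivity)
  have hρ1 : ρ ≤ 1 := min_le_left _ _
  have hρε : ρ * (1 + M ^ p) ≤ ε := by
    rw [← le_div_iff₀ hMp]; exact min_le_right _ _
  refine ⟨φ, h1, h2, ?_⟩
  have c1 : Continuous fun x => Metric.infDist (φ x) K ^ p :=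
    (continuous_infDist.comp h1.smooth.continuous).rpow_const fun _ => Or.inr (by linarith)
  have hle : ∀ x, Metric.infDist (φ x) K ^ p ≤ ρ + M ^ p * β x := by
    intro x
    have h0 := Metric.infDist_nonneg (x := φ x) (s := K)
    have hp0 : 0 ≤ M ^ p := by positivity
    rcases (h7 x).2 with h | h
    · have e1 : Metric.infDist (φ x) K ^ p ≤ ρ ^ p := by gcongr
      have e2 : ρ ^ p ≤ ρ := by
        simpa using Real.rpow_le_rpow_of_exponent_ge hρ0 hρ1 hp.le
      have := mul_nonneg hp0 (h5 x)
      linarith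
    · have e1 : Metric.infDist (φ x) K ^ p ≤ M ^ p := by gcongr; exact (h7 x).1
      have := mul_le_mul_of_nonneg_left h hp0
      linarith
  refine (integral_cube_mono c1 (by fun_prop) hle).trans ?_
  rw [integral_add (integrableOn_cube continuous_const) (integrableOn_cube (by fun_prop)),
    integral_cube_const, integral_const_mul]
  have := mul_le_mul_of_nonneg_left h6 (by positivity : 0 ≤ M ^ p)
  linarith

/-- The bound `M` is independent of `ρ`, so no growth condition on `g` is needed: uniform continuity
on a fixed ball controls `g` by the distance from `K`. -/
theorem IsApproximable.mem_hullInfty (hK : IsCompact K) (hKn : K.Nonempty)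
    (h : IsApproximable K ξ) : ξ ∈ hullInfty K := by
  obtain ⟨M, hM1, hM⟩ := h.exists_infDist_le hKn
  intro g hg _ hgq
  refine le_of_forall_pos_le_add fun δ hδ => ?_
  obtain ⟨C, hC, hgC⟩ := exists_le_add_infDist hK hKn (h := fun σ => g σ - sSup (g '' K))
    (hg.sub continuous_const)
    (fun κ hκ => sub_nonpos.2 (le_csSup (hK.image hg).bddAbove (mem_image_of_mem g hκ))) M
    (half_pos hδ)
  obtain ⟨φ, β, h1, h2, h3, h4, h5, h6, h7⟩ := hM (δ / 2 / ((C + 1) * (1 + M))) (by positivity)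
  set ρ := δ / 2 / ((C + 1) * (1 + M)) with hρ
  have hρ0 : 0 < ρ := by positivity
  have hρδ : C * (ρ * (1 + M)) ≤ δ / 2 := by
    calc C * (ρ * (1 + M)) ≤ (C + 1) * (ρ * (1 + M)) := by gcongr; linarith
      _ = δ / 2 := by rw [hρ]; field_simp
  have hle : ∀ x, g (φ x) ≤ (sSup (g '' K) + δ / 2 + C * ρ) + C * M * β x := by
    intro x
    have e1 := hgC _ (h3 x)
    have e2 : Metric.infDist (φ x) K ≤ ρ + M * β x := by
      have := mul_nonneg (zero_le_one.trans hM1) (h5 x)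
      rcases (h7 x).2 with h | h
      · linarith
      · have := mul_le_mul_of_nonneg_left h (zero_le_one.trans hM1)
        linarith [(h7 x).1]
    have e3 := mul_le_mul_of_nonneg_left e2 hC
    linarith
  rw [← h2]
  refine (hgq.le_integral φ h1).trans ((integral_cube_mono (hg.comp h1.smooth.continuous)
    (by fun_prop) hle).trans ?_)
  rw [integral_add (integrableOn_cube continuous_const) (integrableOn_cube (by fun_prop)),
    integral_cube_const, integral_const_mul]
  have := mul_le_mul_of_nonneg_left h6 (by positivity : 0 ≤ C * M)
  linarith

end Approximable

/-! ### Splitting along the shear and along rank-two directions -/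

section Directions

theorem Phi_eq_of_tartar {σ : Sym 3} {z : ℝ × ℝ} (hz : 0 ≤ z.2) (hp : pressure σ = z.1)
    (ht : tartar σ = wfun z) : Phi σ = z := by
  rw [tartar_eq, wfun, hp] at ht
  have : shear σ = z.2 := by
    rw [← sq_eq_sq₀ (shear_nonneg σ) hz]; linarith
  exact Prod.ext hp this

theorem wfun_Phi (σ : Sym 3) : wfun (Phi σ) = tartar σ := (tartar_eq σ).symm

/-- The shear `e₀ ⊗ e₁ + e₁ ⊗ e₀`. -/
def shearDir : Sym 3 := symPart fun i j => if i = 0 ∧ j = 1 then 2 else 0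

theorem tartar_add_shearDir (σ : Sym 3) (s : ℝ) :
    tartar (σ + s • shearDir) = tartar σ + 8 * s * σ.mat 0 1 + 4 * s ^ 2 := by
  have h := σ.mat_symm 1 0
  simp only [tartar, norm_sq_three, tr_apply, shearDir, Sym.mat_add, Sym.mat_smul, Matrix.add_apply,
    Matrix.smul_apply, symPart_mat, smul_eq_mul]
  simp
  ring

theorem pressure_add_shearDir (σ : Sym 3) (s : ℝ) :
    pressure (σ + s • shearDir) = pressure σ := by
  simp [pressure_eq, tr_apply, shearDir, symPart_mat]

/-- Along the shear Tartar's form is a convex quadratic that tends to infinity both ways, so it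
reaches the level `w ≥ tartar σ` on either side of `σ`. The shear is trace-free and its last column
vanishes, so the pressure is kept and the two matrices are compatible across planes `x₂ = const`. -/
theorem exists_shear_split {σ : Sym 3} {w : ℝ} (hw : tartar σ ≤ w) :
    ∃ (A B : Sym 3) (lam : ℝ), 0 ≤ lam ∧ lam ≤ 1 ∧ σ = lam • A + (1 - lam) • B ∧
      pressure A = pressure σ ∧ pressure B = pressure σ ∧ tartar A = w ∧ tartar B = w ∧
      ∀ i, (A - B).mat i 2 = 0 := by
  set c := σ.mat 0 1 with hc
  set r := √(c ^ 2 + (w - tartar σ) / 4) with hr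
  have hr2 : r ^ 2 = c ^ 2 + (w - tartar σ) / 4 := Real.sq_sqrt (by
    have := sq_nonneg c; linarith)
  have hr0 : 0 ≤ r := Real.sqrt_nonneg _
  have hcr : |c| ≤ r := Real.abs_le_sqrt (by linarith)
  obtain ⟨hc1, hc2⟩ := abs_le.1 hcr
  obtain ⟨lam, h0, h1, hl⟩ : ∃ lam : ℝ, 0 ≤ lam ∧ lam ≤ 1 ∧
      lam * (-c + r) + (1 - lam) * (-c - r) = 0 := by
    clear_value r
    rcases hr0.eq_or_lt with h | h
    · exact ⟨0, le_rfl, zero_le_one, by rw [← h] at hc1 hc2 ⊢; linarith⟩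
    · exact ⟨(c + r) / (2 * r), div_nonneg (by linarith) (by linarith),
        (div_le_one (by linarith)).2 (by linarith), by field_simp; ring⟩
  refine ⟨σ + (-c + r) • shearDir, σ + (-c - r) • shearDir, lam, h0, h1, ?_,
    pressure_add_shearDir _ _, pressure_add_shearDir _ _, ?_, ?_, fun i => ?_⟩
  · have : lam • (σ + (-c + r) • shearDir) + (1 - lam) • (σ + (-c - r) • shearDir) =
        σ + (lam * (-c + r) + (1 - lam) * (-c - r)) • shearDir := by module
    rw [this, hl, zero_smul, add_zero]
  · rw [tartar_add_shearDir, ← hc]; linarith [hr2]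
  · rw [tartar_add_shearDir, ← hc]; linarith [hr2]
  · have : σ + (-c + r) • shearDir - (σ + (-c - r) • shearDir) = (2 * r) • shearDir := by module
    rw [this]
    simp [shearDir, symPart_mat]

/-- A symmetric `3 × 3` matrix with `(tr M)² ≤ |M|²` has an isotropic vector. -/
theorem exists_isotropic {M : Sym 3} (h : tr M ^ 2 ≤ ‖M‖ ^ 2) :
    ∃ n : Fin 3 → ℝ, n ≠ 0 ∧ n ⬝ᵥ M.mat.mulVec n = 0 := by
  -- A nonpositive principal minor yields an isotropic vector in the coordinate plane, by solving
  -- the quadratic equation there.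
  have key : ∀ i j : Fin 3, i ≠ j → M.mat i i * M.mat j j ≤ M.mat i j ^ 2 →
      ∃ n : Fin 3 → ℝ, n ≠ 0 ∧ n ⬝ᵥ M.mat.mulVec n = 0 := by
    intro i j hij hm
    by_cases ha : M.mat i i = 0
    · exact ⟨Pi.single i 1, by simp, by simp [ha]⟩
    · set r := √(M.mat i j ^ 2 - M.mat i i * M.mat j j) with hr
      have hr2 : r ^ 2 = M.mat i j ^ 2 - M.mat i i * M.mat j j := Real.sq_sqrt (by linarith)
      refine ⟨Pi.single i (-M.mat i j + r) + Pi.single j (M.mat i i), fun h0 => ha ?_, ?_⟩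
      · have := congrFun h0 j
        simpa [Pi.single_eq_of_ne hij.symm] using this
      · have hs := M.mat_symm j i
        simp [Matrix.mulVec_add, add_dotProduct, Matrix.mulVec_single, hs]
        linear_combination (M.mat i i) * hr2
  by_contra hcon
  -- If all three minors are positive, expanding the square of the trace gives `(tr M)² > |M|²`.
  have k01 := not_le.1 fun hm => hcon (key 0 1 (by decide) hm)
  have k02 := not_le.1 fun hm => hcon (key 0 2 (by decide) hm)
  have k12 := not_le.1 fun hm => hcon (key 1 2 (by decide) hm)
  rw [norm_sq_three, tr_apply] at h
  nlinarith

/-- There is no quadratic term: `cof n n` has eigenvalues `|n|²`, `|n|²`, `0`, so Tartar's form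
vanishes on it. -/
theorem tartar_add_cof (σ : Sym 3) (n : Fin 3 → ℝ) (s : ℝ) :
    tartar (σ + s • cof n n) = tartar σ - 4 * s * (n ⬝ᵥ σ.mat.mulVec n) := by
  have s1 := σ.mat_symm 1 0
  have s2 := σ.mat_symm 2 0
  have s3 := σ.mat_symm 2 1
  simp only [tartar, norm_sq_three, tr_apply, Sym.mat_add, Sym.mat_smul, Matrix.add_apply,
    Matrix.smul_apply, cof_mat, smul_eq_mul, Matrix.mulVec, dotProduct, Fin.sum_univ_three, s1, s2,
    s3]
  simp
  ring

theorem pressure_add_cof (σ : Sym 3) (n : Fin 3 → ℝ) (s : ℝ) :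
    pressure (σ + s • cof n n) = pressure σ + s * (2 * (n ⬝ᵥ n) / 3) := by
  simp only [pressure_eq, map_add, map_smul, smul_eq_mul]
  simp only [tr_apply, cof_mat, dotProduct, Fin.sum_univ_three, if_true]
  ring

/-- A point of a branch of a hyperbola which is not too steep there splits along a rank-two
direction into points with prescribed pressure on the hyperbola. -/
theorem exists_cof_split {σ : Sym 3} {α β p₁ p₂ : ℝ} (ht : tartar σ = α * pressure σ + β)
    (hs : (6 * pressure σ + α) ^ 2 ≤ 3 * (3 * pressure σ ^ 2 + α * pressure σ + β))
    (h1 : p₁ < pressure σ) (h2 : pressure σ < p₂) :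
    ∃ (A₁ A₂ : Sym 3) (n : Fin 3 → ℝ) (a lam : ℝ), 0 ≤ lam ∧ lam ≤ 1 ∧
      σ = lam • A₁ + (1 - lam) • A₂ ∧ A₁ - A₂ = a • cof n n ∧ pressure A₁ = p₁ ∧
      pressure A₂ = p₂ ∧ tartar A₁ = α * p₁ + β ∧ tartar A₂ = α * p₂ + β := by
  -- With `M = σ + (α/6) Id`, the quantity `tartar - α * pressure` is affine along `cof n n` with
  -- slope `-4 n · M n`, so an isotropic `n` preserves the hyperbola. Given `ht`, the condition `(tr
  -- M)² ≤ |M|²` is equivalent to `hs`.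
  obtain ⟨n, hn, hn0⟩ := exists_isotropic (M := σ + (α / 6) • idSym) (by
    have e1 : ‖σ + (α / 6) • idSym‖ ^ 2 = ‖σ‖ ^ 2 + α / 3 * tr σ + α ^ 2 / 12 := by
      rw [norm_sq_three, norm_sq_three, tr_apply]; simp; ring
    have e2 : tr (σ + (α / 6) • idSym) = tr σ + α / 2 := by
      rw [tr_apply, tr_apply]; simp; ring
    rw [pressure_eq, tartar] at ht
    rw [pressure_eq] at hs
    rw [e1, e2]
    linarith)
  have hnn : 0 < n ⬝ᵥ n := by
    refine lt_of_le_of_ne (Finset.sum_nonneg fun i _ => mul_self_nonneg _) fun h => hn ?_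
    exact dotProduct_self_eq_zero.1 h.symm
  have hq : n ⬝ᵥ σ.mat.mulVec n = -(α / 6) * (n ⬝ᵥ n) := by
    simp only [Sym.mat_add, Sym.mat_smul, idSym_mat, Matrix.add_mulVec, Matrix.smul_mulVec,
      Matrix.one_mulVec, dotProduct_add, dotProduct_smul, smul_eq_mul] at hn0
    linarith
  set p := pressure σ with hp
  set d := 2 * (n ⬝ᵥ n) / 3 with hd
  have hd0 : 0 < d := by positivity
  have hP : ∀ x, pressure (σ + ((x - p) / d) • cof n n) = x := fun x => by
    rw [pressure_add_cof, ← hp, ← hd]; field_simp; ring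
  have hT : ∀ x, tartar (σ + ((x - p) / d) • cof n n) = α * x + β := fun x => by
    rw [tartar_add_cof, hq, ht, hd]; field_simp; ring
  have hpp : 0 < p₂ - p₁ := by linarith
  refine ⟨σ + ((p₁ - p) / d) • cof n n, σ + ((p₂ - p) / d) • cof n n, n, (p₁ - p₂) / d,
    (p₂ - p) / (p₂ - p₁), div_nonneg (by linarith) hpp.le, (div_le_one hpp).2 (by linarith), ?_,
    ?_, hP _, hP _, hT _, hT _⟩
  · match_scalars <;> field_simp <;> ring
  · match_scalars <;> field_simp <;> ring

end Directions

end

end SymDivQC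

namespace SymDivQC

noncomputable section

attribute [local instance] Matrix.frobeniusNormedAddCommGroup Matrix.frobeniusNormedSpace

/-! ### Identification of the hulls -/

section Main

variable {H : Set (ℝ × ℝ)}

theorem exists_Phi_eq {z : ℝ × ℝ} (hz : 0 ≤ z.2) : ∃ σ, Phi σ = z := by
  have hp : pressure (z.1 • idSym) = z.1 := by simp [pressure_eq, tr_apply]; ring
  refine ⟨z.1 • idSym + z.2 • shearDir, Phi_eq_of_tartar hz ?_ ?_⟩
  · rw [pressure_add_shearDir, hp]
  · rw [tartar_add_shearDir, tartar, norm_sq_three, tr_apply, wfun]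
    simp
    ring

theorem isCompact_Phi_preimage (hHc : IsCompact H) : IsCompact {σ | Phi σ ∈ H} := by
  obtain ⟨R, hR⟩ := hHc.isBounded.exists_norm_le
  refine Metric.isCompact_of_isClosed_isBounded (hHc.isClosed.preimage continuous_Phi)
    (isBounded_iff_forall_norm_le.2 ⟨√(5 * R ^ 2), fun σ hσ => Real.le_sqrt_of_sq_le ?_⟩)
  have h1 : |pressure σ| ≤ R := (norm_fst_le (Phi σ)).trans (hR _ hσ)
  have h2 : |shear σ| ≤ R := (norm_snd_le (Phi σ)).trans (hR _ hσ)
  have h3 := sq_le_sq' (abs_le.1 h1).1 (abs_le.1 h1).2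
  have h4 := sq_le_sq' (abs_le.1 h2).1 (abs_le.1 h2).2
  have h5 := shear_sq σ
  have h6 : tr σ = 3 * pressure σ := by rw [pressure_eq]; ring
  rw [h6] at h5
  linarith

/-- Points that satisfy all inequalities of Tartar type and of convex type on `{Φ ∈ H}` are mapped
to `H^sdqc`. -/
theorem Phi_mem_Hsdqc (hH : ∀ y ∈ H, 0 ≤ y.2) (hHc : IsCompact H) (hHn : H.Nonempty) {ξ : Sym 3}
    (ht : ∀ α c : ℝ, (∀ κ, Phi κ ∈ H → tartar κ + α * tr κ ≤ c) → tartar ξ + α * tr ξ ≤ c)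
    (hF : ∀ F : Sym 3 → ℝ, ConvexOn ℝ univ F → Continuous F →
      (∃ L : ℝ, ∀ σ κ, F σ ≤ F κ + L * dist σ κ) → (∀ κ, Phi κ ∈ H → F κ ≤ 0) → F ξ ≤ 0) :
    Phi ξ ∈ Hsdqc H := by
  have hsep : ¬ Separated H (Phi ξ) := by
    rw [not_separated_iff]
    intro α
    have hc : Continuous fun z : ℝ × ℝ => wfun z + α * z.1 := by
      have := continuous_wfun; fun_prop
    obtain ⟨z, hz, hmax⟩ := hHc.exists_isMaxOn hHn hc.continuousOn
    have e : ∀ σ, wfun (Phi σ) + α * (Phi σ).1 = tartar σ + α / 3 * tr σ := fun σ => by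
      rw [wfun_Phi, Phi, pressure_eq]; ring
    refine ⟨z, hz, ?_⟩
    rw [e]
    exact ht (α / 3) _ fun κ hκ => by rw [← e]; exact hmax hκ
  refine ⟨?_, hsep⟩
  have hq : 0 ≤ (Phi ξ).2 := shear_nonneg ξ
  by_cases hl : ∃ z ∈ H, z.1 < (Phi ξ).1
  · by_cases hr : ∃ z ∈ H, (Phi ξ).1 < z.1
    · obtain ⟨s, t, hst, u₁, hu₁, u₂, hu₂, h1, h2, e1, e2⟩ := exists_support_line hHc hl hr
      -- The function `q - (s p + t)` is convex and Lipschitz in the matrix, being a norm of the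
      -- deviatoric part plus an affine function, and it is nonpositive on `K`.
      have hle : (Phi ξ).2 ≤ s * (Phi ξ).1 + t := by
        have hconv : ConvexOn ℝ univ fun σ => (1 / √2) * ‖dev σ‖ + ((-s / 3) * tr σ - t) := by
          have c1 : ConvexOn ℝ univ fun σ : Sym 3 => ‖dev σ‖ :=
            convexOn_univ_norm.comp_linearMap dev.toLinearMap
          have c2 : ConvexOn ℝ univ fun σ : Sym 3 => (-s / 3) * tr σ - t := by
            have := (((-s / 3) • tr).toLinearMap.convexOn convex_univ).add
              (convexOn_const (-t) convex_univ)
            exact this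
          exact (c1.smul (by positivity : (0 : ℝ) ≤ 1 / √2)).add c2
        have e : ∀ σ, (1 / √2) * ‖dev σ‖ + ((-s / 3) * tr σ - t) =
            (Phi σ).2 - (s * (Phi σ).1 + t) := fun σ => by
          rw [Phi, shear_eq, pressure_eq]; ring
        have := hF _ hconv (by fun_prop) ⟨1 / √2 * ‖dev‖ + |(-s / 3)| * ‖tr‖, fun σ κ => ?_⟩
          fun κ hκ => by rw [e]; linarith [hst _ hκ]
        · rw [e] at this; linarith
        · have n1 := norm_le_norm_add_norm_sub' (dev σ) (dev κ)
          rw [← map_sub] at n1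
          have n2 := dev.le_opNorm (σ - κ)
          have n3 : (-s / 3) * tr (σ - κ) ≤ |(-s / 3)| * (‖tr‖ * ‖σ - κ‖) :=
            (le_abs_self _).trans (by rw [abs_mul]; gcongr; exact tr.le_opNorm _)
          rw [map_sub] at n3
          have n4 : 1 / √2 * ‖dev σ‖ ≤ 1 / √2 * (‖dev κ‖ + ‖dev‖ * ‖σ - κ‖) := by
            gcongr; linarith
          rw [dist_eq_norm]
          linarith
      rcases h1.eq_or_lt with h1 | h1
      · have hu : ((Phi ξ).1, u₁.2) ∈ hat H := by rw [← h1]; exact subset_hat hH hu₁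
        exact subset_convexHull ℝ _ (hat_of_le hu hq (by rw [e1, h1]; exact hle))
      rcases h2.eq_or_lt with h2 | h2
      · have hu : ((Phi ξ).1, u₂.2) ∈ hat H := by rw [h2]; exact subset_hat hH hu₂
        exact subset_convexHull ℝ _ (hat_of_le hu hq (by rw [e2, ← h2]; exact hle))
      exact mem_convexHull_of_chord hH hu₁ hu₂ e1 e2 h1 h2 hq hle
    · push Not at hr
      exact subset_convexHull ℝ _ (mem_hat_of_extreme hH hHc hq hsep (s := -1) (by norm_num)
        fun z hz => by have := hr z hz; linarith)
  · push Not at hl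
    exact subset_convexHull ℝ _ (mem_hat_of_extreme hH hHc hq hsep one_ne_zero
      fun z hz => by have := hl z hz; linarith)

/-- Below `H` one shear raises `q` to a point of `H`. Below a hyperbola, the shear raises `q` to the
hyperbola at the same pressure, and each of the two matrices then splits along a rank-two direction
into matrices over the end points `z₁, z₂ ∈ H`. -/
theorem isApproximable_of_mem_Hsdqc (hH : ∀ y ∈ H, 0 ≤ y.2) (hHc : IsCompact H)
    (hconn : IsConnected (Hsdqc H))
    (htan : ∀ y ∈ frontier (Hsdqc H) \ hat H,
      ∀ e ∈ tangentConeAt ℝ (frontier (Hsdqc H)) y, |e.2| ≤ √3 / 4 * |e.1|)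
    {ξ : Sym 3} (hξ : Phi ξ ∈ Hsdqc H) : IsApproximable {σ | Phi σ ∈ H} ξ := by
  rcases exists_hyperbola hH hHc hconn htan hξ with ⟨hq, a, ha, hmem⟩ |
    ⟨α, β, z₁, hz₁, z₂, hz₂, h1, h2, w1, w2, hw, hs⟩
  · have hle : tartar ξ ≤ wfun ((Phi ξ).1, (Phi ξ).2 + a) := by
      rw [← wfun_Phi, wfun, wfun]
      nlinarith
    obtain ⟨A, B, lam, h0, h1, e, pA, pB, tA, tB, hC⟩ := exists_shear_split hle
    have hA : Phi A ∈ H := by rwa [Phi_eq_of_tartar (hH _ hmem) pA tA]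
    have hB : Phi B ∈ H := by rwa [Phi_eq_of_tartar (hH _ hmem) pB tB]
    rw [e]
    -- A simple laminate is a second order one whose inner splittings are trivial.
    exact isApproximable_laminate (n := 0) (m := 0) (a := 0) (b := 0) (lamA := 1) (lamB := 1) hA hA
      hB hB (by simp) (by simp) h0 h1 zero_le_one le_rfl zero_le_one le_rfl (by simp) (by simp) hC
  · rw [wfun_Phi] at hw
    obtain ⟨A, B, lam, h0', h1', e, pA, pB, tA, tB, hC⟩ := exists_shear_split hw
    have split : ∀ C : Sym 3, pressure C = pressure ξ → tartar C = α * pressure ξ + β → _ :=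
      fun C pC tC => exists_cof_split (σ := C) (α := α) (β := β) (p₁ := z₁.1) (p₂ := z₂.1)
        (by rw [pC]; exact tC) (by rw [pC]; exact hs) (by rw [pC]; exact h1) (by rw [pC]; exact h2)
    obtain ⟨A₁, A₂, n, a, la, a0, a1, eA, dA, pA₁, pA₂, tA₁, tA₂⟩ := split A pA tA
    obtain ⟨B₁, B₂, m, b, lb, b0, b1, eB, dB, pB₁, pB₂, tB₁, tB₂⟩ := split B pB tB
    have hm₁ : ∀ C, pressure C = z₁.1 → tartar C = α * z₁.1 + β → Phi C ∈ H := fun C p t => by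
      rwa [Phi_eq_of_tartar (hH _ hz₁) p (by rw [t, w1])]
    have hm₂ : ∀ C, pressure C = z₂.1 → tartar C = α * z₂.1 + β → Phi C ∈ H := fun C p t => by
      rwa [Phi_eq_of_tartar (hH _ hz₂) p (by rw [t, w2])]
    rw [e]
    exact isApproximable_laminate (hm₁ _ pA₁ tA₁) (hm₂ _ pA₂ tA₂) (hm₁ _ pB₁ tB₁) (hm₂ _ pB₂ tB₂)
      dA dB h0' h1' a0 a1 b0 b1 eA eB hC

end Main

end

end SymDivQC

theorem mainTheorem2 (H : Set (ℝ × ℝ)) (hH : ∀ y ∈ H, 0 ≤ y.2) (hHc : IsCompact H)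
    (hconn : IsConnected (SymDivQC.Hsdqc H))
    (htan : ∀ y ∈ frontier (SymDivQC.Hsdqc H) \ SymDivQC.hat H,
      ∀ e ∈ tangentConeAt ℝ (frontier (SymDivQC.Hsdqc H)) y, |e.2| ≤ √3 / 4 * |e.1|) :
    (∀ p : ℝ, 1 < p →
      SymDivQC.hull p {σ : SymDivQC.Sym 3 | SymDivQC.Phi σ ∈ H} =
        {σ | SymDivQC.Phi σ ∈ SymDivQC.Hsdqc H}) ∧
    SymDivQC.hullInfty {σ : SymDivQC.Sym 3 | SymDivQC.Phi σ ∈ H} =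
      {σ | SymDivQC.Phi σ ∈ SymDivQC.Hsdqc H} := by
  have hHn : H.Nonempty := by
    obtain ⟨y, hy⟩ := hconn.nonempty
    obtain ⟨z, -, a, -, hz⟩ := convexHull_nonempty_iff.1 ⟨y, hy.1⟩
    exact ⟨_, hz⟩
  have hK := SymDivQC.isCompact_Phi_preimage hHc
  have hKn : {σ | SymDivQC.Phi σ ∈ H}.Nonempty := by
    obtain ⟨z, hz⟩ := hHn
    obtain ⟨σ, hσ⟩ := SymDivQC.exists_Phi_eq (hH z hz)
    exact ⟨σ, by rwa [mem_ofPred_eq, hσ]⟩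
  refine ⟨fun p hp => Subset.antisymm (fun ξ hξ => ?_) fun ξ hξ => ?_,
    Subset.antisymm (fun ξ hξ => ?_) fun ξ hξ => ?_⟩
  · exact SymDivQC.Phi_mem_Hsdqc hH hHc hHn
      (fun α c h => SymDivQC.tartar_hull hp hK hKn h hξ)
      fun F h1 h2 ⟨L, hL⟩ h3 => SymDivQC.convex_hull_le hp hK hKn h1 h2 hL h3 hξ
  · exact (SymDivQC.isApproximable_of_mem_Hsdqc hH hHc hconn htan hξ).mem_hull hKn hp
  · exact SymDivQC.Phi_mem_Hsdqc hH hHc hHn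
      (fun α c h => SymDivQC.tartar_hullInfty hKn h hξ)
      fun F h1 h2 _ h3 => SymDivQC.convex_hullInfty_le hKn h1 h2 h3 hξ
  · exact (SymDivQC.isApproximable_of_mem_Hsdqc hH hHc hconn htan hξ).mem_hullInfty hK hKn
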